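/- **Setting.** Let $\chi,\bar\alpha,g_0,g_1>0$, $k\ge 1$, and put $\bar g_x=g_0+g_1\log^{\chi}(x+1)$. Let $\bar J:\mathbb{N}\to[0,\infty)$ satisfy $\bar J(0)=1$ and $(r^2+1)\bar J(r)\le 1/(r^{\bar\alpha}+1)$ for all $r$, and let $\eta_1,\eta_2\ge 1$ satisfy, for $p=1,2$ and all integers $r,y_0\ge 0$, $$\sum_{y\ge y_0}\bar g_{r+y}\,(y^{p-1}+1)\,\bar J(y)\le \eta_p\,\bar g_{r+y_0}\,(y_0^p+1)\,\bar J(y_0)\qquad(0^0=1).$$ Let $\Lambda\subset\mathbb{Z}$ be finite. The boson number at site $x\in\Lambda$ is truncated at some $N_x\in\mathbb{N}$, so that the Hilbert space is $\bigotimes_{x\in\Lambda}\mathbb{C}^{N_x+1}$. Let $\bar H=\sum_{Z\subseteq\Lambda,\,|Z|\le k}\bar h_Z$, where $\bar h_Z$ is self-adjoint and supported on $Z$, and for all $i,i'\in\Lambda$ and all integers $x\ge 0$ $$\sum_{Z\ni i,i',\ Z\subset[-x,x]}\|\bar h_Z\|\le \bar g_x\,\bar J(|i-i'|).$$ Let $q\ge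 2$ be even and $l\ge1$. For $0\le s\le q+1$ put $W_s=\Lambda\cap[-\tfrac{ql}{2}+(s-1)l,\,-\tfrac{ql}{2}+sl)$, and let $B_s=W_s$ for $1\le s\le q$, $B_0=\Lambda\cap(-\infty,-\tfrac{ql}{2})$, $B_{q+1}=\Lambda\cap[\tfrac{ql}{2},\infty)$. The interaction-truncated Hamiltonian is $$H_t=\sum_{s=0}^{q+1}h_s+\sum_{s=0}^{q}h_{s,s+1},$$ where $h_s$ is the sum of the $\bar h_Z$ with $\emptyset\ne Z\subseteq B_s$, and $h_{s,s+1}$ is the sum of the $\bar h_Z$ with $Z\subseteq W_s\cup W_{s+1}$ that meet both $W_s$ and $W_{s+1}$. For $\tau\in\mathbb{R}$ let $E_{s,0}$ be the lowest eigenvalue of $h_s$, let $\Pi^{(s)}_{\le\tau_s}$ be the spectral projection of $h_s$ onto energies at most $\tau_s=E_{s,0}+\tau$, and let $\tilde\Pi=\bigotimes_{s=0}^{q+1}\Pi^{(s)}_{\le\tau_s}$ and $\tilde H_t=\tilde\Pi H_t\tilde\Pi$, regarded as an operator on the range of $\tilde\Pi$. Let $\Delta_t$ and $\tilde\Delta_t$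 be the spectral gaps of $H_t$ and $\tilde H_t$ (second lowest minus lowest eigenvalue, counted with multiplicity). **Constants.** Let $c_0=4\eta_1\eta_2\bar J(1)$, $\tilde c_1=\dfrac{2^{\chi+3}\,4k\eta_1}{1-2^{-\bar\alpha}}$, $\tilde c_2=\tilde c_1\Big[\dfrac{2\chi(2+\bar\alpha)}{\bar\alpha}\Big]^{\chi}$, $\tilde c_3=2^{\bar\alpha}+\dfrac{2(2+\bar\alpha)}{\bar\alpha}$, $\tilde T_z=(2c_0\tilde c_3+\tilde c_1)\bar g_{z+ql}$, $T_0=\tilde T_0=(2c_0\tilde c_3+\tilde c_1)\bar g_{ql}$, $$\mu_1=1+\int_0^\infty(z+3)\exp\Big[-\frac{1}{4e}\,\frac{z}{1+\log^\chi(z+3)}\Big]dz,\qquad \mu_2=1+\int_0^\infty(z+3)\exp\Big[-\Big(\frac{2c_0\tilde c_3+\tilde c_1}{4e\tilde c_2}\,z\Big)^{1/(1+\chi)}\Big]dz,$$ $$\mathcal{E}_y=\mu_1\exp\Big(-\frac{y}{4e\,\tilde T_{y/T_0}}\Big)+\mu_2\exp\Big[-\Big(\frac{y}{4e\tilde c_2g_1}\Big)^{1/(1+\chi)}\Big]\qquad(y\ge0),$$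 $$\varepsilon_1=2q\,\mathcal{E}_{\tau-4c_0\bar g_{ql}-8T_0},\qquad \varepsilon_2=\sqrt{\frac{\varepsilon_1}{1-\varepsilon_1}\,2q\,(\tau+2c_0\bar g_{ql})}.$$ **Theorem.** (a) The errors decay sub-exponentially in the cutoff energy: as $\tau\to\infty$, $$\varepsilon_1=O\Big(\exp\Big[-\Big(\frac{\tau}{4e\tilde c_2g_1}\Big)^{1/(1+\chi)}\Big]\Big),\qquad \varepsilon_2=O\Big(\sqrt\tau\,\exp\Big[-\frac12\Big(\frac{\tau}{4e\tilde c_2g_1}\Big)^{1/(1+\chi)}\Big]\Big).$$ Now let $\tau$ be such that $\tau-4c_0\bar g_{ql}-8T_0\ge 0$ and $\varepsilon_1^2\le\tfrac12$. (b) If moreover $2\varepsilon_2^2<\Delta_t$, then any normalized ground states $|\Omega_t\rangle$ of $H_t$ and $|\tilde\Omega_t\rangle$ of $\tilde H_t$ satisfy, after multiplication of $|\tilde\Omega_t\rangle$ by a suitable phase factor, $$\big\||\Omega_t\rangle-|\tilde\Omega_t\rangle\big\|\le\sqrt2\,\varepsilon_1+\frac{\sqrt{2\Delta_t}}{\Delta_t-2\varepsilon_2^2}\,\varepsilon_2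 .$$ (c) If the range of $\tilde\Pi$ has dimension at least $2$ (so that $\tilde\Delta_t$ is defined), then $$\tilde\Delta_t\ge(1-\varepsilon_1^2)\,\Delta_t-2\varepsilon_2^2 .$$ -/

import Mathlib

open scoped BigOperators

/-! ### Parameters and constants -/

/-- Numerical data of the one-dimensional model: interaction order `k`, exponents `χ` and `α`
(the decay exponent written `ᾱ`), interaction strengths `g₀, g₁`, summation constants `η₁, η₂`,
and the distance profile `J` of the interaction. -/
structure ChainParams where
  k : ℕ
  χ : ℝ
  α : ℝ
  g₀ : ℝ
  g₁ : ℝ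
  η₁ : ℝ
  η₂ : ℝ
  J : ℕ → ℝ

namespace ChainParams

variable (p : ChainParams)

/-- `ḡ_x = g₀ + g₁ log^χ (x + 1)`. -/
noncomputable def gbar (x : ℝ) : ℝ := p.g₀ + p.g₁ * Real.log (x + 1) ^ p.χ

/-- The inequality that characterizes `η_e`:
`∑_{y ≥ y₀} ḡ_{r+y} (y^{e-1} + 1) J(y) ≤ η ḡ_{r+y₀} (y₀^e + 1) J(y₀)` for all `r, y₀`.
All terms are nonnegative, so the series is bounded through its partial sums. -/
def EtaBound (e : ℕ) (η : ℝ) : Prop :=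
  ∀ r y₀ n : ℕ,
    ∑ y ∈ Finset.Ico y₀ n, p.gbar ((r : ℝ) + y) * ((y : ℝ) ^ (e - 1) + 1) * p.J y
      ≤ η * p.gbar ((r : ℝ) + y₀) * ((y₀ : ℝ) ^ e + 1) * p.J y₀

/-- `c₀ = 4 η₁ η₂ J(1)`. -/
noncomputable def c₀ : ℝ := 4 * p.η₁ * p.η₂ * p.J 1

/-- `c̃₁ = 2^{χ+3} 4 k η₁ / (1 - 2^{-α})`. -/
noncomputable def c₁ : ℝ :=
  (2 : ℝ) ^ (p.χ + 3) * 4 * p.k * p.η₁ / (1 - (2 : ℝ) ^ (-p.α))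

/-- `c̃₂ = c̃₁ [2 χ (2 + α) / α]^χ`. -/
noncomputable def c₂ : ℝ := p.c₁ * (2 * p.χ * (2 + p.α) / p.α) ^ p.χ

/-- `c̃₃ = 2^α + 2 (2 + α) / α`. -/
noncomputable def c₃ : ℝ := (2 : ℝ) ^ p.α + 2 * (2 + p.α) / p.α

/-- `T_m = (2 c₀ c̃₃ + c̃₁) ḡ_{m + q l} + c̃₂ g₁ m^χ`. -/
noncomputable def T (q l m : ℕ) : ℝ :=
  (2 * p.c₀ * p.c₃ + p.c₁) * p.gbar ((m : ℝ) + (q : ℝ) * l) + p.c₂ * p.g₁ * (m : ℝ) ^ p.χ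

/-- `T̃_z = (2 c₀ c̃₃ + c̃₁) ḡ_{z + q l}`. -/
noncomputable def Ttilde (q l : ℕ) (z : ℝ) : ℝ :=
  (2 * p.c₀ * p.c₃ + p.c₁) * p.gbar (z + (q : ℝ) * l)

noncomputable def μ₁ : ℝ :=
  1 + ∫ z in Set.Ioi (0 : ℝ),
    (z + 3) * Real.exp (-(1 / (4 * Real.exp 1) * (z / (1 + Real.log (z + 3) ^ p.χ))))

noncomputable def μ₂ : ℝ :=
  1 + ∫ z in Set.Ioi (0 : ℝ),
    (z + 3) * Real.exp
      (-(((2 * p.c₀ * p.c₃ + p.c₁) / (4 * Real.exp 1 * p.c₂) * z) ^ (1 / (1 + p.χ))))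

/-- The sub-exponentially decaying function `𝓔_y`, for `y ≥ 0`. -/
noncomputable def errorFn (q l : ℕ) (y : ℝ) : ℝ :=
  p.μ₁ * Real.exp (-(y / (4 * Real.exp 1 * p.Ttilde q l (y / p.T q l 0))))
    + p.μ₂ * Real.exp (-((y / (4 * Real.exp 1 * p.c₂ * p.g₁)) ^ (1 / (1 + p.χ))))

/-- The shifted cutoff `τ - 4 c₀ ḡ_{q l} - 8 T₀`. -/
noncomputable def shiftedCutoff (q l : ℕ) (τ : ℝ) : ℝ :=
  τ - 4 * p.c₀ * p.gbar ((q : ℝ) * l) - 8 * p.T q l 0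

/-- `ε₁ = 2 q 𝓔_{τ - 4 c₀ ḡ_{q l} - 8 T₀}`. -/
noncomputable def eps₁ (q l : ℕ) (τ : ℝ) : ℝ :=
  2 * q * p.errorFn q l (p.shiftedCutoff q l τ)

/-- `ε₂ = √(ε₁ / (1 - ε₁) · 2 q (τ + 2 c₀ ḡ_{q l}))`. -/
noncomputable def eps₂ (q l : ℕ) (τ : ℝ) : ℝ :=
  Real.sqrt (p.eps₁ q l τ / (1 - p.eps₁ q l τ)
    * (2 * q * (τ + 2 * p.c₀ * p.gbar ((q : ℝ) * l))))

end ChainParams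

/-! ### The boson-number-truncated chain -/

/-- Occupation-number configurations on the finite set of sites `Λ ⊆ ℤ`, with at most `N x` bosons
at the site `x`. -/
abbrev Config (Λ : Finset ℤ) (N : ℤ → ℕ) : Type := (x : Λ) → Fin (N x + 1)

/-- The Hilbert space `⨂_{x ∈ Λ} ℂ^{N x + 1}`, with its occupation-number basis. -/
abbrev ChainSpace (Λ : Finset ℤ) (N : ℤ → ℕ) : Type := EuclideanSpace ℂ (Config Λ N)

abbrev ChainOp (Λ : Finset ℤ) (N : ℤ → ℕ) : Type := ChainSpace Λ N →L[ℂ] ChainSpace Λ N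

/-- `O` is supported on `Z`, that is `O = A ⊗ 1` with an operator `A` on `⨂_{x ∈ Z} ℂ^{N x + 1}`,
expressed through matrix elements in the occupation-number basis. -/
def SupportedOn {Λ : Finset ℤ} {N : ℤ → ℕ} (O : ChainOp Λ N) (Z : Finset Λ) : Prop :=
  ∃ A : Matrix ((x : Z) → Fin (N (x : Λ) + 1)) ((x : Z) → Fin (N (x : Λ) + 1)) ℂ,
    (∀ m n : Config Λ N, (∀ x, x ∉ Z → m x = n x) →
      (O (EuclideanSpace.single n 1)) m = A (fun x => m x) (fun x => n x)) ∧
    (∀ m n : Config Λ N, (∃ x, x ∉ Z ∧ m x ≠ n x) →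
      (O (EuclideanSpace.single n 1)) m = 0)

/-! ### Blocks and the interaction-truncated Hamiltonian -/

/-- The interval `[-ql/2 + (s-1) l, -ql/2 + s l)` of length `l`. For `1 ≤ s ≤ q` it is the block
`B_s`; for `s = 0` and `s = q + 1` it is the part `B̃_s` of the edge block next to the bulk. -/
def window (q l s : ℕ) : Set ℤ :=
  Set.Ico (-((q : ℤ) * l / 2) + ((s : ℤ) - 1) * l) (-((q : ℤ) * l / 2) + (s : ℤ) * l)

/-- The blocks `B_0, …, B_{q+1}`: the edge blocks `B_0` and `B_{q+1}` reach to the two ends. -/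
def block (q l s : ℕ) : Set ℤ :=
  if s = 0 then Set.Iio (-((q : ℤ) * l / 2))
  else if s = q + 1 then Set.Ici ((q : ℤ) * l / 2)
  else window q l s

section Hamiltonians

variable {Λ : Finset ℤ} {N : ℤ → ℕ}

open Classical in
/-- `h_s`: all the terms supported on the block `B_s`. -/
noncomputable def blockHam (h : Finset Λ → ChainOp Λ N) (q l s : ℕ) : ChainOp Λ N :=
  ∑ Z : Finset Λ with Z.Nonempty ∧ ∀ x : Λ, x ∈ Z → (x : ℤ) ∈ block q l s, h Z

open Classical in
/-- `h_{s,s+1}`: the terms inside `window s ∪ window (s+1)` that meet both windows. -/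
noncomputable def linkHam (h : Finset Λ → ChainOp Λ N) (q l s : ℕ) : ChainOp Λ N :=
  ∑ Z : Finset Λ with
      (∀ x : Λ, x ∈ Z → (x : ℤ) ∈ window q l s ∪ window q l (s + 1)) ∧
      (∃ x : Λ, x ∈ Z ∧ (x : ℤ) ∈ window q l s) ∧
      (∃ x : Λ, x ∈ Z ∧ (x : ℤ) ∈ window q l (s + 1)),
    h Z

/-- `H_t = ∑_{s=0}^{q+1} h_s + ∑_{s=0}^{q} h_{s,s+1}`. -/
noncomputable def truncHam (h : Finset Λ → ChainOp Λ N) (q l : ℕ) : ChainOp Λ N :=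
  ∑ s ∈ Finset.range (q + 2), blockHam h q l s + ∑ s ∈ Finset.range (q + 1), linkHam h q l s

/-! ### Spectral notions -/

/-- For self-adjoint `A` and an `A`-invariant subspace `W`, the span of the eigenvectors of
`A` in `W` with eigenvalue at most `E`. -/
noncomputable def spectralSubspace (A : ChainOp Λ N) (W : Submodule ℂ (ChainSpace Λ N)) (E : ℝ) :
    Submodule ℂ (ChainSpace Λ N) :=
  ⨆ μ : ℝ, ⨆ _ : μ ≤ E,
    Module.End.eigenspace (A : ChainSpace Λ N →ₗ[ℂ] ChainSpace Λ N) (μ : ℂ) ⊓ W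

/-- The `j`-th smallest eigenvalue (from `j = 0`, counted with multiplicity) of the restriction of
`A` to the invariant subspace `W`; meaningful when `j < dim W`. -/
noncomputable def energyLevel (A : ChainOp Λ N) (W : Submodule ℂ (ChainSpace Λ N)) (j : ℕ) : ℝ :=
  sInf {E : ℝ | j < Module.finrank ℂ (spectralSubspace A W E)}

/-- The spectral gap of `A` restricted to `W`; meaningful when `2 ≤ dim W`. -/
noncomputable def spectralGap (A : ChainOp Λ N) (W : Submodule ℂ (ChainSpace Λ N)) : ℝ :=
  energyLevel A W 1 - energyLevel A W 0

/-- `ψ` is a normalized ground state of `A` restricted to `W`. -/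
def IsGroundState (A : ChainOp Λ N) (W : Submodule ℂ (ChainSpace Λ N))
    (ψ : ChainSpace Λ N) : Prop :=
  ψ ∈ W ∧ ‖ψ‖ = 1 ∧ A ψ = ((energyLevel A W 0 : ℝ) : ℂ) • ψ

/-! ### The energy cutoff -/

/-- `Π^{(s)}_{≤ τ_s}` with `τ_s = E_{s,0} + τ`, as an operator on the whole chain. -/
noncomputable def blockProj (h : Finset Λ → ChainOp Λ N) (q l : ℕ) (τ : ℝ) (s : ℕ) :
    ChainOp Λ N :=
  (spectralSubspace (blockHam h q l s) ⊤
    (energyLevel (blockHam h q l s) ⊤ 0 + τ)).starProjection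

/-- `Π̃ = ⨂_{s=0}^{q+1} Π^{(s)}_{≤ τ_s}`, the product of the block projections (these act on
disjoint blocks and so commute). -/
noncomputable def cutoffProj (h : Finset Λ → ChainOp Λ N) (q l : ℕ) (τ : ℝ) : ChainOp Λ N :=
  ((List.range (q + 2)).map (blockProj h q l τ)).prod

/-- The range of `Π̃`, on which the effective Hamiltonian lives. -/
noncomputable def cutoffSpace (h : Finset Λ → ChainOp Λ N) (q l : ℕ) (τ : ℝ) :
    Submodule ℂ (ChainSpace Λ N) :=
  LinearMap.range (cutoffProj h q l τ : ChainSpace Λ N →ₗ[ℂ] ChainSpace Λ N)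

/-- `H̃_t = Π̃ H_t Π̃`. -/
noncomputable def effHam (h : Finset Λ → ChainOp Λ N) (q l : ℕ) (τ : ℝ) : ChainOp Λ N :=
  cutoffProj h q l τ * truncHam h q l * cutoffProj h q l τ

end Hamiltonians

/-! ### Spectral subspaces and energy levels -/

section Spectral

open scoped InnerProductSpace

variable {Λ : Finset ℤ} {N : ℤ → ℕ}

/-! The heart of the matter is that a ground state of `truncHam` has very little weight above the
cutoff in any single block. Fix a block and write the Hamiltonian as `A + B + V`: `A` is the block,
`V` consists of the at most two links touching it, and `B` is the rest, which commutes with `A` and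
lives on other sites. A product of ground vectors of `A` and `B` shows that the total ground energy
is at most the sum of theirs plus the strength `v` of `V` (`energyLevel_add_le`). Let `G` be `A`
shifted so that its spectrum starts at `c = 2mD`. If the `j`-fold commutators of `A` with `V` are at
most `v j! D^j` for `j ≤ m`, then `G^m V Ω` has norm at most `2v` times that of `G^m Ω`. Hence `G^m
Ω` has mean block energy at most `3v` above the block ground energy, which bounds the `2m`-th moment
of `G` in `Ω`. Markov's inequality bounds the weight above the cutoff
(`norm_sub_starProjection_le`).

The commutator bound needs care because the strength `ḡ` grows with the distance from the origin. On
a chain of at most `m` commutators a power of logarithm is dominated by a power with exponent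
`1/(2m)`, at the price of a constant of order `m^χ`. The total exponent stays at most `1/2`, so the
sums over distance converge against the decay of `J` (`norm_commutatorMap_pow_le`). Thus `mD` grows
like `m^(1+χ)`, and an order `m` of size `τ^(1/(1+χ))` yields the sub-exponential error
(`Valid.exists_order`).

The block projections commute, so their errors add and `Π̃Ω` is within `ε₁` of `Ω`. Since `Π̃`
commutes with the block Hamiltonians, only the links contribute to the energy cost of this trial
state, which is at most `ε₂²` (`energyLevel_effHam_le`). Min-max gives that compression lowers no
level (`energyLevel_le_of_compression`), so the gap shrinks by at most `ε₂²`. A state whose energy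
excess is small compared with the gap is close to the ground state (`exists_phase_norm_sub_le`). -/

lemma mem_spectralSubspace {A : ChainOp Λ N} {W : Submodule ℂ (ChainSpace Λ N)} {E μ : ℝ}
    (hμ : μ ≤ E) {x : ChainSpace Λ N} (hx : x ∈ W) (hAx : A x = (μ : ℂ) • x) :
    x ∈ spectralSubspace A W E := by
  refine Submodule.mem_iSup_of_mem μ (Submodule.mem_iSup_of_mem hμ ?_)
  exact ⟨Module.End.mem_eigenspace_iff.2 hAx, hx⟩

lemma spectralSubspace_le (A : ChainOp Λ N) (W : Submodule ℂ (ChainSpace Λ N)) (E : ℝ) :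
    spectralSubspace A W E ≤ W :=
  iSup_le fun _ => iSup_le fun _ => inf_le_right

/-- An induction principle: a submodule containing all eigenvectors in `W` with eigenvalue at
most `E` contains the spectral subspace. -/
lemma spectralSubspace_le_of_forall {A : ChainOp Λ N} {W S : Submodule ℂ (ChainSpace Λ N)} {E : ℝ}
    (hS : ∀ μ : ℝ, μ ≤ E → ∀ x ∈ W, A x = (μ : ℂ) • x → x ∈ S) :
    spectralSubspace A W E ≤ S :=
  iSup_le fun μ => iSup_le fun hμ => fun x hx =>
    hS μ hμ x hx.2 (Module.End.mem_eigenspace_iff.1 hx.1)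

lemma IsSelfAdjoint.inner_apply_left {A : ChainOp Λ N} (hA : IsSelfAdjoint A)
    (x y : ChainSpace Λ N) : ⟪A x, y⟫_ℂ = ⟪x, A y⟫_ℂ :=
  hA.isSymmetric x y

lemma IsSelfAdjoint.inner_eigenvectors {A : ChainOp Λ N} (hA : IsSelfAdjoint A) {μ ν : ℝ}
    (hμν : μ ≠ ν) {x y : ChainSpace Λ N} (hx : A x = (μ : ℂ) • x) (hy : A y = (ν : ℂ) • y) :
    ⟪x, y⟫_ℂ = 0 := by
  have h := hA.inner_apply_left x y
  rw [hx, hy, inner_smul_left, inner_smul_right, Complex.conj_ofReal] at h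
  have h' : ((μ : ℂ) - ν) * ⟪x, y⟫_ℂ = 0 := by rw [sub_mul, h, sub_self]
  rcases mul_eq_zero.1 h' with h0 | h0
  · exact absurd (by exact_mod_cast sub_eq_zero.1 h0) hμν
  · exact h0

/-- A self-adjoint operator with an invariant subspace has an orthonormal eigenbasis there. -/
lemma exists_eigenbasis {A : ChainOp Λ N} (hA : IsSelfAdjoint A)
    {W : Submodule ℂ (ChainSpace Λ N)} (hW : ∀ x ∈ W, A x ∈ W) :
    ∃ (n : ℕ) (e : OrthonormalBasis (Fin n) ℂ W) (ev : Fin n → ℝ),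
      ∀ i, A (e i : ChainSpace Λ N) = (ev i : ℂ) • (e i : ChainSpace Λ N) := by
  have hs := LinearMap.IsSymmetric.restrict_invariant
    (T := (A : ChainSpace Λ N →ₗ[ℂ] ChainSpace Λ N)) hA.isSymmetric hW
  refine ⟨_, hs.eigenvectorBasis rfl, hs.eigenvalues rfl, fun i => ?_⟩
  have := congrArg Subtype.val (hs.apply_eigenvectorBasis rfl i)
  simpa using this

lemma inner_apply_eq_sum {A : ChainOp Λ N} {W : Submodule ℂ (ChainSpace Λ N)} {n : ℕ}
    (hA : IsSelfAdjoint A) (e : OrthonormalBasis (Fin n) ℂ W) (ev : Fin n → ℝ)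
    (he : ∀ i, A (e i : ChainSpace Λ N) = (ev i : ℂ) • (e i : ChainSpace Λ N))
    (hW : ∀ x ∈ W, A x ∈ W) {x : ChainSpace Λ N} (hx : x ∈ W) :
    RCLike.re ⟪x, A x⟫_ℂ = ∑ i, ev i * ‖⟪(e i : ChainSpace Λ N), x⟫_ℂ‖ ^ 2 := by
  have h1 := e.sum_inner_mul_inner ⟨x, hx⟩ ⟨A x, hW x hx⟩
  simp only [Submodule.coe_inner] at h1
  rw [← h1, map_sum]
  refine Finset.sum_congr rfl fun i _ => ?_
  rw [← hA.inner_apply_left, he, inner_smul_left, Complex.conj_ofReal, mul_left_comm,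
    ← inner_conj_symm x, RCLike.conj_mul]
  norm_cast
  exact Complex.re_ofReal_mul _ _

lemma norm_sq_eq_sum {W : Submodule ℂ (ChainSpace Λ N)} {n : ℕ}
    (e : OrthonormalBasis (Fin n) ℂ W) {x : ChainSpace Λ N} (hx : x ∈ W) :
    ‖x‖ ^ 2 = ∑ i, ‖⟪(e i : ChainSpace Λ N), x⟫_ℂ‖ ^ 2 := by
  have h1 := e.sum_sq_norm_inner_right ⟨x, hx⟩
  simp only [Submodule.coe_inner] at h1
  rw [h1]; rfl

/-- Only eigenvectors with eigenvalue above `E` occur in the expansion of `x`, and at least one does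
occur. The strictness is what the dimension count in the variational principle needs. -/
lemma lt_inner_of_mem_orthogonal {A : ChainOp Λ N} (hA : IsSelfAdjoint A)
    {W : Submodule ℂ (ChainSpace Λ N)} (hW : ∀ x ∈ W, A x ∈ W) {E : ℝ} {x : ChainSpace Λ N}
    (hx : x ∈ W) (hx' : x ∈ (spectralSubspace A W E)ᗮ) (hx0 : x ≠ 0) :
    E * ‖x‖ ^ 2 < RCLike.re ⟪x, A x⟫_ℂ := by
  obtain ⟨n, e, ev, he⟩ := exists_eigenbasis hA hW
  rw [inner_apply_eq_sum hA e ev he hW hx, norm_sq_eq_sum e hx, Finset.mul_sum]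
  have h0 : ∀ i, ev i ≤ E → ⟪(e i : ChainSpace Λ N), x⟫_ℂ = 0 := fun i hi =>
    (Submodule.mem_orthogonal _ _).1 hx' _ (mem_spectralSubspace hi (e i).2 (he i))
  have hne : ∃ i, ⟪(e i : ChainSpace Λ N), x⟫_ℂ ≠ 0 := by
    by_contra! hcon
    have := norm_sq_eq_sum e hx
    simp [hcon] at this
    exact hx0 this
  refine Finset.sum_lt_sum (fun i _ => ?_) ?_
  · rcases le_or_gt (ev i) E with hi | hi
    · simp [h0 i hi]
    · exact mul_le_mul_of_nonneg_right hi.le (sq_nonneg _)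
  · obtain ⟨i, hi⟩ := hne
    refine ⟨i, Finset.mem_univ _, mul_lt_mul_of_pos_right ?_ (by positivity)⟩
    by_contra! hcon
    exact hi (h0 i hcon)

/-- The variational principle: a subspace on which the quadratic form is at most `E` is not
larger than the spectral subspace. -/
lemma finrank_le_finrank_spectralSubspace {A : ChainOp Λ N} (hA : IsSelfAdjoint A)
    {W : Submodule ℂ (ChainSpace Λ N)} (hW : ∀ x ∈ W, A x ∈ W) {E : ℝ}
    {U : Submodule ℂ (ChainSpace Λ N)} (hU : U ≤ W)
    (hUE : ∀ x ∈ U, RCLike.re ⟪x, A x⟫_ℂ ≤ E * ‖x‖ ^ 2) :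
    Module.finrank ℂ U ≤ Module.finrank ℂ (spectralSubspace A W E) := by
  have hdis : Disjoint U (spectralSubspace A W E)ᗮ := by
    rw [Submodule.disjoint_def]
    intro x hx hx'
    by_contra hx0
    exact absurd (hUE x hx) (not_le.2 (lt_inner_of_mem_orthogonal hA hW (hU hx) hx' hx0))
  -- `U` meets the orthogonal complement of the spectral subspace only in zero, so its dimension is
  -- at most the codimension of that complement.
  have h1 := Submodule.finrank_add_finrank_le_of_disjoint hdis
  have h2 := Submodule.finrank_add_finrank_orthogonal (spectralSubspace A W E)
  omega

/-- Eigenvalues are at least `-‖A‖`. Without a lower bound the real infimum in `energyLevel` would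
be the default value 0. -/
lemma bddBelow_energies (A : ChainOp Λ N) (W : Submodule ℂ (ChainSpace Λ N)) (j : ℕ) :
    BddBelow {E : ℝ | j < Module.finrank ℂ (spectralSubspace A W E)} := by
  refine ⟨-‖A‖, fun E hE => ?_⟩
  by_contra! hlt
  have hbot : spectralSubspace A W E ≤ ⊥ := by
    refine spectralSubspace_le_of_forall fun μ hμ x _ hx => ?_
    by_contra hx0
    have h1 : ‖A x‖ ≤ ‖A‖ * ‖x‖ := A.le_opNorm x
    rw [hx, norm_smul, Complex.norm_real, Real.norm_eq_abs] at h1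
    have h2 : |μ| ≤ ‖A‖ := le_of_mul_le_mul_right h1 (norm_pos_iff.2 hx0)
    linarith [neg_abs_le μ]
  have hE' : j < Module.finrank ℂ (spectralSubspace A W E) := hE
  rw [le_bot_iff.1 hbot] at hE'
  simp at hE'

/-- The upper half of min-max, applied below to trial lines and trial planes. -/
lemma energyLevel_le {A : ChainOp Λ N} (hA : IsSelfAdjoint A)
    {W : Submodule ℂ (ChainSpace Λ N)} (hW : ∀ x ∈ W, A x ∈ W) {E : ℝ}
    {U : Submodule ℂ (ChainSpace Λ N)} (hU : U ≤ W) {j : ℕ} (hj : j < Module.finrank ℂ U)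
    (hUE : ∀ x ∈ U, RCLike.re ⟪x, A x⟫_ℂ ≤ E * ‖x‖ ^ 2) : energyLevel A W j ≤ E :=
  csInf_le (bddBelow_energies A W j)
    (lt_of_lt_of_le hj (finrank_le_finrank_spectralSubspace hA hW hU hUE))

lemma inner_smul_apply_smul (A : ChainOp Λ N) (a : ℂ) (x : ChainSpace Λ N) :
    RCLike.re ⟪a • x, A (a • x)⟫_ℂ = ‖a‖ ^ 2 * RCLike.re ⟪x, A x⟫_ℂ := by
  rw [map_smul, inner_smul_left, inner_smul_right, ← mul_assoc, RCLike.conj_mul]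
  norm_cast
  exact RCLike.re_ofReal_mul _ _

lemma energyLevel_zero_mul_le {A : ChainOp Λ N} (hA : IsSelfAdjoint A)
    {W : Submodule ℂ (ChainSpace Λ N)} (hW : ∀ x ∈ W, A x ∈ W) {x : ChainSpace Λ N}
    (hx : x ∈ W) : energyLevel A W 0 * ‖x‖ ^ 2 ≤ RCLike.re ⟪x, A x⟫_ℂ := by
  rcases eq_or_ne x 0 with rfl | hx0
  · simp
  have hpos : 0 < ‖x‖ ^ 2 := by positivity
  rw [← le_div_iff₀ hpos]
  refine energyLevel_le hA hW (U := ℂ ∙ x) (by simpa using hx) ?_ ?_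
  · rw [finrank_span_singleton hx0]; exact Nat.one_pos
  · intro y hy
    obtain ⟨a, rfl⟩ := Submodule.mem_span_singleton.1 hy
    rw [inner_smul_apply_smul, norm_smul, mul_pow]
    field_simp
    rfl

/-- At `E = ‖A‖` the quadratic form bound holds on all of `W`. This makes the sets defining the
levels nonempty, so their infima are meaningful. -/
lemma exists_finrank_spectralSubspace {A : ChainOp Λ N} (hA : IsSelfAdjoint A)
    {W : Submodule ℂ (ChainSpace Λ N)} (hW : ∀ x ∈ W, A x ∈ W) :
    ∃ E : ℝ, Module.finrank ℂ W ≤ Module.finrank ℂ (spectralSubspace A W E) := by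
  refine ⟨‖A‖, finrank_le_finrank_spectralSubspace hA hW le_rfl fun x _ => ?_⟩
  calc RCLike.re ⟪x, A x⟫_ℂ ≤ ‖x‖ * ‖A x‖ := re_inner_le_norm _ _
    _ ≤ ‖x‖ * (‖A‖ * ‖x‖) := by gcongr; exact A.le_opNorm x
    _ = ‖A‖ * ‖x‖ ^ 2 := by ring

lemma energyLevel_zero_le_one {A : ChainOp Λ N} (hA : IsSelfAdjoint A)
    {W : Submodule ℂ (ChainSpace Λ N)} (hW : ∀ x ∈ W, A x ∈ W) (h2 : 2 ≤ Module.finrank ℂ W) :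
    energyLevel A W 0 ≤ energyLevel A W 1 := by
  obtain ⟨E, hE⟩ := exists_finrank_spectralSubspace hA hW
  refine csInf_le_csInf (bddBelow_energies A W 0) ⟨E, ?_⟩ fun E' hE' => ?_
  · simp only [Set.mem_ofPred_eq]; omega
  · simp only [Set.mem_ofPred_eq] at hE' ⊢; omega

/-- The min-max comparison: if the quadratic forms of `A` and `A'` agree on an `A'`-invariant
subspace `W`, then the levels of `A'` on `W` are not below those of `A`. -/
lemma energyLevel_le_of_compression {A A' : ChainOp Λ N} (hA : IsSelfAdjoint A)
    (hA' : IsSelfAdjoint A') {W : Submodule ℂ (ChainSpace Λ N)} (hW : ∀ x ∈ W, A' x ∈ W)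
    (hAA' : ∀ x ∈ W, ⟪x, A x⟫_ℂ = ⟪x, A' x⟫_ℂ) {j : ℕ} (hj : j < Module.finrank ℂ W) :
    energyLevel A ⊤ j ≤ energyLevel A' W j := by
  obtain ⟨E, hE⟩ := exists_finrank_spectralSubspace hA' hW
  refine csInf_le_csInf (bddBelow_energies A ⊤ j) ⟨E, hj.trans_le hE⟩ fun E' hE' => ?_
  refine lt_of_lt_of_le hE' (finrank_le_finrank_spectralSubspace hA (fun _ _ => Submodule.mem_top) le_top ?_)
  intro x hx
  have hxW := spectralSubspace_le _ _ _ hx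
  rw [hAA' x hxW]
  obtain ⟨n, e, ev, he⟩ := exists_eigenbasis hA' hW
  rw [inner_apply_eq_sum hA' e ev he hW hxW, norm_sq_eq_sum e hxW, Finset.mul_sum]
  refine Finset.sum_le_sum fun i _ => ?_
  rcases le_or_gt (ev i) E' with hi | hi
  · exact mul_le_mul_of_nonneg_right hi (sq_nonneg _)
  -- An eigenvector above `E'` is orthogonal to the whole spectral subspace, so its coefficient in
  -- `x` vanishes.
  · have hle : spectralSubspace A' W E' ≤ (ℂ ∙ (e i : ChainSpace Λ N))ᗮ :=
      spectralSubspace_le_of_forall fun μ hμ y _ hy =>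
        Submodule.mem_orthogonal_singleton_iff_inner_right.2
          (hA'.inner_eigenvectors (by linarith : ev i ≠ μ) (he i) hy)
    have := Submodule.mem_orthogonal_singleton_iff_inner_right.1 (hle hx)
    simp [this]

/-- On the orthogonal complement of a ground state the quadratic form is at least the first
excited level. -/
lemma energyLevel_one_mul_le {A : ChainOp Λ N} (hA : IsSelfAdjoint A) {ψ x : ChainSpace Λ N}
    (hψ : IsGroundState A ⊤ ψ) (hx : ⟪ψ, x⟫_ℂ = 0) :
    energyLevel A ⊤ 1 * ‖x‖ ^ 2 ≤ RCLike.re ⟪x, A x⟫_ℂ := by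
  obtain ⟨-, hψ1, hAψ⟩ := hψ
  rcases eq_or_ne x 0 with rfl | hx0
  · simp
  have hpos : 0 < ‖x‖ ^ 2 := by positivity
  rw [← le_div_iff₀ hpos]
  set R := RCLike.re ⟪x, A x⟫_ℂ / ‖x‖ ^ 2 with hR
  -- The Rayleigh quotient `R` of `x` also dominates the ground energy. So the form is at most `R`
  -- on the whole plane spanned by `ψ` and `x`, a trial space of dimension 2 for level 1.
  have h0 : energyLevel A ⊤ 0 ≤ R := by
    rw [hR, le_div_iff₀ hpos]
    exact energyLevel_zero_mul_le hA (fun _ _ => Submodule.mem_top) Submodule.mem_top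
  have hli : LinearIndependent ℂ ![ψ, x] := by
    have hψ0 : ψ ≠ 0 := by rintro rfl; simp at hψ1
    rw [LinearIndependent.pair_iff' hψ0]
    rintro a rfl
    rw [inner_smul_right, inner_self_eq_norm_sq_to_K, hψ1] at hx
    apply hx0
    simp at hx
    simp [hx]
  refine energyLevel_le hA (fun _ _ => Submodule.mem_top) (U := Submodule.span ℂ (Set.range ![ψ, x])) le_top
    ?_ ?_
  · rw [finrank_span_eq_card hli]; simp
  · intro y hy
    rw [Matrix.range_cons, Matrix.range_cons, Matrix.range_empty, Set.union_empty,
      Set.singleton_union] at hy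
    obtain ⟨a, b, rfl⟩ := Submodule.mem_span_pair.1 hy
    have hx' : ⟪x, ψ⟫_ℂ = 0 := inner_eq_zero_symm.1 hx
    have hc1 : ⟪a • ψ, A (b • x)⟫_ℂ = 0 := by
      rw [← hA.inner_apply_left, map_smul, hAψ]
      simp [hx]
    have hc2 : ⟪b • x, A (a • ψ)⟫_ℂ = 0 := by
      rw [map_smul, hAψ]
      simp [hx']
    have hort : ⟪a • ψ, b • x⟫_ℂ = 0 := by simp [hx]
    have hn : ‖a • ψ + b • x‖ ^ 2 = ‖a • ψ‖ ^ 2 + ‖b • x‖ ^ 2 := by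
      have := norm_add_sq_eq_norm_sq_add_norm_sq_of_inner_eq_zero _ _ hort
      nlinarith
    rw [map_add, inner_add_left, inner_add_right, inner_add_right, hc1, hc2, zero_add, add_zero,
      map_add, inner_smul_apply_smul, inner_smul_apply_smul, hn, norm_smul, norm_smul, hψ1]
    have hψA : RCLike.re ⟪ψ, A ψ⟫_ℂ = energyLevel A ⊤ 0 := by
      rw [hAψ, inner_smul_right, inner_self_eq_norm_sq_to_K, hψ1]; simp
    have hxA : RCLike.re ⟪x, A x⟫_ℂ = R * ‖x‖ ^ 2 := by rw [hR]; field_simp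
    rw [hψA, hxA]
    nlinarith [mul_le_mul_of_nonneg_left h0 (sq_nonneg ‖a‖)]

/-- The lowest level is attained. -/
lemma exists_ground_vector {A : ChainOp Λ N} (hA : IsSelfAdjoint A) :
    ∃ x : ChainSpace Λ N, x ≠ 0 ∧ A x = ((energyLevel A ⊤ 0 : ℝ) : ℂ) • x := by
  obtain ⟨n, e, ev, he⟩ := exists_eigenbasis hA (W := ⊤) fun _ _ => Submodule.mem_top
  have hn : n = Module.finrank ℂ (⊤ : Submodule ℂ (ChainSpace Λ N)) := by
    rw [Module.finrank_eq_card_basis e.toBasis, Fintype.card_fin]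
  have hpos : 0 < n := by
    rw [hn, finrank_top, finrank_euclideanSpace]; exact Fintype.card_pos
  have : NeZero n := ⟨hpos.ne'⟩
  obtain ⟨i, -, hi⟩ := Finset.exists_min_image Finset.univ ev ⟨0, Finset.mem_univ _⟩
  have hne : (e i : ChainSpace Λ N) ≠ 0 := by
    have := e.orthonormal.ne_zero i
    simpa using this
  have hle : energyLevel A ⊤ 0 ≤ ev i := by
    have h1 := energyLevel_zero_mul_le hA (W := ⊤) (fun _ _ => Submodule.mem_top)
      (x := (e i : ChainSpace Λ N)) Submodule.mem_top
    rw [he, inner_smul_right, inner_self_eq_norm_sq_to_K] at h1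
    have h2 : ‖(e i : ChainSpace Λ N)‖ = 1 := e.orthonormal.1 i
    simpa [h2] using h1
  -- An eigenvector below the least member of the eigenbasis would be orthogonal to the entire
  -- basis, hence zero.
  have hge : ev i ≤ energyLevel A ⊤ 0 := by
    refine le_csInf ?_ fun E hE => ?_
    · obtain ⟨E, hE⟩ := exists_finrank_spectralSubspace hA (W := ⊤) fun _ _ => Submodule.mem_top
      exact ⟨E, by simp only [Set.mem_ofPred_eq]; omega⟩
    · by_contra! hlt
      have hbot : spectralSubspace A ⊤ E ≤ ⊥ := by
        refine spectralSubspace_le_of_forall fun μ hμ x _ hx => ?_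
        have : ‖x‖ ^ 2 = 0 := by
          rw [norm_sq_eq_sum e (x := x) Submodule.mem_top]
          refine Finset.sum_eq_zero fun k _ => ?_
          have := hi k (Finset.mem_univ _)
          rw [hA.inner_eigenvectors (by linarith : ev k ≠ μ) (he k) hx]
          simp
        simpa using this
      rw [Set.mem_ofPred_eq, le_bot_iff.1 hbot] at hE
      simp at hE
  exact ⟨_, hne, by rw [le_antisymm hle hge]; exact he i⟩

end Spectral

/-! ### Supports -/

section Support

variable {Λ : Finset ℤ} {N : ℤ → ℕ}

/-- The configuration `m` with its values on `Z` replaced by those of `k`. -/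
def overwrite (m : Config Λ N) (Z : Finset Λ) (k : (x : Z) → Fin (N (x : Λ) + 1)) : Config Λ N :=
  fun x => if hx : x ∈ Z then k ⟨x, hx⟩ else m x

lemma overwrite_of_mem (m : Config Λ N) {Z : Finset Λ} (k : (x : Z) → Fin (N (x : Λ) + 1))
    {x : Λ} (hx : x ∈ Z) : overwrite m Z k x = k ⟨x, hx⟩ := dif_pos hx

lemma overwrite_of_notMem (m : Config Λ N) {Z : Finset Λ} (k : (x : Z) → Fin (N (x : Λ) + 1))
    {x : Λ} (hx : x ∉ Z) : overwrite m Z k x = m x := dif_neg hx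

lemma apply_eq_sum_single (O : ChainOp Λ N) (ψ : ChainSpace Λ N) (m : Config Λ N) :
    (O ψ) m = ∑ n : Config Λ N, ψ n * (O (EuclideanSpace.single n 1)) m := by
  conv_lhs => rw [← (EuclideanSpace.basisFun (Config Λ N) ℂ).sum_repr ψ]
  simp [map_sum]

/-- A supported operator acts on the coordinates of its support only. -/
lemma SupportedOn.exists_apply_eq {O : ChainOp Λ N} {Z : Finset Λ} (hO : SupportedOn O Z) :
    ∃ A : Matrix ((x : Z) → Fin (N (x : Λ) + 1)) ((x : Z) → Fin (N (x : Λ) + 1)) ℂ,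
      ∀ (ψ : ChainSpace Λ N) (m : Config Λ N),
        (O ψ) m = ∑ k, A (fun x => m x) k * ψ (overwrite m Z k) := by
  obtain ⟨A, h1, h2⟩ := hO
  refine ⟨A, fun ψ m => ?_⟩
  rw [apply_eq_sum_single]
  symm
  -- Matrix elements vanish unless `n` agrees with `m` off `Z`; such `n` are exactly the overwrites
  -- of `m` on `Z`.
  refine Fintype.sum_of_injective (overwrite m Z) ?_ _ _ ?_ ?_
  · intro k k' hkk
    funext x
    have := congrFun hkk x
    rwa [overwrite_of_mem m k x.2, overwrite_of_mem m k' x.2] at this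
  · intro n hn
    rw [h2 m n, mul_zero]
    by_contra! hcon
    refine hn ⟨fun x => n x, ?_⟩
    funext x
    by_cases hx : x ∈ Z
    · rw [overwrite_of_mem _ _ hx]
    · rw [overwrite_of_notMem _ _ hx, hcon x hx]
  · intro k
    rw [h1 m _ fun x hx => (overwrite_of_notMem m k hx).symm, mul_comm]
    congr 2
    funext x
    exact (overwrite_of_mem m k x.2).symm

/-- Operators with disjoint supports commute. -/
lemma SupportedOn.commute {O O' : ChainOp Λ N} {Z Z' : Finset Λ} (hO : SupportedOn O Z)
    (hO' : SupportedOn O' Z') (hd : Disjoint Z Z') : Commute O O' := by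
  obtain ⟨A, hA⟩ := hO.exists_apply_eq
  obtain ⟨A', hA'⟩ := hO'.exists_apply_eq
  have hd' : ∀ x, x ∈ Z → x ∉ Z' := fun x hx => Finset.disjoint_left.1 hd hx
  ext ψ m
  change (O (O' ψ)) m = (O' (O ψ)) m
  rw [hA, hA']
  simp_rw [hA, hA', Finset.mul_sum]
  rw [Finset.sum_comm]
  refine Finset.sum_congr rfl fun k' _ => Finset.sum_congr rfl fun k _ => ?_
  -- Overwriting on `Z` is invisible to the matrix acting on `Z'` and conversely, and the two
  -- overwrites may be done in either order.
  have e1 : (fun x : Z' => overwrite m Z k x) = fun x : Z' => m x := by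
    funext x; exact overwrite_of_notMem _ _ fun hx => hd' _ hx x.2
  have e2 : (fun x : Z => overwrite m Z' k' x) = fun x : Z => m x := by
    funext x; exact overwrite_of_notMem _ _ (hd' _ x.2)
  have e3 : overwrite (overwrite m Z k) Z' k' = overwrite (overwrite m Z' k') Z k := by
    funext x
    by_cases hx : x ∈ Z
    · rw [overwrite_of_notMem _ _ (hd' x hx), overwrite_of_mem _ _ hx, overwrite_of_mem _ _ hx]
    · by_cases hx' : x ∈ Z'
      · rw [overwrite_of_mem _ _ hx', overwrite_of_notMem _ _ hx, overwrite_of_mem _ _ hx']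
      · rw [overwrite_of_notMem _ _ hx', overwrite_of_notMem _ _ hx, overwrite_of_notMem _ _ hx,
          overwrite_of_notMem _ _ hx']
  rw [e1, e2, e3]
  ring

/-- The configuration equal to `m` on `X` and to `n` off `X`. -/
noncomputable def patch (X : Set ℤ) (m n : Config Λ N) : Config Λ N :=
  open Classical in fun x => if (x : ℤ) ∈ X then m x else n x

/-- `O` acts on the coordinates in `X` only: it treats a factor that depends on the coordinates off
`X` as a constant. -/
def ActsInside (O : ChainOp Λ N) (X : Set ℤ) : Prop :=
  ∀ (n : Config Λ N) (Φ Θ : ChainSpace Λ N) (f : Config Λ N → ℂ),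
    (∀ m m' : Config Λ N, (∀ x : Λ, (x : ℤ) ∉ X → m x = m' x) → f m = f m') →
    (∀ m, Θ m = f m * Φ (patch X m n)) → ∀ m, (O Θ) m = f m * (O Φ) (patch X m n)

/-- Overwriting inside `Z ⊆ X` does not change `f`, which only sees coordinates off `X`, and it
commutes with patching along `X`. -/
lemma SupportedOn.actsInside {O : ChainOp Λ N} {Z : Finset Λ} (hO : SupportedOn O Z)
    {X : Set ℤ} (hZ : ∀ x ∈ Z, (x : ℤ) ∈ X) : ActsInside O X := by
  intro n Φ Θ f hf hΘ m
  obtain ⟨A, hA⟩ := hO.exists_apply_eq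
  rw [hA, hA, Finset.mul_sum]
  refine Finset.sum_congr rfl fun k _ => ?_
  have e1 : (fun x : Z => patch X m n x) = fun x : Z => m x := by
    funext x; exact if_pos (hZ _ x.2)
  have e2 : patch X (overwrite m Z k) n = overwrite (patch X m n) Z k := by
    funext x
    by_cases hx : x ∈ Z
    · rw [overwrite_of_mem _ _ hx, patch, if_pos (hZ _ hx), overwrite_of_mem _ _ hx]
    · rw [overwrite_of_notMem _ _ hx, patch, patch, overwrite_of_notMem _ _ hx]
  have e3 : f (overwrite m Z k) = f m :=
    hf _ _ fun x hx => overwrite_of_notMem _ _ fun hxZ => hx (hZ _ hxZ)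
  rw [hΘ, e1, e2, e3]
  ring

lemma ActsInside.sum {ι : Type*} {s : Finset ι} {O : ι → ChainOp Λ N} {X : Set ℤ}
    (hO : ∀ i ∈ s, ActsInside (O i) X) : ActsInside (∑ i ∈ s, O i) X := by
  intro n Φ Θ f hf hΘ m
  simp only [_root_.sum_apply, WithLp.ofLp_sum, Finset.sum_apply, Finset.mul_sum]
  exact Finset.sum_congr rfl fun i hi => hO i hi n Φ Θ f hf hΘ m

lemma ActsInside.add {O O' : ChainOp Λ N} {X : Set ℤ} (hO : ActsInside O X)
    (hO' : ActsInside O' X) : ActsInside (O + O') X := by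
  intro n Φ Θ f hf hΘ m
  simp only [_root_.add_apply, PiLp.add_apply, hO n Φ Θ f hf hΘ m, hO' n Φ Θ f hf hΘ m, mul_add]

/-- Eigenvectors of operators inside and outside `X` combine to a joint eigenvector. -/
lemma exists_joint_eigenvector {A B : ChainOp Λ N} {X : Set ℤ} (hA : ActsInside A X)
    (hB : ActsInside B Xᶜ) {Φ Ψ : ChainSpace Λ N} (hΦ0 : Φ ≠ 0) (hΨ0 : Ψ ≠ 0) {a b : ℂ}
    (hΦ : A Φ = a • Φ) (hΨ : B Ψ = b • Ψ) :
    ∃ Θ : ChainSpace Λ N, Θ ≠ 0 ∧ A Θ = a • Θ ∧ B Θ = b • Θ := by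
  obtain ⟨m₀, hm₀⟩ : ∃ m, Φ m ≠ 0 := by
    by_contra! hcon; exact hΦ0 (by ext m; simpa using hcon m)
  obtain ⟨m₁, hm₁⟩ : ∃ m, Ψ m ≠ 0 := by
    by_contra! hcon; exact hΨ0 (by ext m; simpa using hcon m)
  -- A product vector: the slice of `Φ` through `m₀` on `X` times the slice of `Ψ` through `m₁` on
  -- the complement. The slices pass through nonzero coordinates, so `Θ` is nonzero at `patch X m₀
  -- m₁`.
  let Θ : ChainSpace Λ N := WithLp.toLp 2 fun m => Ψ (patch Xᶜ m m₁) * Φ (patch X m m₀)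
  have hΘ : ∀ m, Θ m = Ψ (patch Xᶜ m m₁) * Φ (patch X m m₀) := fun m => rfl
  refine ⟨Θ, fun h0 => ?_, ?_, ?_⟩
  · have h1 := hΘ (patch X m₀ m₁)
    have e1 : patch Xᶜ (patch X m₀ m₁) m₁ = m₁ := by
      funext x; by_cases hx : (x : ℤ) ∈ X <;> simp [patch, hx]
    have e2 : patch X (patch X m₀ m₁) m₀ = m₀ := by
      funext x; by_cases hx : (x : ℤ) ∈ X <;> simp [patch, hx]
    rw [e1, e2, h0] at h1
    exact mul_ne_zero hm₁ hm₀ (by simpa using h1.symm)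
  · ext m
    rw [hA m₀ Φ Θ (fun m => Ψ (patch Xᶜ m m₁)) ?_ hΘ, hΦ]
    · simp only [PiLp.smul_apply, smul_eq_mul, hΘ]; ring
    · intro m m' hmm
      refine congrArg (fun c => Ψ c) (funext fun x => ?_)
      by_cases hx : (x : ℤ) ∈ X
      · simp [patch, hx]
      · simp [patch, hx, hmm x hx]
  · ext m
    rw [hB m₁ Ψ Θ (fun m => Φ (patch X m m₀)) ?_ (fun m => by rw [hΘ, mul_comm]), hΨ]
    · simp only [PiLp.smul_apply, smul_eq_mul, hΘ]; ring
    · intro m m' hmm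
      refine congrArg (fun c => Φ c) (funext fun x => ?_)
      by_cases hx : (x : ℤ) ∈ X
      · simp [patch, hx, hmm x (by simpa using hx)]
      · simp [patch, hx]

end Support

/-! ### Bounds on the interaction -/

namespace ChainParams

/-- The standing assumptions on the parameters. -/
structure Valid (p : ChainParams) : Prop where
  one_le_k : 1 ≤ p.k
  χ_pos : 0 < p.χ
  α_pos : 0 < p.α
  g₀_pos : 0 < p.g₀
  g₁_pos : 0 < p.g₁
  J_zero : p.J 0 = 1
  J_nonneg : ∀ r, 0 ≤ p.J r
  J_decay : ∀ r : ℕ, ((r : ℝ) ^ 2 + 1) * p.J r ≤ 1 / ((r : ℝ) ^ p.α + 1)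
  one_le_η₁ : 1 ≤ p.η₁
  one_le_η₂ : 1 ≤ p.η₂
  bound_η₁ : p.EtaBound 1 p.η₁
  bound_η₂ : p.EtaBound 2 p.η₂

variable {p : ChainParams}

lemma Valid.gbar_pos (hp : p.Valid) {x : ℝ} (hx : 0 ≤ x) : 0 < p.gbar x := by
  have h1 : 0 ≤ Real.log (x + 1) := Real.log_nonneg (by linarith)
  have h2 := Real.rpow_nonneg h1 p.χ
  have := hp.g₀_pos
  have := hp.g₁_pos
  unfold gbar
  positivity

lemma Valid.gbar_mono (hp : p.Valid) {x y : ℝ} (hx : 0 ≤ x) (hxy : x ≤ y) :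
    p.gbar x ≤ p.gbar y := by
  have h1 : 0 ≤ Real.log (x + 1) := Real.log_nonneg (by linarith)
  have h2 : Real.log (x + 1) ≤ Real.log (y + 1) := Real.log_le_log (by linarith) (by linarith)
  have h3 := Real.rpow_le_rpow h1 h2 hp.χ_pos.le
  have := mul_le_mul_of_nonneg_left h3 hp.g₁_pos.le
  unfold gbar
  linarith

/-- For `r ≥ 1` the denominator `r^α + 1` is at least 2. This factor 2 compensates for the two sites
at each distance from the origin. -/
lemma Valid.J_le (hp : p.Valid) {d y : ℕ} (hd : y + 1 ≤ d) :
    p.J d ≤ 1 / (2 * (((y + 1 : ℕ) : ℝ) ^ 2 + 1)) := by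
  have hd1 : (1 : ℝ) ≤ d := by exact_mod_cast (by omega : 1 ≤ d)
  have hyd : ((y + 1 : ℕ) : ℝ) ≤ d := by exact_mod_cast hd
  have h1 : 1 ≤ (d : ℝ) ^ p.α := Real.one_le_rpow hd1 hp.α_pos.le
  have h2 : ((d : ℝ) ^ 2 + 1) * p.J d ≤ 1 / 2 :=
    (hp.J_decay d).trans (one_div_le_one_div_of_le (by norm_num) (by linarith))
  have h3 : ((y + 1 : ℕ) : ℝ) ^ 2 ≤ (d : ℝ) ^ 2 := by gcongr
  rw [le_div_iff₀ (by positivity)]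
  nlinarith [mul_le_mul_of_nonneg_right h3 (hp.J_nonneg d)]

lemma sum_sqrt_div_le (n : ℕ) :
    ∑ y ∈ Finset.range n, Real.sqrt (1 + y) / ((y : ℝ) ^ 2 + 1) ≤ 5 := by
  -- The correction term makes the induction close: for `a ≥ 1` the summand at `a` is at most `3/√a
  -- - 3/√(a+1)`, which telescopes.
  have key : ∀ n : ℕ, ∑ y ∈ Finset.range (n + 1), Real.sqrt (1 + y) / ((y : ℝ) ^ 2 + 1)
      ≤ 5 - 3 / Real.sqrt (n + 1) := by
    intro n
    induction n with
    | zero => norm_num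
    | succ n ih =>
      rw [Finset.sum_range_succ]
      push_cast
      set a : ℝ := (n : ℝ) + 1 with ha
      have ha1 : 1 ≤ a := by rw [ha]; linarith [(Nat.cast_nonneg n : (0 : ℝ) ≤ n)]
      set s := Real.sqrt a with hs
      set t := Real.sqrt (a + 1) with ht
      have hs2 : s ^ 2 = a := Real.sq_sqrt (by linarith)
      have ht2 : t ^ 2 = a + 1 := Real.sq_sqrt (by linarith)
      have hs0 : 0 < s := Real.sqrt_pos.2 (by linarith)
      have ht0 : 0 < t := Real.sqrt_pos.2 (by linarith)
      have hst : s * t ≤ a + 1 / 2 := by nlinarith [sq_nonneg (s - t)]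
      have h1 : 3 / s - 3 / t = 3 / (s * t * (s + t)) := by
        field_simp
        nlinarith
      have h2 : t / (a ^ 2 + 1) ≤ 3 / (s * t * (s + t)) := by
        rw [div_le_div_iff₀ (by positivity) (by positivity)]
        have e : t * (s * t * (s + t)) = t ^ 2 * (s ^ 2 + s * t) := by ring
        rw [e, ht2, hs2]
        nlinarith [mul_le_mul_of_nonneg_left hst (by linarith : (0 : ℝ) ≤ a + 1),
          sq_nonneg (a - 5 / 4)]
      rw [add_comm 1 a]
      linarith
  rcases n with _ | n
  · simp
  · exact (key n).trans (sub_le_self _ (by positivity))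

end ChainParams

lemma sum_le_sum_sum_of_cover {ι κ : Type*} {S : Finset ι} {I : Finset κ} {T : κ → Finset ι}
    {f : ι → ℝ} (hf : ∀ Z, 0 ≤ f Z) (hS : ∀ Z ∈ S, ∃ i ∈ I, Z ∈ T i) :
    ∑ Z ∈ S, f Z ≤ ∑ i ∈ I, ∑ Z ∈ T i, f Z := by
  classical
  have h1 : ∀ Z ∈ S, f Z ≤ ∑ i ∈ I, if Z ∈ T i then f Z else 0 := by
    intro Z hZ
    obtain ⟨i, hi, hZi⟩ := hS Z hZ
    refine le_trans (by rw [if_pos hZi]) (Finset.single_le_sum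
      (f := fun i => if Z ∈ T i then f Z else 0) (fun i _ => ?_) hi)
    split_ifs <;> simp [hf]
  refine (Finset.sum_le_sum h1).trans ?_
  rw [Finset.sum_comm]
  refine Finset.sum_le_sum fun i _ => ?_
  rw [← Finset.sum_filter]
  exact Finset.sum_le_sum_of_subset_of_nonneg (fun Z hZ => (Finset.mem_filter.1 hZ).2)
    fun Z _ _ => hf Z

/-! ### Total strength of the terms meeting a region -/

section Interaction

variable {Λ : Finset ℤ} {N : ℤ → ℕ}

/-- The largest distance from the origin of a site in `Z`. -/
def extent (Z : Finset Λ) : ℕ := Z.sup fun j => (j : ℤ).natAbs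

lemma natAbs_le_extent {Z : Finset Λ} {j : Λ} (hj : j ∈ Z) : (j : ℤ).natAbs ≤ extent Z :=
  Finset.le_sup (f := fun j : Λ => (j : ℤ).natAbs) hj

lemma extent_le {Z : Finset Λ} {r : ℕ} (hZ : ∀ j ∈ Z, (j : ℤ).natAbs ≤ r) : extent Z ≤ r :=
  Finset.sup_le hZ

/-- The terms through `i` and `i'` inside `[-x, x]`. -/
noncomputable def termsThrough (i i' : Λ) (x : ℕ) : Finset (Finset Λ) :=
  open Classical in
  Finset.univ.filter fun Z => i ∈ Z ∧ i' ∈ Z ∧ ∀ j : Λ, j ∈ Z → |(j : ℤ)| ≤ x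

lemma mem_termsThrough {i i' : Λ} {x : ℕ} {Z : Finset Λ} :
    Z ∈ termsThrough i i' x ↔ i ∈ Z ∧ i' ∈ Z ∧ extent Z ≤ x := by
  simp only [termsThrough, Finset.mem_filter, Finset.mem_univ, true_and]
  refine and_congr_right fun _ => and_congr_right fun _ => ⟨fun h => extent_le fun j hj => ?_,
    fun h j hj => ?_⟩
  · have := h j hj
    rw [Int.abs_eq_natAbs] at this
    exact_mod_cast this
  · have := natAbs_le_extent hj
    rw [Int.abs_eq_natAbs]
    exact_mod_cast this.trans h

/-- The local strength of the interaction inside `[-x, x]` is bounded by `ḡ_x J`. -/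
def InteractionBound (p : ChainParams) (h : Finset Λ → ChainOp Λ N) : Prop :=
  ∀ (i i' : Λ) (x : ℕ),
    ∑ Z ∈ termsThrough i i' x, ‖h Z‖ ≤ p.gbar x * p.J ((i : ℤ) - (i' : ℤ)).natAbs

/-- At most two sites, `±n`, lie at distance `n` from the origin, whence the factor 2. -/
lemma sum_sites_le {φ : ℕ → ℝ} (hφ : ∀ n, 0 ≤ φ n) {r R : ℕ}
    (hR : ∀ j : Λ, (j : ℤ).natAbs ≤ r + R) :
    ∑ j ∈ Finset.univ.filter (fun j : Λ => r < (j : ℤ).natAbs), φ (j : ℤ).natAbs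
      ≤ ∑ y ∈ Finset.range R, 2 * φ (r + (y + 1)) := by
  have hmaps : ∀ j ∈ Finset.univ.filter (fun j : Λ => r < (j : ℤ).natAbs),
      (j : ℤ).natAbs - r - 1 ∈ Finset.range R := by
    intro j hj
    have := hR j
    simp only [Finset.mem_filter, Finset.mem_univ, true_and, Finset.mem_range] at hj ⊢
    omega
  rw [← Finset.sum_fiberwise_of_maps_to hmaps]
  refine Finset.sum_le_sum fun y _ => ?_
  have hval : ∀ j ∈ (Finset.univ.filter (fun j : Λ => r < (j : ℤ).natAbs)).filter
      (fun j : Λ => (j : ℤ).natAbs - r - 1 = y), (j : ℤ).natAbs = r + (y + 1) := by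
    intro j hj
    simp only [Finset.mem_filter, Finset.mem_univ, true_and] at hj
    omega
  rw [Finset.sum_congr rfl fun j hj => by rw [hval j hj], Finset.sum_const, nsmul_eq_mul]
  refine mul_le_mul_of_nonneg_right ?_ (hφ _)
  have hcard := Finset.card_le_card_of_injOn
    (t := {((r + (y + 1) : ℕ) : ℤ), -((r + (y + 1) : ℕ) : ℤ)}) (fun j : Λ => (j : ℤ))
    (fun j hj => by
      have := hval j hj
      simp only [Finset.coe_insert, Finset.coe_singleton, Set.mem_insert_iff,
        Set.mem_singleton_iff]
      omega) (fun a _ b _ hab => Subtype.ext hab)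
  exact_mod_cast hcard.trans Finset.card_le_two

open Classical in
/-- The total weighted strength of the terms that meet `X ⊆ [-r, r]`. -/
lemma sum_meeting_le {p : ChainParams} (hp : p.Valid) {h : Finset Λ → ChainOp Λ N}
    (hb : InteractionBound p h) {X : Finset Λ} {r : ℕ} (hX : ∀ x ∈ X, (x : ℤ).natAbs ≤ r)
    {g : ℕ → ℝ} (hg : ∀ n, 0 ≤ g n) :
    ∃ R : ℕ, ∑ Z : Finset Λ with ¬ Disjoint Z X, ‖h Z‖ * g (max r (extent Z))
      ≤ X.card * ∑ y ∈ Finset.range R,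
        p.gbar ((r + y : ℕ) : ℝ) * g (r + y) / ((y : ℝ) ^ 2 + 1) := by
  set R := extent (Finset.univ : Finset Λ) with hRdef
  refine ⟨R + 1, ?_⟩
  have hR : ∀ j : Λ, (j : ℤ).natAbs ≤ r + R := fun j =>
    (natAbs_le_extent (Finset.mem_univ j)).trans (by omega)
  have hf : ∀ Z : Finset Λ, 0 ≤ ‖h Z‖ * g (max r (extent Z)) := fun Z =>
    mul_nonneg (norm_nonneg _) (hg _)
  have hgb : ∀ n : ℕ, 0 ≤ p.gbar (n : ℝ) := fun n => (hp.gbar_pos (Nat.cast_nonneg n)).le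
  have hmeet : ∀ Z : Finset Λ, ¬ Disjoint Z X → ∃ i ∈ X, i ∈ Z := fun Z hZ => by
    obtain ⟨i, hi, hi'⟩ := Finset.not_disjoint_iff.1 hZ
    exact ⟨i, hi', hi⟩
  -- Terms inside `[-r, r]` are counted through one site of `X`, with `J 0 = 1`, and give the
  -- summand `y = 0`. The others are counted through a site `i` of `X` and a farthest site `j`, so
  -- that their extent is exactly `|j|`.
  rw [← Finset.sum_filter_add_sum_filter_not _ fun Z => extent Z ≤ r]
  have hin : ∑ Z ∈ (Finset.univ.filter fun Z : Finset Λ => ¬ Disjoint Z X).filter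
      (fun Z => extent Z ≤ r), ‖h Z‖ * g (max r (extent Z)) ≤ X.card * (p.gbar r * g r) := by
    refine (sum_le_sum_sum_of_cover (I := X) (T := fun i => termsThrough i i r) hf ?_).trans ?_
    · intro Z hZ
      simp only [Finset.mem_filter, Finset.mem_univ, true_and] at hZ
      obtain ⟨i, hi, hi'⟩ := hmeet Z hZ.1
      exact ⟨i, hi, mem_termsThrough.2 ⟨hi', hi', hZ.2⟩⟩
    · rw [← nsmul_eq_mul]
      refine Finset.sum_le_card_nsmul _ _ _ fun i _ => ?_
      have hJ := hb i i r
      rw [sub_self, Int.natAbs_zero, hp.J_zero, mul_one] at hJ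
      rw [Finset.sum_congr rfl fun Z hZ => by rw [max_eq_left (mem_termsThrough.1 hZ).2.2],
        ← Finset.sum_mul]
      exact mul_le_mul_of_nonneg_right hJ (hg r)
  have hout : ∑ Z ∈ (Finset.univ.filter fun Z : Finset Λ => ¬ Disjoint Z X).filter
      (fun Z => ¬ extent Z ≤ r), ‖h Z‖ * g (max r (extent Z))
      ≤ X.card * ∑ y ∈ Finset.range R,
        p.gbar ((r + (y + 1) : ℕ) : ℝ) * g (r + (y + 1)) / (((y + 1 : ℕ) : ℝ) ^ 2 + 1) := by
    refine (sum_le_sum_sum_of_cover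
      (I := X ×ˢ Finset.univ.filter (fun j : Λ => r < (j : ℤ).natAbs))
      (T := fun q => termsThrough q.1 q.2 (q.2 : ℤ).natAbs) hf ?_).trans ?_
    · intro Z hZ
      simp only [Finset.mem_filter, Finset.mem_univ, true_and, not_le] at hZ
      obtain ⟨i, hi, hi'⟩ := hmeet Z hZ.1
      obtain ⟨j, hj, hjZ⟩ := Finset.exists_mem_eq_sup Z ⟨i, hi'⟩ fun j : Λ => (j : ℤ).natAbs
      have hjZ' : extent Z = (j : ℤ).natAbs := hjZ
      exact ⟨(i, j), by simp [hi]; omega, mem_termsThrough.2 ⟨hi', hj, hjZ'.le⟩⟩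
    · rw [Finset.sum_product, ← nsmul_eq_mul]
      refine Finset.sum_le_card_nsmul _ _ _ fun i hi => ?_
      have hterm : ∀ j ∈ Finset.univ.filter (fun j : Λ => r < (j : ℤ).natAbs),
          ∑ Z ∈ termsThrough i j (j : ℤ).natAbs, ‖h Z‖ * g (max r (extent Z))
          ≤ (fun n : ℕ => p.gbar n * g n / (2 * (((n - r : ℕ) : ℝ) ^ 2 + 1))) (j : ℤ).natAbs := by
        intro j hj
        simp only [Finset.mem_filter, Finset.mem_univ, true_and] at hj
        rw [Finset.sum_congr rfl fun Z hZ => by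
          rw [max_eq_right (by have := natAbs_le_extent (mem_termsThrough.1 hZ).2.1; omega),
            le_antisymm (mem_termsThrough.1 hZ).2.2
              (natAbs_le_extent (mem_termsThrough.1 hZ).2.1)], ← Finset.sum_mul]
        have hi' := hX i hi
        -- Since `|i| ≤ r`, the distance from `i` to `j` is at least `|j| - r`, which is the
        -- position of `j` outside the interval.
        have hJ := hp.J_le (d := ((i : ℤ) - j).natAbs) (y := (j : ℤ).natAbs - r - 1) (by omega)
        rw [show (j : ℤ).natAbs - r - 1 + 1 = (j : ℤ).natAbs - r by omega] at hJ
        have h2 := (hb i j (j : ℤ).natAbs).trans (mul_le_mul_of_nonneg_left hJ (hgb _))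
        have h3 := mul_le_mul_of_nonneg_right h2 (hg (j : ℤ).natAbs)
        refine h3.trans (le_of_eq ?_)
        simp only
        ring
      refine (Finset.sum_le_sum hterm).trans ((sum_sites_le
        (φ := fun n : ℕ => p.gbar n * g n / (2 * (((n - r : ℕ) : ℝ) ^ 2 + 1)))
        (fun n => ?_) hR).trans
        (le_of_eq (Finset.sum_congr rfl fun y _ => ?_)))
      · exact div_nonneg (mul_nonneg (hgb n) (hg n)) (by positivity)
      · simp only [show r + (y + 1) - r = y + 1 by omega]
        field_simp
  rw [Finset.sum_range_succ', mul_add, add_comm]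
  refine add_le_add hout ?_
  simpa using hin

end Interaction

/-! ### Nested commutators -/

section Commutators

variable {Λ : Finset ℤ} {N : ℤ → ℕ}

/-- The commutator with `A`, as a linear map. -/
noncomputable def commutatorMap (A : ChainOp Λ N) : ChainOp Λ N →ₗ[ℂ] ChainOp Λ N :=
  LinearMap.mulLeft ℂ A - LinearMap.mulRight ℂ A

lemma commutatorMap_apply (A O : ChainOp Λ N) : commutatorMap A O = A * O - O * A := rfl

lemma commutatorMap_sum {ι : Type*} (s : Finset ι) (A : ι → ChainOp Λ N) (O : ChainOp Λ N) :
    commutatorMap (∑ i ∈ s, A i) O = ∑ i ∈ s, commutatorMap (A i) O := by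
  simp only [commutatorMap_apply, Finset.sum_mul, Finset.mul_sum, Finset.sum_sub_distrib]

lemma norm_commutatorMap_le (A O : ChainOp Λ N) : ‖commutatorMap A O‖ ≤ 2 * ‖A‖ * ‖O‖ := by
  rw [commutatorMap_apply]
  calc ‖A * O - O * A‖ ≤ ‖A * O‖ + ‖O * A‖ := norm_sub_le _ _
    _ ≤ ‖A‖ * ‖O‖ + ‖O‖ * ‖A‖ := add_le_add (norm_mul_le _ _) (norm_mul_le _ _)
    _ = 2 * ‖A‖ * ‖O‖ := by ring

/-- `A ^ m * O` expanded in nested commutators. -/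
lemma pow_mul_eq_sum_commutatorMap (A O : ChainOp Λ N) (m : ℕ) :
    A ^ m * O = ∑ j ∈ Finset.range (m + 1),
      (m.choose j : ℂ) • ((commutatorMap A ^ j) O * A ^ (m - j)) := by
  -- Left multiplication by `A` is the sum of the commutator map and right multiplication, and these
  -- two commute, so the binomial theorem applies.
  have hcomm : Commute (commutatorMap A) (LinearMap.mulRight ℂ A) := by
    ext1 X
    change A * (X * A) - X * A * A = (A * X - X * A) * A
    simp only [sub_mul, mul_assoc]
  have hadd : commutatorMap A + LinearMap.mulRight ℂ A = LinearMap.mulLeft ℂ A := by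
    ext1 X
    exact sub_add_cancel (A * X) (X * A)
  have h := congrArg (fun f => f O) (hcomm.add_pow m)
  simp only [hadd, LinearMap.pow_mulLeft, LinearMap.mulLeft_apply] at h
  rw [h, LinearMap.sum_apply]
  refine Finset.sum_congr rfl fun j _ => ?_
  rw [(Nat.cast_commute (m.choose j) _).symm.eq, ← nsmul_eq_mul, hcomm.pow_pow,
    LinearMap.smul_apply, Module.End.mul_apply, LinearMap.pow_mulRight, LinearMap.mulRight_apply]
  exact (Nat.cast_smul_eq_nsmul ℂ _ _).symm

/-! ### Factorial growth of nested commutators -/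

section Growth

variable {p : ChainParams} {h : Finset Λ → ChainOp Λ N} {r₀ : ℕ} {Γ ε : ℝ}

/-- The estimate `1 + r + y ≤ (1 + r)(1 + y)` separates the variables. The total exponent is at most
`1/2`, so the `y`-part is at most `√(1+y)/(y²+1)`, whose sum is at most 5. -/
lemma sum_growth_le (hΓ : 0 ≤ Γ)
    (hgrow : ∀ r : ℕ, r₀ ≤ r → p.gbar r ≤ Γ * (((1 : ℝ) + r) / (1 + r₀)) ^ ε)
    {j : ℕ} (hj0 : 0 ≤ (j + 1 : ℕ) * ε) (hj : ((j + 1 : ℕ) : ℝ) * ε ≤ 1 / 2) {r : ℕ} (hr : r₀ ≤ r)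
    (R : ℕ) :
    ∑ y ∈ Finset.range R, p.gbar ((r + y : ℕ) : ℝ)
        * (((1 : ℝ) + (r + y : ℕ)) / (1 + r₀)) ^ (j * ε) / ((y : ℝ) ^ 2 + 1)
      ≤ 5 * Γ * (((1 : ℝ) + r) / (1 + r₀)) ^ (((j + 1 : ℕ) : ℝ) * ε) := by
  set U := (((1 : ℝ) + r) / (1 + r₀)) ^ (((j + 1 : ℕ) : ℝ) * ε) with hU
  have hU0 : 0 ≤ U := by positivity
  have hterm : ∀ y ∈ Finset.range R, p.gbar ((r + y : ℕ) : ℝ)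
        * (((1 : ℝ) + (r + y : ℕ)) / (1 + r₀)) ^ (j * ε) / ((y : ℝ) ^ 2 + 1)
      ≤ Γ * U * (Real.sqrt (1 + y) / ((y : ℝ) ^ 2 + 1)) := by
    intro y _
    set u : ℝ := ((1 : ℝ) + (r + y : ℕ)) / (1 + r₀) with hu
    have hu0 : 0 < u := by positivity
    have h1 := mul_le_mul_of_nonneg_right (hgrow (r + y) (by omega))
      (Real.rpow_nonneg hu0.le (j * ε))
    rw [mul_assoc, ← hu, ← Real.rpow_add hu0] at h1
    have e1 : ε + j * ε = ((j + 1 : ℕ) : ℝ) * ε := by push_cast; ring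
    rw [e1] at h1
    have h2 : u ≤ ((1 : ℝ) + r) / (1 + r₀) * (1 + y) := by
      rw [hu, div_mul_eq_mul_div]
      gcongr
      push_cast
      nlinarith [(Nat.cast_nonneg r : (0 : ℝ) ≤ r), (Nat.cast_nonneg y : (0 : ℝ) ≤ y),
        mul_nonneg (Nat.cast_nonneg r : (0 : ℝ) ≤ r) (Nat.cast_nonneg y : (0 : ℝ) ≤ y)]
    have h3 : u ^ (((j + 1 : ℕ) : ℝ) * ε) ≤ U * Real.sqrt (1 + y) := by
      refine (Real.rpow_le_rpow hu0.le h2 hj0).trans ?_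
      rw [Real.mul_rpow (by positivity) (by positivity), Real.sqrt_eq_rpow]
      exact mul_le_mul_of_nonneg_left (Real.rpow_le_rpow_of_exponent_le
        (by linarith [(Nat.cast_nonneg y : (0 : ℝ) ≤ y)]) hj) hU0
    rw [← mul_div_assoc]
    refine div_le_div_of_nonneg_right ?_ (by positivity)
    calc _ ≤ Γ * u ^ (((j + 1 : ℕ) : ℝ) * ε) := h1
      _ ≤ Γ * (U * Real.sqrt (1 + y)) := mul_le_mul_of_nonneg_left h3 hΓ
      _ = _ := by ring
  refine (Finset.sum_le_sum hterm).trans ?_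
  rw [← Finset.mul_sum]
  calc Γ * U * _ ≤ Γ * U * 5 :=
        mul_le_mul_of_nonneg_left (ChainParams.sum_sqrt_div_le R) (by positivity)
    _ = _ := by ring

open Classical in
/-- Growth of the nested commutators with a sum of terms of the interaction. -/
lemma norm_commutatorMap_pow_le (hp : p.Valid) (hb : InteractionBound p h)
    (hsupp : ∀ Z, SupportedOn (h Z) Z) (hlocal : ∀ Z, p.k < Z.card → h Z = 0)
    (hΓ : 0 ≤ Γ) (hε : 0 ≤ ε)
    (hgrow : ∀ r : ℕ, r₀ ≤ r → p.gbar r ≤ Γ * (((1 : ℝ) + r) / (1 + r₀)) ^ ε)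
    (F : Finset (Finset Λ)) (j : ℕ) (hj : (j : ℝ) * ε ≤ 1 / 2) :
    ∀ (X : Finset Λ) (r : ℕ) (O : ChainOp Λ N), r₀ ≤ r → (∀ x ∈ X, (x : ℤ).natAbs ≤ r) →
      (∀ Z, Disjoint Z X → Commute (h Z) O) →
      ‖(commutatorMap (∑ Z ∈ F, h Z) ^ j) O‖
        ≤ ‖O‖ * (∏ t ∈ Finset.range j, ((X.card : ℝ) + t * p.k)) * (10 * Γ) ^ j
          * (((1 : ℝ) + r) / (1 + r₀)) ^ (j * ε) := by
  induction j with
  | zero => intro X r O _ _ _; simp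
  | succ j ih =>
    intro X r O hr hX hO
    have hjε : (j : ℝ) * ε ≤ 1 / 2 := by push_cast at hj; linarith
    let u : ℕ → ℝ := fun n => (((1 : ℝ) + n) / (1 + r₀)) ^ (j * ε)
    have hu : ∀ n, 0 ≤ u n := fun n => by positivity
    set Q : ℝ := ∏ t ∈ Finset.range j, ((X.card : ℝ) + (t + 1 : ℕ) * p.k) with hQ
    have hQ0 : 0 ≤ Q := Finset.prod_nonneg fun t _ => by positivity
    have hterm : ∀ Z, ¬ Disjoint Z X →
        ‖(commutatorMap (∑ Z ∈ F, h Z) ^ j) (commutatorMap (h Z) O)‖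
        ≤ (2 * ‖O‖ * Q * (10 * Γ) ^ j) * (‖h Z‖ * u (max r (extent Z))) := by
      intro Z hZ
      rcases lt_or_ge p.k Z.card with hk | hk
      · simp [hlocal Z hk, commutatorMap_apply]
      -- The innermost commutator lives on `X ∪ Z`, with at most `k` more sites and radius enlarged
      -- to the extent of `Z`; hence the induction runs over all regions, radii and operators.
      have h1 := ih hjε (X ∪ Z) (max r (extent Z)) (commutatorMap (h Z) O)
        (hr.trans (le_max_left _ _)) (fun x hx => ?_) (fun Z' hZ' => ?_)
      · refine h1.trans ?_
        have h2 : ∏ t ∈ Finset.range j, (((X ∪ Z).card : ℝ) + t * p.k) ≤ Q := by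
          refine Finset.prod_le_prod (fun t _ => by positivity) fun t _ => ?_
          have : ((X ∪ Z).card : ℝ) ≤ X.card + p.k := by
            exact_mod_cast (Finset.card_union_le X Z).trans (by omega)
          push_cast
          linarith
        have h3 := norm_commutatorMap_le (h Z) O
        calc _ ≤ (2 * ‖h Z‖ * ‖O‖) * Q * (10 * Γ) ^ j * u (max r (extent Z)) := by
              gcongr
          _ = _ := by ring
      · rcases Finset.mem_union.1 hx with hx | hx
        · exact (hX x hx).trans (le_max_left _ _)
        · exact (natAbs_le_extent hx).trans (le_max_right _ _)
      · rw [Finset.disjoint_union_right] at hZ'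
        have c1 := (hsupp Z').commute (hsupp Z) hZ'.2
        have c2 := hO Z' hZ'.1
        exact (c1.mul_right c2).sub_right (c2.mul_right c1)
    have hzero : ∀ Z, Disjoint Z X → commutatorMap (h Z) O = 0 := fun Z hZ => by
      rw [commutatorMap_apply, (hO Z hZ).eq, sub_self]
    obtain ⟨R, hR⟩ := sum_meeting_le hp hb hX (g := u) hu
    have hgr := sum_growth_le (p := p) hΓ hgrow (j := j) (by positivity) hj hr R
    have hprod : ∏ t ∈ Finset.range (j + 1), ((X.card : ℝ) + t * p.k) = Q * X.card := by
      rw [Finset.prod_range_succ']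
      simp [hQ]
    -- Only the innermost commutator is expanded into terms, and only the `Z` meeting `X` survive.
    -- The constant 10 is the 2 of a commutator norm times the 5 of `sum_growth_le`.
    rw [pow_succ, Module.End.mul_apply, commutatorMap_sum, map_sum]
    calc ‖∑ Z ∈ F, (commutatorMap (∑ Z ∈ F, h Z) ^ j) (commutatorMap (h Z) O)‖
        ≤ ∑ Z ∈ F, ‖(commutatorMap (∑ Z ∈ F, h Z) ^ j) (commutatorMap (h Z) O)‖ :=
          norm_sum_le _ _
      _ ≤ ∑ Z : Finset Λ, ‖(commutatorMap (∑ Z ∈ F, h Z) ^ j) (commutatorMap (h Z) O)‖ :=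
          Finset.sum_le_univ_sum_of_nonneg fun _ => norm_nonneg _
      _ = ∑ Z : Finset Λ with ¬ Disjoint Z X,
            ‖(commutatorMap (∑ Z ∈ F, h Z) ^ j) (commutatorMap (h Z) O)‖ := by
          symm
          refine Finset.sum_subset (Finset.subset_univ _) fun Z _ hZ => ?_
          simp only [Finset.mem_filter, Finset.mem_univ, true_and, not_not] at hZ
          rw [hzero Z hZ, map_zero, norm_zero]
      _ ≤ ∑ Z : Finset Λ with ¬ Disjoint Z X,
            (2 * ‖O‖ * Q * (10 * Γ) ^ j) * (‖h Z‖ * u (max r (extent Z))) :=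
          Finset.sum_le_sum fun Z hZ => hterm Z (Finset.mem_filter.1 hZ).2
      _ ≤ (2 * ‖O‖ * Q * (10 * Γ) ^ j) * (X.card * (5 * Γ *
            (((1 : ℝ) + r) / (1 + r₀)) ^ (((j + 1 : ℕ) : ℝ) * ε))) := by
          rw [← Finset.mul_sum]
          gcongr
          exact hR.trans (mul_le_mul_of_nonneg_left hgr (Nat.cast_nonneg _))
      _ = _ := by rw [hprod]; ring

/-- Starting at radius `r₀` makes the distance factor 1. As `X` has at most `k` sites, the product
of the successive support sizes is at most `j! k^j`. -/
lemma norm_commutatorMap_pow_term_le (hp : p.Valid) (hb : InteractionBound p h)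
    (hsupp : ∀ Z, SupportedOn (h Z) Z) (hlocal : ∀ Z, p.k < Z.card → h Z = 0)
    (hΓ : 0 ≤ Γ) (hε : 0 ≤ ε)
    (hgrow : ∀ r : ℕ, r₀ ≤ r → p.gbar r ≤ Γ * (((1 : ℝ) + r) / (1 + r₀)) ^ ε)
    (F : Finset (Finset Λ)) {j : ℕ} (hj : (j : ℝ) * ε ≤ 1 / 2) {X : Finset Λ}
    (hX : extent X ≤ r₀) :
    ‖(commutatorMap (∑ Z ∈ F, h Z) ^ j) (h X)‖
      ≤ ‖h X‖ * (j.factorial * (10 * p.k * Γ) ^ j) := by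
  rcases lt_or_ge p.k X.card with hk | hk
  · simp [hlocal X hk]
  have h1 := norm_commutatorMap_pow_le hp hb hsupp hlocal hΓ hε hgrow F j hj X r₀ (h X) le_rfl
    (fun x hx => (natAbs_le_extent hx).trans hX) (fun Z hZ => (hsupp Z).commute (hsupp X) hZ)
  rw [div_self (by positivity), Real.one_rpow, mul_one] at h1
  refine h1.trans ?_
  have h2 : ∏ t ∈ Finset.range j, ((X.card : ℝ) + t * p.k) ≤ j.factorial * (p.k : ℝ) ^ j := by
    have e : (j.factorial : ℝ) * (p.k : ℝ) ^ j
        = ∏ t ∈ Finset.range j, (((t + 1 : ℕ) : ℝ) * p.k) := by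
      rw [Finset.prod_mul_distrib, Finset.prod_const, Finset.card_range,
        ← Finset.prod_range_add_one_eq_factorial]
      push_cast
      rfl
    rw [e]
    refine Finset.prod_le_prod (fun t _ => by positivity) fun t _ => ?_
    have : (X.card : ℝ) ≤ p.k := by exact_mod_cast hk
    push_cast
    linarith
  calc _ ≤ ‖h X‖ * (j.factorial * (p.k : ℝ) ^ j) * (10 * Γ) ^ j := by gcongr
    _ = _ := by rw [mul_pow, mul_pow, mul_pow]; ring

end Growth

end Commutators

/-! ### Concentration of the block energy in the ground state -/

/-- With `L = log u`, the inequality `x ≤ e^x` at `x = L/(2χm)` gives `L^χ ≤ (2χm)^χ u^(1/(2m))`.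
The exponent is chosen so that `m` such factors cost no more than `u^(1/2)`. -/
lemma ChainParams.Valid.gbar_le_mul_rpow {p : ChainParams} (hp : p.Valid) {m : ℕ} (hm : 1 ≤ m)
    {r₀ r : ℕ} (hr : r₀ ≤ r) :
    p.gbar r ≤ (2 : ℝ) ^ p.χ * (p.gbar r₀ + p.g₁ * (2 * p.χ * m) ^ p.χ)
      * (((1 : ℝ) + r) / (1 + r₀)) ^ (1 / (2 * m : ℝ)) := by
  have hχ := hp.χ_pos
  have hm0 : (0 : ℝ) < m := by exact_mod_cast hm
  have hr' : (r₀ : ℝ) ≤ r := by exact_mod_cast hr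
  have hr0 : (0 : ℝ) ≤ r₀ := Nat.cast_nonneg _
  set u : ℝ := ((1 : ℝ) + r) / (1 + r₀) with hu
  have hu1 : 1 ≤ u := by rw [hu, one_le_div (by positivity)]; linarith
  have hu0 : 0 < u := by linarith
  set a := Real.log ((r₀ : ℝ) + 1) with ha
  set L := Real.log u with hL
  have ha0 : 0 ≤ a := Real.log_nonneg (by linarith)
  have hL0 : 0 ≤ L := Real.log_nonneg hu1
  have hsum : Real.log ((r : ℝ) + 1) = a + L := by
    rw [ha, hL, ← Real.log_mul (by positivity) hu0.ne', hu]
    congr 1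
    field_simp
    ring
  have hpow : (a + L) ^ p.χ ≤ (2 : ℝ) ^ p.χ * (a ^ p.χ + L ^ p.χ) := by
    have h1 : a + L ≤ 2 * max a L := by linarith [le_max_left a L, le_max_right a L]
    refine (Real.rpow_le_rpow (by positivity) h1 hχ.le).trans ?_
    rw [Real.mul_rpow (by norm_num) (le_max_of_le_left ha0)]
    refine mul_le_mul_of_nonneg_left ?_ (by positivity)
    have h2 := Real.rpow_nonneg ha0 p.χ
    have h3 := Real.rpow_nonneg hL0 p.χ
    rcases max_choice a L with h | h <;> rw [h] <;> linarith
  set w : ℝ := u ^ (1 / (2 * m : ℝ)) with hw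
  have hw1 : 1 ≤ w := Real.one_le_rpow hu1 (by positivity)
  have hLw : L ^ p.χ ≤ (2 * p.χ * m) ^ p.χ * w := by
    have h1 : L ≤ 2 * p.χ * m * Real.exp (L / (2 * p.χ * m)) := by
      have := Real.add_one_le_exp (L / (2 * p.χ * m))
      have h2 : L = 2 * p.χ * m * (L / (2 * p.χ * m)) := by field_simp
      calc L = 2 * p.χ * m * (L / (2 * p.χ * m)) := h2
        _ ≤ _ := mul_le_mul_of_nonneg_left (by linarith) (by positivity)
    refine (Real.rpow_le_rpow hL0 h1 hχ.le).trans ?_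
    rw [Real.mul_rpow (by positivity) (Real.exp_pos _).le, ← Real.exp_mul, hw,
      Real.rpow_def_of_pos hu0, ← hL]
    refine le_of_eq ?_
    congr 2
    field_simp
  have h2χ : 1 ≤ (2 : ℝ) ^ p.χ := Real.one_le_rpow (by norm_num) hχ.le
  have hg0 := hp.g₀_pos
  have hg1 := hp.g₁_pos
  have haχ : 0 ≤ a ^ p.χ := Real.rpow_nonneg ha0 _
  have h2w : 1 ≤ (2 : ℝ) ^ p.χ * w := by nlinarith
  have e1 : p.g₀ ≤ p.g₀ * ((2 : ℝ) ^ p.χ * w) := le_mul_of_one_le_right hg0.le h2w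
  have e2 : p.g₁ * (a + L) ^ p.χ
      ≤ p.g₁ * ((2 : ℝ) ^ p.χ * (a ^ p.χ * w + (2 * p.χ * m) ^ p.χ * w)) := by
    refine mul_le_mul_of_nonneg_left (hpow.trans (mul_le_mul_of_nonneg_left ?_ (by positivity)))
      hg1.le
    have := le_mul_of_one_le_right haχ hw1
    linarith
  unfold ChainParams.gbar
  rw [hsum, ← ha]
  calc p.g₀ + p.g₁ * (a + L) ^ p.χ ≤ _ := add_le_add e1 e2
    _ = _ := by ring

/-- Young's inequality, equivalently the tangent to a power function at `M`. Averaged over a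
probability weight, it turns a bound on the ratio of consecutive moments into a bound on the moment
itself. -/
lemma mul_pow_add_pow_ge {t M : ℝ} (ht : 0 ≤ t) (hM : 0 ≤ M) (n : ℕ) :
    (n + 1 : ℝ) * M * t ^ n ≤ n * t ^ (n + 1) + M ^ (n + 1) := by
  induction n with
  | zero => simp
  | succ n ih =>
    have h1 : 0 ≤ (t ^ (n + 1) - M ^ (n + 1)) * (t - M) := by
      rcases le_total t M with h | h
      · exact mul_nonneg_of_nonpos_of_nonpos (sub_nonpos.2 (pow_le_pow_left₀ ht h _))
          (sub_nonpos.2 h)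
      · exact mul_nonneg (sub_nonneg.2 (pow_le_pow_left₀ hM h _)) (sub_nonneg.2 h)
    have h2 := mul_le_mul_of_nonneg_left ih ht
    push_cast
    calc ((n : ℝ) + 1 + 1) * M * t ^ (n + 1)
        = t * ((n + 1 : ℝ) * M * t ^ n) + M * t ^ (n + 1) := by ring
      _ ≤ t * (n * t ^ (n + 1) + M ^ (n + 1)) + M * t ^ (n + 1)
          + (t ^ (n + 1) - M ^ (n + 1)) * (t - M) := by linarith
      _ = _ := by ring

section Concentration

open scoped InnerProductSpace

variable {Λ : Finset ℤ} {N : ℤ → ℕ}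

/-- Sum of the geometrically weighted commutator contributions. -/
lemma norm_pow_mul_apply_le {G V : ChainOp Λ N} {Ω : ChainSpace Λ N} {v D c : ℝ} {m : ℕ}
    (hv : 0 ≤ v) (hD : 0 ≤ D) (hcD : 2 * (m * D) ≤ c)
    (had : ∀ j ≤ m, ‖(commutatorMap G ^ j) V‖ ≤ v * (j.factorial * D ^ j))
    (hG : ∀ j ≤ m, c ^ j * ‖(G ^ (m - j)) Ω‖ ≤ ‖(G ^ m) Ω‖) :
    ‖(G ^ m) (V Ω)‖ ≤ 2 * v * ‖(G ^ m) Ω‖ := by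
  have hterm : ∀ j ∈ Finset.range (m + 1),
      ‖((m.choose j : ℂ) • ((commutatorMap G ^ j) V * G ^ (m - j))) Ω‖
      ≤ v * ‖(G ^ m) Ω‖ * (1 / 2 : ℝ) ^ j := by
    intro j hj
    have hjm : j ≤ m := by simpa [Nat.lt_succ_iff] using hj
    -- The factorial growth of the commutators is absorbed by the binomial coefficient: their
    -- product is a descending factorial.
    have h1 : ((m.choose j : ℝ) * j.factorial) ≤ (m : ℝ) ^ j := by
      have := Nat.descFactorial_le_pow m j
      rw [Nat.descFactorial_eq_factorial_mul_choose] at this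
      calc ((m.choose j : ℝ) * j.factorial) = ((j.factorial * m.choose j : ℕ) : ℝ) := by
            push_cast; ring
        _ ≤ _ := by exact_mod_cast this
    -- Each lost power of `G` is worth at least `c ≥ 2mD`, so every further commutator gains a
    -- factor `1/2`.
    have h2 : (m * D) ^ j ≤ (1 / 2 : ℝ) ^ j * c ^ j := by
      rw [← mul_pow]
      exact pow_le_pow_left₀ (by positivity) (by linarith) j
    change ‖(m.choose j : ℂ) • ((commutatorMap G ^ j) V ((G ^ (m - j)) Ω))‖ ≤ _
    rw [norm_smul, Complex.norm_natCast]
    calc (m.choose j : ℝ) * ‖(commutatorMap G ^ j) V ((G ^ (m - j)) Ω)‖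
        ≤ (m.choose j : ℝ) * (v * (j.factorial * D ^ j) * ‖(G ^ (m - j)) Ω‖) := by
          gcongr
          exact (ContinuousLinearMap.le_opNorm _ _).trans
            (mul_le_mul_of_nonneg_right (had j hjm) (norm_nonneg _))
      _ = v * ((m.choose j : ℝ) * j.factorial * D ^ j) * ‖(G ^ (m - j)) Ω‖ := by ring
      _ ≤ v * ((m : ℝ) ^ j * D ^ j) * ‖(G ^ (m - j)) Ω‖ := by gcongr
      _ = v * ‖(G ^ (m - j)) Ω‖ * (m * D) ^ j := by rw [mul_pow]; ring
      _ ≤ v * ‖(G ^ (m - j)) Ω‖ * ((1 / 2 : ℝ) ^ j * c ^ j) := by gcongr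
      _ = v * (1 / 2 : ℝ) ^ j * (c ^ j * ‖(G ^ (m - j)) Ω‖) := by ring
      _ ≤ v * (1 / 2 : ℝ) ^ j * ‖(G ^ m) Ω‖ := by gcongr; exact hG j hjm
      _ = _ := by ring
  have hgeo : ∑ j ∈ Finset.range (m + 1), (1 / 2 : ℝ) ^ j ≤ 2 := by
    have := summable_geometric_two.sum_le_tsum (Finset.range (m + 1)) fun _ _ => by positivity
    rwa [tsum_geometric_two] at this
  have e : (G ^ m) (V Ω) = (G ^ m * V) Ω := rfl
  rw [e, pow_mul_eq_sum_commutatorMap, _root_.sum_apply]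
  calc _ ≤ ∑ j ∈ Finset.range (m + 1), v * ‖(G ^ m) Ω‖ * (1 / 2 : ℝ) ^ j :=
        (norm_sum_le _ _).trans (Finset.sum_le_sum hterm)
    _ ≤ v * ‖(G ^ m) Ω‖ * 2 := by
        rw [← Finset.mul_sum]
        exact mul_le_mul_of_nonneg_left hgeo (by positivity)
    _ = _ := by ring

lemma inner_pow_apply {G : ChainOp Λ N} (hG : IsSelfAdjoint G) {e x : ChainSpace Λ N} {t : ℝ}
    (he : G e = (t : ℂ) • e) (n : ℕ) : ⟪e, (G ^ n) x⟫_ℂ = (t : ℂ) ^ n * ⟪e, x⟫_ℂ := by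
  induction n with
  | zero => simp
  | succ n ih =>
    rw [pow_succ', mul_apply_eq_comp, ← hG.inner_apply_left, he, inner_smul_left,
      Complex.conj_ofReal, ih]
    ring

/-- If `A` and `B` commute and the perturbation `V` has nested commutators with `A` of factorial
growth, then a low eigenvector of `A + B + V` has little weight at high energies of `A`. -/
lemma norm_sub_starProjection_le {A B V : ChainOp Λ N} (hA : IsSelfAdjoint A)
    (hAB : Commute A B) {Ω : ChainSpace Λ N} (hΩ1 : ‖Ω‖ = 1) {b v D E₀ τ : ℝ} {m : ℕ}
    (hB : ∀ x, b * ‖x‖ ^ 2 ≤ RCLike.re ⟪x, B x⟫_ℂ)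
    (hΩ : (A + B + V) Ω = (E₀ : ℂ) • Ω) (hE₀ : E₀ ≤ energyLevel A ⊤ 0 + b + v)
    (hv : 0 ≤ v) (hD : 0 < D) (hm : 1 ≤ m) (hτ : 0 ≤ τ)
    (had : ∀ j ≤ m, ‖(commutatorMap A ^ j) V‖ ≤ v * (j.factorial * D ^ j)) :
    ‖Ω - (spectralSubspace A ⊤ (energyLevel A ⊤ 0 + τ)).starProjection Ω‖
      ≤ ((3 * v + 2 * (m * D)) / (τ + 2 * (m * D))) ^ m := by
  set a := energyLevel A ⊤ 0 with ha
  set c : ℝ := 2 * (m * D) with hcdef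
  have hm0 : (0 : ℝ) < m := by exact_mod_cast hm
  have hc : 0 < c := by positivity
  obtain ⟨n, e, ev, he⟩ := exists_eigenbasis hA (W := ⊤) fun _ _ => Submodule.mem_top
  have hev : ∀ i, a ≤ ev i := fun i => by
    have h1 := energyLevel_zero_mul_le hA (W := ⊤) (fun _ _ => Submodule.mem_top)
      (x := (e i : ChainSpace Λ N)) Submodule.mem_top
    rw [he, inner_smul_right, inner_self_eq_norm_sq_to_K] at h1
    have h2 : ‖(e i : ChainSpace Λ N)‖ = 1 := e.orthonormal.1 i
    simpa [h2] using h1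
  -- The shift puts the bottom of the spectrum at `c = 2mD` without changing any commutator.
  let G : ChainOp Λ N := A + ((c - a : ℝ) : ℂ) • 1
  have hGsa : IsSelfAdjoint G := by
    change IsSelfAdjoint (A + ((c - a : ℝ) : ℂ) • (1 : ChainOp Λ N))
    refine IsSelfAdjoint.add (R := ChainOp Λ N) hA ?_
    rw [IsSelfAdjoint, star_smul, star_one]
    simp
  have hGA : commutatorMap G = commutatorMap A := by
    ext1 X
    simp only [commutatorMap_apply, G, add_mul, mul_add, smul_mul_assoc, mul_smul_comm, one_mul,
      mul_one]
    abel
  let t : Fin n → ℝ := fun i => ev i - a + c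
  have htc : ∀ i, c ≤ t i := fun i => by have := hev i; simp only [t]; linarith
  have ht0 : ∀ i, 0 ≤ t i := fun i => hc.le.trans (htc i)
  have hGe : ∀ i, G (e i : ChainSpace Λ N) = (t i : ℂ) • (e i : ChainSpace Λ N) := fun i => by
    change A (e i : ChainSpace Λ N) + ((c - a : ℝ) : ℂ) • (e i : ChainSpace Λ N) = _
    rw [he, ← add_smul]
    congr 1
    simp only [t]
    push_cast
    ring
  let w : Fin n → ℝ := fun i => ‖⟪(e i : ChainSpace Λ N), Ω⟫_ℂ‖ ^ 2
  have hw0 : ∀ i, 0 ≤ w i := fun i => sq_nonneg _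
  have hw1 : ∑ i, w i = 1 := by
    rw [← norm_sq_eq_sum e (x := Ω) Submodule.mem_top, hΩ1, one_pow]
  have hcoef : ∀ (k : ℕ) (i : Fin n),
      ‖⟪(e i : ChainSpace Λ N), (G ^ k) Ω⟫_ℂ‖ ^ 2 = t i ^ (2 * k) * w i := fun k i => by
    rw [inner_pow_apply hGsa (hGe i), norm_mul, norm_pow, Complex.norm_real, Real.norm_eq_abs,
      abs_of_nonneg (ht0 i), mul_pow, ← pow_mul, mul_comm k 2]
  have hnorm : ∀ k : ℕ, ‖(G ^ k) Ω‖ ^ 2 = ∑ i, t i ^ (2 * k) * w i := fun k => by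
    rw [norm_sq_eq_sum e (x := (G ^ k) Ω) Submodule.mem_top]
    exact Finset.sum_congr rfl fun i _ => hcoef k i
  have hlow : ∀ j ≤ m, c ^ j * ‖(G ^ (m - j)) Ω‖ ≤ ‖(G ^ m) Ω‖ := by
    intro j hj
    refine (sq_le_sq₀ (by positivity) (by positivity)).1 ?_
    rw [mul_pow, hnorm, hnorm, Finset.mul_sum]
    refine Finset.sum_le_sum fun i _ => ?_
    rw [← mul_assoc]
    refine mul_le_mul_of_nonneg_right ?_ (hw0 i)
    have e1 : t i ^ (2 * m) = (t i ^ j) ^ 2 * t i ^ (2 * (m - j)) := by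
      rw [← pow_mul, ← pow_add]; congr 1; omega
    rw [e1]
    have := pow_le_pow_left₀ hc.le (htc i) j
    have h0 := ht0 i
    gcongr
  set Ψ := (G ^ m) Ω with hΨ
  have hVΨ : ‖(G ^ m) (V Ω)‖ ≤ 2 * v * ‖Ψ‖ :=
    norm_pow_mul_apply_le hv hD.le le_rfl (fun j hj => by rw [hGA]; exact had j hj) hlow
  have hcommA : Commute (G ^ m) A := by
    refine Commute.pow_left ?_ m
    exact (Commute.refl A).add_left ((Commute.one_left A).smul_left _)
  have hcommB : Commute (G ^ m) B := by
    refine Commute.pow_left ?_ m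
    exact hAB.add_left ((Commute.one_left B).smul_left _)
  have heq : A Ψ + B Ψ + (G ^ m) (V Ω) = (E₀ : ℂ) • Ψ := by
    have h1 := congrArg (G ^ m) hΩ
    have hA' : (G ^ m) (A Ω) = A ((G ^ m) Ω) := congrArg (fun f : ChainOp Λ N => f Ω) hcommA.eq
    have hB' : (G ^ m) (B Ω) = B ((G ^ m) Ω) := congrArg (fun f : ChainOp Λ N => f Ω) hcommB.eq
    rw [map_smul, _root_.add_apply, _root_.add_apply, map_add, map_add,
      hA', hB'] at h1
    exact h1
  -- Here `E₀ ≤ a + b + v`, `B` contributes at least `b`, and the term with `V` at least `-2v`;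
  -- together these leave `a + 3v`.
  have hAΨ : RCLike.re ⟪Ψ, A Ψ⟫_ℂ ≤ (a + 3 * v) * ‖Ψ‖ ^ 2 := by
    have h1 := congrArg (fun y => RCLike.re ⟪Ψ, y⟫_ℂ) heq
    simp only [inner_add_right, map_add, inner_smul_right, inner_self_eq_norm_sq_to_K] at h1
    have h2 : RCLike.re ((E₀ : ℂ) * ((‖Ψ‖ : ℝ) : ℂ) ^ 2) = E₀ * ‖Ψ‖ ^ 2 := by
      rw [← Complex.ofReal_pow]
      exact Complex.re_ofReal_mul _ _
    have h3 : -(2 * v * ‖Ψ‖ ^ 2) ≤ RCLike.re ⟪Ψ, (G ^ m) (V Ω)⟫_ℂ := by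
      have h4 := abs_le.1 ((RCLike.abs_re_le_norm _).trans
        (norm_inner_le_norm (𝕜 := ℂ) Ψ ((G ^ m) (V Ω))))
      have h5 := mul_le_mul_of_nonneg_left hVΨ (norm_nonneg Ψ)
      nlinarith [h4.1]
    have h6 := hB Ψ
    have h7 := mul_le_mul_of_nonneg_right hE₀ (sq_nonneg ‖Ψ‖)
    have h8 : RCLike.re ⟪Ψ, A Ψ⟫_ℂ + RCLike.re ⟪Ψ, B Ψ⟫_ℂ
        + RCLike.re ⟪Ψ, (G ^ m) (V Ω)⟫_ℂ = E₀ * ‖Ψ‖ ^ 2 := h1.trans h2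
    nlinarith
  set M : ℝ := 3 * v + c with hM
  have hM0 : 0 < M := by positivity
  set S := ∑ i, t i ^ (2 * m) * w i with hS
  have hS1 : ∑ i, t i ^ (2 * m + 1) * w i ≤ M * S := by
    have h1 := inner_apply_eq_sum hA e ev he (fun _ _ => Submodule.mem_top)
      (x := Ψ) Submodule.mem_top
    simp only [hΨ, hcoef] at h1
    rw [← hΨ] at h1
    have h2 : ∑ i, t i ^ (2 * m + 1) * w i
        = ∑ i, ev i * (t i ^ (2 * m) * w i) + (c - a) * S := by
      rw [hS, Finset.mul_sum, ← Finset.sum_add_distrib]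
      refine Finset.sum_congr rfl fun i _ => ?_
      rw [pow_succ]
      have : t i = ev i + (c - a) := by simp only [t]; ring
      conv_lhs => rw [mul_assoc, mul_comm (t i) (w i), ← mul_assoc, this]
      rw [← this]
      ring
    rw [h2, ← h1]
    have h3 : ‖Ψ‖ ^ 2 = S := hnorm m
    rw [h3] at hAΨ
    nlinarith
  -- The averaged tangent inequality reads `(2m+1) M S ≤ 2m · M S + M^(2m+1)`, using that the
  -- weights `w` sum to 1.
  have hSM : S ≤ M ^ (2 * m) := by
    have h1 : ∑ i, ((2 * m : ℕ) + 1 : ℝ) * M * t i ^ (2 * m) * w i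
        ≤ ∑ i, ((2 * m : ℕ) * t i ^ (2 * m + 1) + M ^ (2 * m + 1)) * w i :=
      Finset.sum_le_sum fun i _ => mul_le_mul_of_nonneg_right
        (mul_pow_add_pow_ge (ht0 i) hM0.le (2 * m)) (hw0 i)
    have h2 : ∑ i, ((2 * m : ℕ) + 1 : ℝ) * M * t i ^ (2 * m) * w i
        = ((2 * m : ℕ) + 1 : ℝ) * M * S := by
      rw [hS, Finset.mul_sum]
      exact Finset.sum_congr rfl fun i _ => by ring
    have h3 : ∑ i, ((2 * m : ℕ) * t i ^ (2 * m + 1) + M ^ (2 * m + 1)) * w i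
        = (2 * m : ℕ) * (∑ i, t i ^ (2 * m + 1) * w i) + M ^ (2 * m + 1) := by
      rw [Finset.mul_sum]
      simp only [add_mul, Finset.sum_add_distrib]
      rw [← Finset.mul_sum, hw1, mul_one]
      congr 1
      exact Finset.sum_congr rfl fun i _ => by ring
    rw [h2, h3] at h1
    have h4 := mul_le_mul_of_nonneg_left hS1 (Nat.cast_nonneg (2 * m) : (0 : ℝ) ≤ (2 * m : ℕ))
    have h5 : M * S ≤ M * M ^ (2 * m) := by
      rw [← pow_succ']
      nlinarith
    exact le_of_mul_le_mul_left h5 hM0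
  set P := (spectralSubspace A ⊤ (a + τ)).starProjection with hP
  -- Markov's inequality, component by component: what survives off the spectral subspace has `t i ≥
  -- τ + c`.
  have hQ : ∀ i, ‖⟪(e i : ChainSpace Λ N), Ω - P Ω⟫_ℂ‖ ^ 2 * (τ + c) ^ (2 * m)
      ≤ t i ^ (2 * m) * w i := by
    intro i
    have hsym : ⟪(e i : ChainSpace Λ N), P Ω⟫_ℂ = ⟪P (e i : ChainSpace Λ N), Ω⟫_ℂ :=
      (Submodule.inner_starProjection_left_eq_right _ _ _).symm
    rw [inner_sub_right, hsym]
    rcases le_or_gt (ev i) (a + τ) with hi | hi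
    · have hmem := mem_spectralSubspace (W := ⊤) hi Submodule.mem_top (he i)
      rw [hP, Submodule.starProjection_eq_self_iff.2 hmem, sub_self, norm_zero]
      have := mul_nonneg (pow_nonneg (ht0 i) (2 * m)) (hw0 i)
      simpa using this
    · have hort : (e i : ChainSpace Λ N) ∈ (spectralSubspace A ⊤ (a + τ))ᗮ := by
        have hle : spectralSubspace A ⊤ (a + τ) ≤ (ℂ ∙ (e i : ChainSpace Λ N))ᗮ :=
          spectralSubspace_le_of_forall fun μ hμ y _ hy =>
            Submodule.mem_orthogonal_singleton_iff_inner_right.2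
              (hA.inner_eigenvectors (by linarith : ev i ≠ μ) (he i) hy)
        rw [Submodule.mem_orthogonal]
        intro y hy
        exact Submodule.mem_orthogonal_singleton_iff_inner_left.1 (hle hy)
      rw [hP, (Submodule.starProjection_apply_eq_zero_iff _).2 hort, inner_zero_left, sub_zero,
        mul_comm]
      refine mul_le_mul_of_nonneg_right (pow_le_pow_left₀ (by positivity) ?_ _) (hw0 i)
      simp only [t]
      linarith
  have hfin : ‖Ω - P Ω‖ ^ 2 * (τ + c) ^ (2 * m) ≤ M ^ (2 * m) := by
    rw [norm_sq_eq_sum e (x := Ω - P Ω) Submodule.mem_top, Finset.sum_mul]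
    exact (Finset.sum_le_sum fun i _ => hQ i).trans hSM
  have hτc : 0 < τ + c := by linarith
  rw [div_pow, le_div_iff₀ (by positivity)]
  refine (sq_le_sq₀ (by positivity) (by positivity)).1 ?_
  rw [mul_pow, ← pow_mul, ← pow_mul, mul_comm m 2]
  exact hfin

end Concentration

/-! ### Numerical estimates -/

namespace ChainParams

variable {p : ChainParams}

lemma Valid.c₀_nonneg (hp : p.Valid) : 0 ≤ p.c₀ := by
  have := hp.one_le_η₁
  have := hp.one_le_η₂
  have := hp.J_nonneg 1
  unfold c₀
  positivity

lemma Valid.le_c₁ (hp : p.Valid) : 32 * (2 : ℝ) ^ p.χ * p.k ≤ p.c₁ := by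
  have h1 : 0 < (2 : ℝ) ^ (-p.α) := by positivity
  have h2 : (2 : ℝ) ^ (-p.α) < 1 := Real.rpow_lt_one_of_one_lt_of_neg (by norm_num)
    (by linarith [hp.α_pos])
  have h3 : (2 : ℝ) ^ (p.χ + 3) = 8 * (2 : ℝ) ^ p.χ := by
    rw [Real.rpow_add (by norm_num)]; norm_num; ring
  have h4 : 0 ≤ 32 * (2 : ℝ) ^ p.χ * p.k := by positivity
  have h5 := hp.one_le_η₁
  rw [c₁, le_div_iff₀ (by linarith), h3]
  have h6 : 32 * (2 : ℝ) ^ p.χ * p.k * (1 - (2 : ℝ) ^ (-p.α)) ≤ 32 * (2 : ℝ) ^ p.χ * p.k :=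
    mul_le_of_le_one_right h4 (by linarith)
  have h7 := mul_le_mul_of_nonneg_left h5 h4
  linarith

lemma Valid.c₁_pos (hp : p.Valid) : 0 < p.c₁ := by
  refine lt_of_lt_of_le ?_ hp.le_c₁
  have : (0 : ℝ) < p.k := by exact_mod_cast hp.one_le_k
  positivity

/-- Holds because `(2 + α)/α ≥ 1`; this is the form in which `c̃₂` meets the factor `(2χm)^χ` of the
commutator rate. -/
lemma Valid.le_c₂ (hp : p.Valid) : p.c₁ * (2 * p.χ) ^ p.χ ≤ p.c₂ := by
  have h1 := hp.χ_pos
  have h2 := hp.α_pos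
  refine mul_le_mul_of_nonneg_left (Real.rpow_le_rpow (by positivity) ?_ h1.le) hp.c₁_pos.le
  rw [le_div_iff₀ h2]
  nlinarith [mul_pos h1 h2]

lemma Valid.c₂_pos (hp : p.Valid) : 0 < p.c₂ := by
  have := hp.c₁_pos
  have := hp.χ_pos
  have := hp.α_pos
  unfold c₂
  positivity

lemma Valid.three_le_c₃ (hp : p.Valid) : 3 ≤ p.c₃ := by
  have h2 := hp.α_pos
  have h3 : 1 ≤ (2 : ℝ) ^ p.α := Real.one_le_rpow (by norm_num) h2.le
  have h4 : 2 ≤ 2 * (2 + p.α) / p.α := by rw [le_div_iff₀ h2]; linarith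
  unfold c₃
  linarith

/-- The prefactor `2 c₀ c̃₃ + c̃₁` of the energy scales. -/
lemma Valid.scale_bounds (hp : p.Valid) :
    6 * p.c₀ ≤ 2 * p.c₀ * p.c₃ + p.c₁ ∧ p.c₁ ≤ 2 * p.c₀ * p.c₃ + p.c₁ := by
  have h0 := hp.c₀_nonneg
  have h1 := hp.c₁_pos
  have h3 := mul_le_mul_of_nonneg_left hp.three_le_c₃ h0
  constructor <;> linarith

lemma Valid.scale_pos (hp : p.Valid) : 0 < 2 * p.c₀ * p.c₃ + p.c₁ :=
  hp.c₁_pos.trans_le hp.scale_bounds.2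

lemma Valid.T_zero (hp : p.Valid) (q l : ℕ) :
    p.T q l 0 = (2 * p.c₀ * p.c₃ + p.c₁) * p.gbar ((q : ℝ) * l) := by
  simp [T, Real.zero_rpow hp.χ_pos.ne']

lemma Valid.T_zero_pos (hp : p.Valid) (q l : ℕ) : 0 < p.T q l 0 := by
  rw [hp.T_zero]
  exact mul_pos hp.scale_pos (hp.gbar_pos (by positivity))

lemma Valid.T_zero_le_Ttilde (hp : p.Valid) (q l : ℕ) {z : ℝ} (hz : 0 ≤ z) :
    p.T q l 0 ≤ p.Ttilde q l z := by
  rw [hp.T_zero, Ttilde]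
  exact mul_le_mul_of_nonneg_left (hp.gbar_mono (by positivity) (by linarith)) hp.scale_pos.le

lemma one_le_log_of_three_le {x : ℝ} (hx : 3 ≤ x) : 1 ≤ Real.log x := by
  rw [Real.le_log_iff_exp_le (by linarith)]
  linarith [Real.exp_one_lt_d9]

lemma Valid.g₁_le_gbar (hp : p.Valid) {x : ℝ} (hx : 2 ≤ x) : p.g₁ ≤ p.gbar x := by
  have h1 := Real.one_le_rpow (one_le_log_of_three_le (by linarith : 3 ≤ x + 1)) hp.χ_pos.le
  have := hp.g₀_pos
  have := mul_le_mul_of_nonneg_left h1 hp.g₁_pos.le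
  unfold gbar
  linarith

lemma one_le_μ₁ : 1 ≤ p.μ₁ := by
  have : 0 ≤ ∫ z in Set.Ioi (0 : ℝ),
      (z + 3) * Real.exp (-(1 / (4 * Real.exp 1) * (z / (1 + Real.log (z + 3) ^ p.χ)))) :=
    MeasureTheory.setIntegral_nonneg measurableSet_Ioi fun z hz => by
      have : (0 : ℝ) < z := hz
      positivity
  unfold μ₁
  linarith

lemma one_le_μ₂ : 1 ≤ p.μ₂ := by
  have : 0 ≤ ∫ z in Set.Ioi (0 : ℝ),
      (z + 3) * Real.exp (-(((2 * p.c₀ * p.c₃ + p.c₁) / (4 * Real.exp 1 * p.c₂) * z)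
        ^ (1 / (1 + p.χ)))) :=
    MeasureTheory.setIntegral_nonneg measurableSet_Ioi fun z hz => by
      have : (0 : ℝ) < z := hz
      positivity
  unfold μ₂
  linarith

/-- On `(0, 4e]` the exponent in the integrand is at least `-1`, so the integral is at least `3 e⁻¹
· 4e = 12`. It serves the range where no commutator order is good enough: there the error function
already exceeds 1. -/
lemma Valid.exp_one_le_μ₂ (hp : p.Valid) (h : 2 * p.c₀ * p.c₃ + p.c₁ ≤ p.c₂) :
    Real.exp 1 ≤ p.μ₂ := by
  have hc₂ := hp.c₂_pos
  have hχ := hp.χ_pos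
  set s : ℝ := 1 / (1 + p.χ) with hs
  have hs0 : 0 < s := by positivity
  set κ : ℝ := (2 * p.c₀ * p.c₃ + p.c₁) / (4 * Real.exp 1 * p.c₂) with hκ
  have he := Real.exp_pos 1
  have hκ0 : 0 < κ := div_pos hp.scale_pos (by positivity)
  have hκ1 : κ * (4 * Real.exp 1) ≤ 1 := by
    rw [hκ, div_mul_eq_mul_div, div_le_one (by positivity)]
    nlinarith
  set f : ℝ → ℝ := fun z => (z + 3) * Real.exp (-((κ * z) ^ s)) with hf
  -- Integrability is essential: the integral of a nonintegrable function is 0 by default.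
  have hint : MeasureTheory.IntegrableOn f (Set.Ioi 0) := by
    have h1 := integrableOn_rpow_mul_exp_neg_mul_rpow (p := s) (s := 1) (b := κ ^ s)
      (by norm_num) hs0 (by positivity)
    have h0 := integrableOn_rpow_mul_exp_neg_mul_rpow (p := s) (s := 0) (b := κ ^ s)
      (by norm_num) hs0 (by positivity)
    refine (h1.add (h0.const_mul 3)).congr_fun (fun z hz => ?_) measurableSet_Ioi
    have hz0 : (0 : ℝ) < z := hz
    simp only [hf, Pi.add_apply, Real.rpow_one, Real.rpow_zero,
      Real.mul_rpow hκ0.le hz0.le, neg_mul]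
    ring
  have hsub : Set.Ioc (0 : ℝ) (4 * Real.exp 1) ⊆ Set.Ioi 0 := fun z hz => hz.1
  have h1 : 3 * Real.exp (-1) * (MeasureTheory.volume.real (Set.Ioc (0 : ℝ) (4 * Real.exp 1)))
      ≤ ∫ z in Set.Ioc (0 : ℝ) (4 * Real.exp 1), f z := by
    refine MeasureTheory.setIntegral_ge_of_const_le_real measurableSet_Ioc measure_Ioc_lt_top.ne
      (fun z hz => ?_)
      (hint.mono_set hsub)
    have hz0 : 0 < z := hz.1
    have hκz : κ * z ≤ 1 := (mul_le_mul_of_nonneg_left hz.2 hκ0.le).trans hκ1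
    have h2 : (κ * z) ^ s ≤ 1 := Real.rpow_le_one (by positivity) hκz hs0.le
    simp only [hf]
    gcongr
    linarith
  have h2 : ∫ z in Set.Ioc (0 : ℝ) (4 * Real.exp 1), f z ≤ ∫ z in Set.Ioi (0 : ℝ), f z := by
    refine MeasureTheory.setIntegral_mono_set hint ?_ hsub.eventuallyLE
    filter_upwards [MeasureTheory.ae_restrict_mem measurableSet_Ioi] with z hz
    have hz0 : (0 : ℝ) < z := hz
    simp only [hf, Pi.zero_apply]
    positivity
  rw [Real.volume_real_Ioc_of_le (by positivity)] at h1
  have h3 : Real.exp (-1) * Real.exp 1 = 1 := by rw [← Real.exp_add]; simp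
  have h4 : 12 ≤ ∫ z in Set.Ioi (0 : ℝ), f z := by
    refine le_trans (le_of_eq ?_) (h1.trans h2)
    calc (12 : ℝ) = 12 * (Real.exp (-1) * Real.exp 1) := by rw [h3, mul_one]
      _ = _ := by ring
  have h5 := Real.exp_one_lt_d9
  have h6 : p.μ₂ = 1 + ∫ z in Set.Ioi (0 : ℝ), f z := rfl
  linarith

lemma errorFn_nonneg (q l : ℕ) (y : ℝ) : 0 ≤ p.errorFn q l y := by
  have := one_le_μ₁ (p := p)
  have := one_le_μ₂ (p := p)
  unfold errorFn
  positivity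

lemma Valid.exp_le_errorFn (hp : p.Valid) (q l : ℕ) {y : ℝ} (hy : 0 ≤ y) :
    Real.exp (-(y / (4 * Real.exp 1 * p.T q l 0))) ≤ p.errorFn q l y := by
  have h1 := one_le_μ₁ (p := p)
  have h2 := one_le_μ₂ (p := p)
  have hT := hp.T_zero_pos q l
  have hTT := hp.T_zero_le_Ttilde q l (div_nonneg hy hT.le)
  have h3 : Real.exp (-(y / (4 * Real.exp 1 * p.T q l 0)))
      ≤ Real.exp (-(y / (4 * Real.exp 1 * p.Ttilde q l (y / p.T q l 0)))) := by
    gcongr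
  unfold errorFn
  have h4 := le_mul_of_one_le_left (Real.exp_pos
    (-(y / (4 * Real.exp 1 * p.Ttilde q l (y / p.T q l 0))))).le h1
  have h5 : 0 ≤ p.μ₂ * Real.exp (-((y / (4 * Real.exp 1 * p.c₂ * p.g₁)) ^ (1 / (1 + p.χ)))) := by
    positivity
  linarith

lemma mul_exp_le_errorFn (q l : ℕ) (y : ℝ) :
    p.μ₂ * Real.exp (-((y / (4 * Real.exp 1 * p.c₂ * p.g₁)) ^ (1 / (1 + p.χ))))
      ≤ p.errorFn q l y := by
  have h1 := one_le_μ₁ (p := p)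
  unfold errorFn
  have : 0 ≤ p.μ₁ * Real.exp (-(y / (4 * Real.exp 1 * p.Ttilde q l (y / p.T q l 0)))) := by
    positivity
  linarith

/-- The growth constant of the nested commutators. -/
noncomputable def commutatorRate (p : ChainParams) (q l m : ℕ) : ℝ :=
  10 * p.k * ((2 : ℝ) ^ p.χ * (p.gbar ((q : ℝ) * l) + p.g₁ * (2 * p.χ * m) ^ p.χ))

/-- The constant is `10/32`, from `c̃₁ ≥ 32 · 2^χ k`. It leaves room for the factors of `e` in the
choice of the order. -/
lemma Valid.commutatorRate_le (hp : p.Valid) (q l m : ℕ) :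
    p.commutatorRate q l m
      ≤ 5 / 16 * (p.T q l 0 + p.c₂ * p.g₁ * (m : ℝ) ^ p.χ) := by
  have hg := hp.gbar_pos (x := (q : ℝ) * l) (by positivity)
  have hg1 := hp.g₁_pos
  have hχ := hp.χ_pos
  have h1 : 10 * p.k * (2 : ℝ) ^ p.χ ≤ 5 / 16 * p.c₁ := by linarith [hp.le_c₁]
  have h2 : p.c₁ * p.gbar ((q : ℝ) * l) ≤ p.T q l 0 := by
    rw [hp.T_zero]
    exact mul_le_mul_of_nonneg_right hp.scale_bounds.2 hg.le
  have h3 : p.c₁ * (p.g₁ * (2 * p.χ * m) ^ p.χ) ≤ p.c₂ * p.g₁ * (m : ℝ) ^ p.χ := by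
    rw [Real.mul_rpow (by positivity) (Nat.cast_nonneg m)]
    calc p.c₁ * (p.g₁ * ((2 * p.χ) ^ p.χ * (m : ℝ) ^ p.χ))
        = p.c₁ * (2 * p.χ) ^ p.χ * (p.g₁ * (m : ℝ) ^ p.χ) := by ring
      _ ≤ p.c₂ * (p.g₁ * (m : ℝ) ^ p.χ) :=
          mul_le_mul_of_nonneg_right hp.le_c₂ (by positivity)
      _ = _ := by ring
  calc p.commutatorRate q l m
      = 10 * p.k * (2 : ℝ) ^ p.χ * (p.gbar ((q : ℝ) * l) + p.g₁ * (2 * p.χ * m) ^ p.χ) := by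
        unfold commutatorRate; ring
    _ ≤ 5 / 16 * p.c₁ * (p.gbar ((q : ℝ) * l) + p.g₁ * (2 * p.χ * m) ^ p.χ) :=
        mul_le_mul_of_nonneg_right h1 (by positivity)
    _ ≤ _ := by linarith

lemma Valid.commutatorRate_pos (hp : p.Valid) (q l m : ℕ) : 0 < p.commutatorRate q l m := by
  have hg := hp.gbar_pos (x := (q : ℝ) * l) (by positivity)
  have hg1 := hp.g₁_pos
  have hχ := hp.χ_pos
  have hk : (0 : ℝ) < p.k := by exact_mod_cast hp.one_le_k
  unfold commutatorRate
  positivity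

/-- A suitable commutator order brings the concentration bound below the error function. -/
lemma Valid.exists_order (hp : p.Valid) {q l : ℕ} (hql : 2 ≤ q * l) {τ v : ℝ} (hv0 : 0 ≤ v)
    (hv : v ≤ p.c₀ * p.gbar ((q : ℝ) * l) / 2) (hy : 0 ≤ p.shiftedCutoff q l τ) :
    1 ≤ p.errorFn q l (p.shiftedCutoff q l τ) ∨ ∃ m : ℕ, 1 ≤ m ∧
      ((3 * v + 2 * (m * p.commutatorRate q l m)) / (τ + 2 * (m * p.commutatorRate q l m))) ^ m
        ≤ p.errorFn q l (p.shiftedCutoff q l τ) := by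
  set y := p.shiftedCutoff q l τ with hydef
  set gb := p.gbar ((q : ℝ) * l) with hgb
  set T₀ := p.T q l 0 with hT₀
  set G := p.c₂ * p.g₁ with hG
  set e := Real.exp 1 with he
  have he1 : e < 2.7182818286 := Real.exp_one_lt_d9
  have he0 : 0 < e := Real.exp_pos 1
  have hT0 : 0 < T₀ := hp.T_zero_pos q l
  have hG0 : 0 < G := mul_pos hp.c₂_pos hp.g₁_pos
  have hχ := hp.χ_pos
  have hgb0 : 0 < gb := hp.gbar_pos (by positivity)
  have hTeq : T₀ = (2 * p.c₀ * p.c₃ + p.c₁) * gb := hp.T_zero q l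
  have hc0gb : 6 * (p.c₀ * gb) ≤ T₀ := by
    rw [hTeq, ← mul_assoc]
    exact mul_le_mul_of_nonneg_right hp.scale_bounds.1 hgb0.le
  have hc0 : 0 ≤ p.c₀ * gb := mul_nonneg hp.c₀_nonneg hgb0.le
  have hv3 : 3 * v ≤ T₀ / 4 := by linarith
  have hτ : y + 8 * T₀ ≤ τ := by
    have : y = τ - 4 * p.c₀ * gb - 8 * T₀ := rfl
    linarith
  set a := y / (4 * e * T₀) with ha
  set b := (y / (4 * e * p.c₂ * p.g₁)) ^ (1 / (1 + p.χ)) with hb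
  have ha0 : 0 ≤ a := by positivity
  have hyG : 0 ≤ y / (4 * e * p.c₂ * p.g₁) := by
    have := hp.c₂_pos
    have := hp.g₁_pos
    positivity
  have hb0 : 0 ≤ b := Real.rpow_nonneg hyG _
  have haT : a * T₀ = y / (4 * e) := by rw [ha]; field_simp
  have hbG : b ^ (1 + p.χ) * G = y / (4 * e) := by
    rw [hb, ← Real.rpow_mul hyG, one_div_mul_cancel (by positivity), Real.rpow_one]
    have h1 := hp.c₂_pos.ne'
    have h2 := hp.g₁_pos.ne'
    rw [hG]
    field_simp
  have hEa : Real.exp (-a) ≤ p.errorFn q l y := hp.exp_le_errorFn q l hy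
  have hEb' : p.μ₂ * Real.exp (-b) ≤ p.errorFn q l y := mul_exp_le_errorFn q l y
  have hEb : Real.exp (-b) ≤ p.errorFn q l y :=
    (le_mul_of_one_le_left (Real.exp_pos _).le one_le_μ₂).trans hEb'
  -- In this regime `g₁ ≤ ḡ_{ql}` forces `2c₀c̃₃ + c̃₁ ≤ c̃₂`, so `μ₂ ≥ e` and the error function is
  -- at least `e · e^(-b) ≥ 1`.
  by_cases hA : T₀ < G ∧ b < 1
  · left
    have hg1gb : p.g₁ ≤ gb := hp.g₁_le_gbar (by exact_mod_cast hql)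
    have h1 : 2 * p.c₀ * p.c₃ + p.c₁ ≤ p.c₂ := by
      by_contra! hlt
      have h2 := mul_le_mul hlt.le hg1gb hp.g₁_pos.le hp.scale_pos.le
      rw [← hTeq] at h2
      linarith [hA.1]
    have h2 := hp.exp_one_le_μ₂ h1
    calc (1 : ℝ) = Real.exp 1 * Real.exp (-1) := by rw [← Real.exp_add]; simp
      _ ≤ p.μ₂ * Real.exp (-b) := by
          have := hA.2
          have : 0 ≤ p.μ₂ := zero_le_one.trans one_le_μ₂
          gcongr
      _ ≤ _ := hEb'
  right
  -- The error function is at least `e^(-M)`, so a concentration bound of `e^(-M)` is enough.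
  set M := min a b with hM
  have hEM : Real.exp (-M) ≤ p.errorFn q l y := by
    rcases min_choice a b with h | h <;> rw [hM, h] <;> assumption
  rcases lt_or_ge M 1 with hM1 | hM1
  · refine ⟨1, le_rfl, le_trans ?_ hEM⟩
    -- If `b < 1` this is the negation of `hA`. If `b ≥ 1` then `a < 1`, and `G ≤ b^(1+χ) G = a T₀ ≤
    -- T₀`. The order 1 then achieves a ratio of at most `1/e`.
    have hGT : G ≤ T₀ := by
      rcases lt_or_ge b 1 with hb1 | hb1
      · by_contra! hlt
        exact hA ⟨hlt, hb1⟩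
      · have ha1 : a < 1 := (min_lt_iff.1 hM1).resolve_right (not_lt.2 hb1)
        have h1 : 1 ≤ b ^ (1 + p.χ) := Real.one_le_rpow hb1 (by positivity)
        have h2 : G ≤ b ^ (1 + p.χ) * G := le_mul_of_one_le_left hG0.le h1
        have h3 : a * T₀ ≤ T₀ := mul_le_of_le_one_left hT0.le ha1.le
        linarith
    have hD := hp.commutatorRate_le q l 1
    have hD0 := hp.commutatorRate_pos q l 1
    set D := p.commutatorRate q l 1
    rw [Nat.cast_one, Real.one_rpow, mul_one] at hD
    have hD' : D ≤ 5 / 8 * T₀ := by linarith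
    rw [pow_one, Nat.cast_one, one_mul, div_le_iff₀ (by linarith)]
    have h1 : Real.exp (-1) ≤ Real.exp (-M) := by gcongr
    have h2 : e * Real.exp (-1) = 1 := by rw [he, ← Real.exp_add]; simp
    have h3 : 3 * v + 2 * D ≤ Real.exp (-1) * (τ + 2 * D) := by
      have h4 : e * (3 * v + 2 * D) ≤ τ + 2 * D := by
        calc e * (3 * v + 2 * D) ≤ 3 * (T₀ / 4 + 2 * (5 / 8 * T₀)) :=
              mul_le_mul (by linarith) (by linarith) (by positivity) (by norm_num)
          _ ≤ _ := by linarith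
      calc 3 * v + 2 * D = Real.exp (-1) * (e * (3 * v + 2 * D)) := by
            rw [← mul_assoc, mul_comm (Real.exp (-1)), h2, one_mul]
        _ ≤ _ := mul_le_mul_of_nonneg_left h4 (Real.exp_pos _).le
    refine h3.trans (mul_le_mul_of_nonneg_right h1 (by linarith))
  -- The ratio will be at most `e^(-2)`, and `2m ≥ m + 1 > M` makes up for rounding down. The bounds
  -- `m ≤ a` and `m ≤ b` control the two parts of the commutator rate, each by `y/(4e)`.
  · set m := ⌊M⌋₊ with hm
    have hm1 : 1 ≤ m := Nat.le_floor (by simpa using hM1)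
    have hmM : (m : ℝ) ≤ M := Nat.floor_le (by linarith)
    have hMm : M < m + 1 := Nat.lt_floor_add_one M
    have hm1' : (1 : ℝ) ≤ m := by exact_mod_cast hm1
    refine ⟨m, hm1, le_trans ?_ hEM⟩
    have hD := hp.commutatorRate_le q l m
    have hD0 := hp.commutatorRate_pos q l m
    set D := p.commutatorRate q l m
    have hma : (m : ℝ) * T₀ ≤ y / (4 * e) := by
      rw [← haT]
      exact mul_le_mul_of_nonneg_right (hmM.trans (min_le_left _ _)) hT0.le
    have hmb : (m : ℝ) * (G * (m : ℝ) ^ p.χ) ≤ y / (4 * e) := by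
      rw [← hbG]
      calc (m : ℝ) * (G * (m : ℝ) ^ p.χ) = (m : ℝ) ^ (1 + p.χ) * G := by
            rw [Real.rpow_add (by linarith), Real.rpow_one]; ring
        _ ≤ _ := by
            have := hmM.trans (min_le_right a b)
            gcongr
    have hmD : 2 * (m * D) ≤ 5 / 4 * (y / (4 * e)) := by
      have h1 : m * D ≤ m * (5 / 16 * (T₀ + G * (m : ℝ) ^ p.χ)) :=
        mul_le_mul_of_nonneg_left hD (by linarith)
      have h2 : m * (5 / 16 * (T₀ + G * (m : ℝ) ^ p.χ))
          = 5 / 16 * (m * T₀ + m * (G * (m : ℝ) ^ p.χ)) := by ring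
      linarith
    have hmD0 : 0 < m * D := by positivity
    have h2 : e ^ 2 * (3 * v + 2 * (m * D)) ≤ τ + 2 * (m * D) := by
      have h3 : e ^ 2 * (y / (4 * e)) = e * y / 4 := by field_simp
      have h4 : e ^ 2 ≤ 8 := by
        calc e ^ 2 ≤ 2.7182818286 ^ 2 := pow_le_pow_left₀ he0.le he1.le 2
          _ ≤ 8 := by norm_num
      have h5 : e ^ 2 * (3 * v) ≤ 2 * T₀ := by
        calc e ^ 2 * (3 * v) ≤ 8 * (T₀ / 4) := mul_le_mul h4 hv3 (by positivity) (by norm_num)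
          _ = 2 * T₀ := by ring
      have h6 : e ^ 2 * (2 * (m * D)) ≤ 5 / 4 * (e * y / 4) := by
        rw [← h3]
        calc e ^ 2 * (2 * (m * D)) ≤ e ^ 2 * (5 / 4 * (y / (4 * e))) := by gcongr
          _ = _ := by ring
      have h7 : e * y ≤ 3 * y := mul_le_mul_of_nonneg_right (by linarith) hy
      rw [mul_add]
      linarith
    have hden : 0 < τ + 2 * (m * D) := by linarith
    have h8 : (3 * v + 2 * (m * D)) / (τ + 2 * (m * D)) ≤ Real.exp (-2) := by
      rw [div_le_iff₀ hden]
      have h9 : Real.exp (-2) * e ^ 2 = 1 := by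
        rw [he, ← Real.exp_nat_mul, ← Real.exp_add]; norm_num
      calc 3 * v + 2 * (m * D) = Real.exp (-2) * (e ^ 2 * (3 * v + 2 * (m * D))) := by
            rw [← mul_assoc (Real.exp (-2)), h9, one_mul]
        _ ≤ _ := mul_le_mul_of_nonneg_left h2 (Real.exp_pos _).le
    calc _ ≤ Real.exp (-2) ^ m := pow_le_pow_left₀ (by positivity) h8 m
      _ = Real.exp (m * -2) := by rw [← Real.exp_nat_mul]
      _ ≤ Real.exp (-M) := by
          gcongr
          linarith

end ChainParams

/-! ### Blocks, links and their strengths -/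

/-- The case `r = 0` of `EtaBound`, divided by `ḡ_{y₀}`, which is the smallest of the `ḡ_y` in the
sum. -/
lemma ChainParams.Valid.sum_mul_J_le {p : ChainParams} (hp : p.Valid) {e : ℕ} {η : ℝ}
    (hη : p.EtaBound e η) (y₀ n : ℕ) :
    ∑ y ∈ Finset.Ico y₀ n, ((y : ℝ) ^ (e - 1) + 1) * p.J y
      ≤ η * (((y₀ : ℝ) ^ e + 1) * p.J y₀) := by
  have h0 := hη 0 y₀ n
  rw [Nat.cast_zero, zero_add] at h0
  have hg : 0 < p.gbar (y₀ : ℝ) := hp.gbar_pos (Nat.cast_nonneg _)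
  refine le_of_mul_le_mul_left ?_ hg
  rw [Finset.mul_sum]
  refine (Finset.sum_le_sum fun y hy => ?_).trans (h0.trans (le_of_eq (by ring)))
  have hy' : (y₀ : ℝ) ≤ y := by exact_mod_cast (Finset.mem_Ico.1 hy).1
  rw [zero_add, ← mul_assoc]
  have hJ := hp.J_nonneg y
  have := hp.gbar_mono (Nat.cast_nonneg y₀) hy'
  gcongr

lemma sum_comp_le_sum_range {ι : Type*} {S : Finset ι} {φ : ι → ℕ} {n : ℕ} {f : ℕ → ℝ}
    (hf : ∀ i, 0 ≤ f i) (hφ : ∀ i ∈ S, φ i < n) (hinj : Set.InjOn φ S) :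
    ∑ i ∈ S, f (φ i) ≤ ∑ u ∈ Finset.range n, f u := by
  classical
  rw [← Finset.sum_image (f := f) hinj]
  refine Finset.sum_le_sum_of_subset_of_nonneg (fun u hu => ?_) fun u _ _ => hf u
  obtain ⟨i, hi, rfl⟩ := Finset.mem_image.1 hu
  exact Finset.mem_range.2 (hφ i hi)

/-- The boundary between the windows `s` and `s + 1`. -/
def windowEnd (q l s : ℕ) : ℤ := -((q : ℤ) * l / 2) + (s : ℤ) * l

lemma mem_window {q l s : ℕ} {x : ℤ} :
    x ∈ window q l s ↔ windowEnd q l s - l ≤ x ∧ x < windowEnd q l s := by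
  unfold window windowEnd
  rw [Set.mem_Ico]
  have : ((s : ℤ) - 1) * l = s * l - l := by ring
  rw [this]
  constructor <;> rintro ⟨h1, h2⟩ <;> constructor <;> linarith

lemma windowEnd_succ (q l s : ℕ) : windowEnd q l (s + 1) = windowEnd q l s + l := by
  unfold windowEnd
  push_cast
  ring

lemma windowEnd_mono {q l s s' : ℕ} (h : s ≤ s') : windowEnd q l s ≤ windowEnd q l s' := by
  have : (s : ℤ) * l ≤ s' * l := by exact_mod_cast Nat.mul_le_mul_right l h
  unfold windowEnd
  linarith

lemma windowEnd_zero (q l : ℕ) : windowEnd q l 0 = -((q : ℤ) * l / 2) := by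
  simp [windowEnd]

/-- Evenness of `q` makes the integer division exact, so that the right end of the bulk is the
mirror image of the left end. -/
lemma windowEnd_last {q l : ℕ} (hq : Even q) : windowEnd q l q = (q : ℤ) * l / 2 := by
  obtain ⟨t, rfl⟩ := hq
  have : ((t + t : ℕ) : ℤ) * l = 2 * ((t : ℤ) * l) := by push_cast; ring
  unfold windowEnd
  rw [this]
  omega

lemma window_subset_block {q l s : ℕ} (hq : Even q) : window q l s ⊆ block q l s := by
  intro x hx
  unfold block
  split_ifs with h0 h1
  · subst h0
    rw [mem_window, windowEnd_zero] at hx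
    exact hx.2
  · subst h1
    rw [mem_window, windowEnd_succ, windowEnd_last hq] at hx
    exact Set.mem_Ici.2 (by linarith [hx.1])
  · exact hx

lemma block_lt_of_lt {q l s s' : ℕ} (hq : Even q) (hs' : s' ≤ q + 1) (hss' : s < s')
    {x x' : ℤ} (hx : x ∈ block q l s) (hx' : x' ∈ block q l s') : x < x' := by
  have h1 : x < windowEnd q l s := by
    unfold block at hx
    split_ifs at hx with h0 h1
    · subst h0; rw [windowEnd_zero]; exact hx
    · omega
    · exact (mem_window.1 hx).2
  have h2 : windowEnd q l (s' - 1) ≤ x' := by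
    obtain ⟨t, rfl⟩ : ∃ t, s' = t + 1 := ⟨s' - 1, by omega⟩
    unfold block at hx'
    rw [if_neg (Nat.succ_ne_zero t)] at hx'
    rw [Nat.add_sub_cancel]
    split_ifs at hx' with h1
    · have : t = q := by omega
      subst this
      rw [windowEnd_last hq]; exact hx'
    · have := (mem_window.1 hx').1
      rw [windowEnd_succ] at this
      linarith
  exact h1.trans_le ((windowEnd_mono (by omega)).trans h2)

lemma notMem_block_of_ne {q l s s' : ℕ} (hq : Even q) (hs : s ≤ q + 1) (hs' : s' ≤ q + 1)
    (hss' : s ≠ s') {x : ℤ} (hx : x ∈ block q l s) : x ∉ block q l s' := by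
  intro hx'
  rcases lt_or_gt_of_ne hss' with h | h
  · exact lt_irrefl _ (block_lt_of_lt hq hs' h hx hx')
  · exact lt_irrefl _ (block_lt_of_lt hq hs h hx' hx)

section Terms

variable {Λ : Finset ℤ} {N : ℤ → ℕ}

/-- The terms of the block Hamiltonian `h_s`. -/
noncomputable def blockTerms (Λ : Finset ℤ) (q l s : ℕ) : Finset (Finset Λ) :=
  open Classical in
  Finset.univ.filter fun Z => Z.Nonempty ∧ ∀ x : Λ, x ∈ Z → (x : ℤ) ∈ block q l s

/-- The terms of the coupling `h_{s,s+1}`. -/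
noncomputable def linkTerms (Λ : Finset ℤ) (q l s : ℕ) : Finset (Finset Λ) :=
  open Classical in
  Finset.univ.filter fun Z =>
      (∀ x : Λ, x ∈ Z → (x : ℤ) ∈ window q l s ∪ window q l (s + 1)) ∧
      (∃ x : Λ, x ∈ Z ∧ (x : ℤ) ∈ window q l s) ∧
      (∃ x : Λ, x ∈ Z ∧ (x : ℤ) ∈ window q l (s + 1))

lemma blockHam_eq (h : Finset Λ → ChainOp Λ N) (q l s : ℕ) :
    blockHam h q l s = ∑ Z ∈ blockTerms Λ q l s, h Z := rfl

lemma linkHam_eq (h : Finset Λ → ChainOp Λ N) (q l s : ℕ) :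
    linkHam h q l s = ∑ Z ∈ linkTerms Λ q l s, h Z := rfl

lemma mem_blockTerms {q l s : ℕ} {Z : Finset Λ} : Z ∈ blockTerms Λ q l s ↔
    Z.Nonempty ∧ ∀ x : Λ, x ∈ Z → (x : ℤ) ∈ block q l s := by
  classical
  rw [blockTerms, Finset.mem_filter]
  exact and_iff_right (Finset.mem_univ Z)

lemma mem_linkTerms {q l s : ℕ} {Z : Finset Λ} : Z ∈ linkTerms Λ q l s ↔
    (∀ x : Λ, x ∈ Z → (x : ℤ) ∈ window q l s ∪ window q l (s + 1)) ∧
      (∃ x : Λ, x ∈ Z ∧ (x : ℤ) ∈ window q l s) ∧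
      (∃ x : Λ, x ∈ Z ∧ (x : ℤ) ∈ window q l (s + 1)) := by
  classical
  rw [linkTerms, Finset.mem_filter]
  exact and_iff_right (Finset.mem_univ Z)

lemma mem_block_of_mem_blockTerms {q l s : ℕ} {Z : Finset Λ} (hZ : Z ∈ blockTerms Λ q l s)
    {x : Λ} (hx : x ∈ Z) : (x : ℤ) ∈ block q l s :=
  (mem_blockTerms.1 hZ).2 x hx

lemma mem_block_of_mem_linkTerms {q l s : ℕ} (hq : Even q) {Z : Finset Λ}
    (hZ : Z ∈ linkTerms Λ q l s) {x : Λ} (hx : x ∈ Z) :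
    (x : ℤ) ∈ block q l s ∨ (x : ℤ) ∈ block q l (s + 1) :=
  ((mem_linkTerms.1 hZ).1 x hx).imp (fun h => window_subset_block hq h)
    fun h => window_subset_block hq h

lemma extent_le_of_mem_linkTerms {q l s : ℕ} (hq : Even q) (hq2 : 2 ≤ q) (hs : s ≤ q)
    {Z : Finset Λ} (hZ : Z ∈ linkTerms Λ q l s) : extent Z ≤ q * l := by
  refine extent_le fun x hx => ?_
  have h1 := (mem_linkTerms.1 hZ).1 x hx
  rw [Set.mem_union, mem_window, mem_window, windowEnd_succ] at h1
  have h2 := windowEnd_mono (q := q) (l := l) (Nat.zero_le s)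
  have h3 := windowEnd_mono (q := q) (l := l) hs
  rw [windowEnd_zero] at h2
  rw [windowEnd_last hq] at h3
  have h4 : 2 * (l : ℤ) ≤ (q : ℤ) * l := by exact_mod_cast Nat.mul_le_mul_right l hq2
  have h5 : ((q * l : ℕ) : ℤ) = (q : ℤ) * l := by push_cast; ring
  generalize (q : ℤ) * l = P at *
  omega

/-- A link term contains a pair of sites on the two sides of the boundary. The sum of `J` over such
pairs is done by `η₁` in the right site and by `η₂` in the left one; since `y⁰ + 1 = 2`, the result
is `(η₁/2) · η₂ · 2J(1) = c₀/4`. -/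
lemma sum_norm_linkTerms_le {p : ChainParams} (hp : p.Valid) {h : Finset Λ → ChainOp Λ N}
    (hb : InteractionBound p h) {q l s : ℕ} (hq : Even q) (hq2 : 2 ≤ q) (hs : s ≤ q) :
    ∑ Z ∈ linkTerms Λ q l s, ‖h Z‖ ≤ p.c₀ * p.gbar ((q : ℝ) * l) / 4 := by
  classical
  set c := windowEnd q l s with hc
  have hg : 0 < p.gbar ((q : ℝ) * l) := hp.gbar_pos (by positivity)
  let S : Finset Λ := Finset.univ.filter fun i => (i : ℤ) ∈ window q l s
  let S' : Finset Λ := Finset.univ.filter fun i => (i : ℤ) ∈ window q l (s + 1)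
  have hS : ∀ i ∈ S, c - l ≤ (i : ℤ) ∧ (i : ℤ) < c := fun i hi =>
    mem_window.1 (Finset.mem_filter.1 hi).2
  have hS' : ∀ i ∈ S', c ≤ (i : ℤ) ∧ (i : ℤ) < c + l := fun i hi => by
    have := mem_window.1 (Finset.mem_filter.1 hi).2
    rw [windowEnd_succ, add_sub_cancel_right] at this
    exact this
  have hcover : ∑ Z ∈ linkTerms Λ q l s, ‖h Z‖
      ≤ ∑ t ∈ S ×ˢ S', ∑ Z ∈ termsThrough t.1 t.2 (q * l), ‖h Z‖ := by
    refine sum_le_sum_sum_of_cover (fun _ => norm_nonneg _) fun Z hZ => ?_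
    have hext := extent_le_of_mem_linkTerms hq hq2 hs hZ
    obtain ⟨-, ⟨x, hxZ, hx⟩, ⟨x', hxZ', hx'⟩⟩ := mem_linkTerms.1 hZ
    exact ⟨(x, x'), Finset.mem_product.2 ⟨Finset.mem_filter.2 ⟨Finset.mem_univ _, hx⟩,
      Finset.mem_filter.2 ⟨Finset.mem_univ _, hx'⟩⟩, mem_termsThrough.2 ⟨hxZ, hxZ', hext⟩⟩
  have hinner : ∀ i ∈ S, ∑ i' ∈ S', p.J ((i : ℤ) - i').natAbs
      ≤ p.η₁ / 2 * ((((c - 1 - (i : ℤ)).toNat + 1 : ℕ) + 1 : ℝ)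
        * p.J ((c - 1 - (i : ℤ)).toNat + 1)) := by
    intro i hi
    have hi' := hS i hi
    -- The number of integers strictly between `i` and the boundary `c`; the site `c + w` is then at
    -- distance `u + 1 + w` from `i`.
    set u := (c - 1 - (i : ℤ)).toNat with hu
    have h1 : ∑ i' ∈ S', p.J ((i : ℤ) - i').natAbs
        = ∑ i' ∈ S', (fun w => p.J (u + 1 + w)) ((i' : ℤ) - c).toNat := by
      refine Finset.sum_congr rfl fun i' hi'S => ?_
      have := hS' i' hi'S
      simp only
      congr 1
      omega
    have h2 : ∑ i' ∈ S', (fun w => p.J (u + 1 + w)) ((i' : ℤ) - c).toNat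
        ≤ ∑ w ∈ Finset.range l, p.J (u + 1 + w) := by
      refine sum_comp_le_sum_range (fun w => hp.J_nonneg _) (fun i' hi'S => ?_) ?_
      · have := hS' i' hi'S
        omega
      · intro x hx y hy hxy
        have := hS' x hx
        have := hS' y hy
        simp only at hxy
        exact Subtype.ext (by omega)
    have h3 := hp.sum_mul_J_le hp.bound_η₁ (u + 1) (u + 1 + l)
    rw [Finset.sum_Ico_eq_sum_range, Nat.add_sub_cancel_left] at h3
    simp only [Nat.sub_self, pow_zero, pow_one] at h3
    rw [← Finset.mul_sum] at h3
    rw [h1]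
    refine h2.trans ?_
    linarith
  have houter : ∑ i ∈ S, (((c - 1 - (i : ℤ)).toNat + 1 : ℕ) + 1 : ℝ)
      * p.J ((c - 1 - (i : ℤ)).toNat + 1) ≤ p.η₂ * (2 * p.J 1) := by
    have h1 := sum_comp_le_sum_range (S := S) (φ := fun i => (c - 1 - (i : ℤ)).toNat) (n := l)
      (f := fun u => (((u + 1 : ℕ) : ℝ) + 1) * p.J (u + 1))
      (fun u => mul_nonneg (by positivity) (hp.J_nonneg _)) (fun i hi => ?_) ?_
    · refine h1.trans ?_
      have h3 := hp.sum_mul_J_le hp.bound_η₂ 1 (1 + l)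
      rw [Finset.sum_Ico_eq_sum_range, Nat.add_sub_cancel_left] at h3
      norm_num at h3
      refine le_trans (le_of_eq (Finset.sum_congr rfl fun u _ => ?_)) (h3.trans (le_of_eq ?_))
      · rw [add_comm u 1]; push_cast; ring
      · ring
    · have := hS i hi
      omega
    · intro x hx y hy hxy
      have := hS x hx
      have := hS y hy
      simp only at hxy
      exact Subtype.ext (by omega)
  have hη := hp.one_le_η₁
  calc ∑ Z ∈ linkTerms Λ q l s, ‖h Z‖
      ≤ ∑ t ∈ S ×ˢ S', ∑ Z ∈ termsThrough t.1 t.2 (q * l), ‖h Z‖ := hcover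
    _ ≤ ∑ t ∈ S ×ˢ S', p.gbar ((q : ℝ) * l) * p.J ((t.1 : ℤ) - t.2).natAbs :=
        Finset.sum_le_sum fun t _ => by
          have := hb t.1 t.2 (q * l)
          push_cast at this
          exact this
    _ = p.gbar ((q : ℝ) * l) * ∑ i ∈ S, ∑ i' ∈ S', p.J ((i : ℤ) - i').natAbs := by
        rw [← Finset.mul_sum, Finset.sum_product]
    _ ≤ p.gbar ((q : ℝ) * l) * (p.η₁ / 2 * (p.η₂ * (2 * p.J 1))) := by
        refine mul_le_mul_of_nonneg_left ?_ hg.le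
        refine (Finset.sum_le_sum hinner).trans ?_
        rw [← Finset.mul_sum]
        exact mul_le_mul_of_nonneg_left houter (by linarith)
    _ = _ := by unfold ChainParams.c₀; ring

end Terms

/-! ### The block energy in the ground state -/

section BlockEnergy

open scoped InnerProductSpace

variable {Λ : Finset ℤ} {N : ℤ → ℕ} {h : Finset Λ → ChainOp Λ N} {q l : ℕ}

lemma isSelfAdjoint_finset_sum {ι : Type*} (s : Finset ι) {A : ι → ChainOp Λ N}
    (hA : ∀ i, IsSelfAdjoint (A i)) : IsSelfAdjoint (∑ i ∈ s, A i) :=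
  isSelfAdjoint_sum (R := ChainOp Λ N) s fun i _ => hA i

lemma isSelfAdjoint_blockHam (hsa : ∀ Z, IsSelfAdjoint (h Z)) (s : ℕ) :
    IsSelfAdjoint (blockHam h q l s) := by
  rw [blockHam_eq]; exact isSelfAdjoint_finset_sum _ hsa

lemma isSelfAdjoint_linkHam (hsa : ∀ Z, IsSelfAdjoint (h Z)) (s : ℕ) :
    IsSelfAdjoint (linkHam h q l s) := by
  rw [linkHam_eq]; exact isSelfAdjoint_finset_sum _ hsa

lemma isSelfAdjoint_truncHam (hsa : ∀ Z, IsSelfAdjoint (h Z)) :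
    IsSelfAdjoint (truncHam h q l) :=
  IsSelfAdjoint.add (R := ChainOp Λ N)
    (isSelfAdjoint_finset_sum _ (isSelfAdjoint_blockHam hsa))
    (isSelfAdjoint_finset_sum _ (isSelfAdjoint_linkHam hsa))

lemma actsInside_blockHam (hsupp : ∀ Z, SupportedOn (h Z) Z) {s : ℕ} {X : Set ℤ}
    (hX : block q l s ⊆ X) : ActsInside (blockHam h q l s) X := by
  rw [blockHam_eq]
  exact ActsInside.sum fun Z hZ => (hsupp Z).actsInside fun x hx =>
    hX (mem_block_of_mem_blockTerms hZ hx)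

lemma actsInside_linkHam (hq : Even q) (hsupp : ∀ Z, SupportedOn (h Z) Z) {s : ℕ} {X : Set ℤ}
    (hX : block q l s ⊆ X) (hX' : block q l (s + 1) ⊆ X) : ActsInside (linkHam h q l s) X := by
  rw [linkHam_eq]
  exact ActsInside.sum fun Z hZ => (hsupp Z).actsInside fun x hx =>
    (mem_block_of_mem_linkTerms hq hZ hx).elim (fun h => hX h) fun h => hX' h

lemma commute_sum_sum_of_disjoint (hsupp : ∀ Z, SupportedOn (h Z) Z)
    {F F' : Finset (Finset Λ)} (hd : ∀ Z ∈ F, ∀ Z' ∈ F', Disjoint Z Z') :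
    Commute (∑ Z ∈ F, h Z) (∑ Z ∈ F', h Z) :=
  Commute.sum_left _ _ _ fun Z hZ => Commute.sum_right _ _ _ fun Z' hZ' =>
    (hsupp Z).commute (hsupp Z') (hd Z hZ Z' hZ')

lemma block_subset_compl (hq : Even q) {s s' : ℕ} (hs : s ≤ q + 1) (hs' : s' ≤ q + 1)
    (hss' : s' ≠ s) : block q l s' ⊆ (block q l s)ᶜ :=
  fun _ hx => notMem_block_of_ne hq hs' hs hss' hx

lemma commute_blockHam (hq : Even q) (hsupp : ∀ Z, SupportedOn (h Z) Z) {s s' : ℕ}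
    (hs : s ≤ q + 1) (hs' : s' ≤ q + 1) :
    Commute (blockHam h q l s) (blockHam h q l s') := by
  rcases eq_or_ne s' s with rfl | hne
  · exact Commute.refl _
  rw [blockHam_eq, blockHam_eq]
  refine commute_sum_sum_of_disjoint hsupp fun Z hZ Z' hZ' => ?_
  exact Finset.disjoint_left.2 fun x hx hx' => block_subset_compl hq hs hs' hne
    (mem_block_of_mem_blockTerms hZ' hx') (mem_block_of_mem_blockTerms hZ hx)

lemma commute_blockHam_linkHam (hq : Even q) (hsupp : ∀ Z, SupportedOn (h Z) Z) {s s' : ℕ}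
    (hs : s ≤ q + 1) (hs' : s' + 1 ≤ q + 1) (h1 : s' ≠ s) (h2 : s' + 1 ≠ s) :
    Commute (blockHam h q l s) (linkHam h q l s') := by
  rw [blockHam_eq, linkHam_eq]
  refine commute_sum_sum_of_disjoint hsupp fun Z hZ Z' hZ' => ?_
  refine Finset.disjoint_left.2 fun x hx hx' => ?_
  rcases mem_block_of_mem_linkTerms hq hZ' hx' with hb | hb
  · exact block_subset_compl hq hs (by omega) h1 hb (mem_block_of_mem_blockTerms hZ hx)
  · exact block_subset_compl hq hs hs' h2 hb (mem_block_of_mem_blockTerms hZ hx)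

lemma norm_linkHam_le {p : ChainParams} (hp : p.Valid) (hb : InteractionBound p h)
    (hq : Even q) (hq2 : 2 ≤ q) {s : ℕ} (hs : s ≤ q) :
    ‖linkHam h q l s‖ ≤ p.c₀ * p.gbar ((q : ℝ) * l) / 4 := by
  rw [linkHam_eq]
  exact (norm_sum_le _ _).trans (sum_norm_linkTerms_le hp hb hq hq2 hs)

/-- The ground energy of `A + B + V` with independent `A` and `B`. -/
lemma energyLevel_add_le {A B V : ChainOp Λ N} (hA : IsSelfAdjoint A) (hB : IsSelfAdjoint B)
    (hV : IsSelfAdjoint V) {X : Set ℤ} (hAX : ActsInside A X) (hBX : ActsInside B Xᶜ) {v : ℝ}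
    (hv : ‖V‖ ≤ v) :
    energyLevel (A + B + V) ⊤ 0 ≤ energyLevel A ⊤ 0 + energyLevel B ⊤ 0 + v := by
  obtain ⟨Φ, hΦ0, hΦ⟩ := exists_ground_vector hA
  obtain ⟨Ψ, hΨ0, hΨ⟩ := exists_ground_vector hB
  obtain ⟨Θ, hΘ0, hΘA, hΘB⟩ := exists_joint_eigenvector hAX hBX hΦ0 hΨ0 hΦ hΨ
  have hpos : 0 < ‖Θ‖ ^ 2 := by positivity
  have hsa : IsSelfAdjoint (A + B + V) := IsSelfAdjoint.add (R := ChainOp Λ N)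
    (IsSelfAdjoint.add (R := ChainOp Λ N) hA hB) hV
  have h1 := energyLevel_zero_mul_le hsa (W := ⊤) (fun _ _ => Submodule.mem_top) (x := Θ)
    Submodule.mem_top
  refine le_of_mul_le_mul_right (h1.trans ?_) hpos
  have hre : ∀ c : ℝ, RCLike.re ((c : ℂ) * ((‖Θ‖ : ℝ) : ℂ) ^ 2) = c * ‖Θ‖ ^ 2 := fun c => by
    rw [← Complex.ofReal_pow]
    exact Complex.re_ofReal_mul _ _
  have h2 : RCLike.re ⟪Θ, V Θ⟫_ℂ ≤ v * ‖Θ‖ ^ 2 := by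
    calc RCLike.re ⟪Θ, V Θ⟫_ℂ ≤ ‖Θ‖ * ‖V Θ‖ := re_inner_le_norm _ _
      _ ≤ ‖Θ‖ * (v * ‖Θ‖) := by
          gcongr
          exact (V.le_opNorm Θ).trans (by gcongr)
      _ = _ := by ring
  rw [_root_.add_apply, _root_.add_apply, hΘA, hΘB, inner_add_right, inner_add_right,
    inner_smul_right, inner_smul_right, inner_self_eq_norm_sq_to_K, map_add, map_add]
  have e1 := hre (energyLevel A ⊤ 0)
  have e2 := hre (energyLevel B ⊤ 0)
  calc _ = energyLevel A ⊤ 0 * ‖Θ‖ ^ 2 + energyLevel B ⊤ 0 * ‖Θ‖ ^ 2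
        + RCLike.re ⟪Θ, V Θ⟫_ℂ := congrArg₂ _ (congrArg₂ _ e1 e2) rfl
    _ ≤ _ := by linarith

/-- A ground state of the interaction-truncated Hamiltonian is concentrated at low energies of
each block. -/
lemma norm_sub_blockProj_le {p : ChainParams} (hp : p.Valid) (hb : InteractionBound p h)
    (hsa : ∀ Z, IsSelfAdjoint (h Z)) (hsupp : ∀ Z, SupportedOn (h Z) Z)
    (hlocal : ∀ Z, p.k < Z.card → h Z = 0) (hq : Even q) (hq2 : 2 ≤ q) (hl : 1 ≤ l)
    {Ω : ChainSpace Λ N} (hΩ : IsGroundState (truncHam h q l) ⊤ Ω) {τ : ℝ}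
    (hτ : 0 ≤ p.shiftedCutoff q l τ) {s : ℕ} (hs : s ≤ q + 1) :
    ‖Ω - blockProj h q l τ s Ω‖ ≤ p.errorFn q l (p.shiftedCutoff q l τ) := by
  obtain ⟨-, hΩ1, hΩE⟩ := hΩ
  set gb := p.gbar ((q : ℝ) * l) with hgb
  have hgb0 : 0 < gb := hp.gbar_pos (by positivity)
  have hc0 := hp.c₀_nonneg
  let near : Finset ℕ := (Finset.range (q + 1)).filter fun s' => s' = s ∨ s' + 1 = s
  let far : Finset ℕ := (Finset.range (q + 1)).filter fun s' => ¬ (s' = s ∨ s' + 1 = s)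
  set A := blockHam h q l s with hA
  let V := ∑ s' ∈ near, linkHam h q l s'
  let B := ∑ s' ∈ (Finset.range (q + 2)).erase s, blockHam h q l s'
    + ∑ s' ∈ far, linkHam h q l s'
  have hdec : truncHam h q l = A + B + V := by
    have h1 := Finset.add_sum_erase (Finset.range (q + 2)) (blockHam h q l)
      (Finset.mem_range.2 (by omega : s < q + 2))
    have h2 := Finset.sum_filter_add_sum_filter_not (Finset.range (q + 1))
      (fun s' => s' = s ∨ s' + 1 = s) (linkHam h q l)
    unfold truncHam
    rw [← h1, ← h2]
    simp only [A, B, V, near, far]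
    abel
  have hAsa : IsSelfAdjoint A := isSelfAdjoint_blockHam hsa s
  have hBsa : IsSelfAdjoint B := IsSelfAdjoint.add (R := ChainOp Λ N)
    (isSelfAdjoint_finset_sum _ (isSelfAdjoint_blockHam hsa))
    (isSelfAdjoint_finset_sum _ (isSelfAdjoint_linkHam hsa))
  have hVsa : IsSelfAdjoint V := isSelfAdjoint_finset_sum _ (isSelfAdjoint_linkHam hsa)
  have hfar : ∀ s' ∈ far, s' + 1 ≤ q + 1 ∧ s' ≠ s ∧ s' + 1 ≠ s := fun s' hs' => by
    simp only [far, Finset.mem_filter, Finset.mem_range, not_or] at hs'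
    exact ⟨by omega, hs'.2.1, hs'.2.2⟩
  have hoth : ∀ s' ∈ (Finset.range (q + 2)).erase s, s' ≤ q + 1 ∧ s' ≠ s := fun s' hs' => by
    simp only [Finset.mem_erase, Finset.mem_range] at hs'
    exact ⟨by omega, hs'.1⟩
  have hAB : Commute A B := by
    refine Commute.add_right (Commute.sum_right _ _ _ fun s' hs' => ?_)
      (Commute.sum_right _ _ _ fun s' hs' => ?_)
    · exact commute_blockHam hq hsupp hs (hoth s' hs').1
    · obtain ⟨h1, h2, h3⟩ := hfar s' hs'
      exact commute_blockHam_linkHam hq hsupp hs h1 h2 h3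
  have hAX : ActsInside A (block q l s) := actsInside_blockHam hsupp le_rfl
  have hBX : ActsInside B (block q l s)ᶜ := by
    refine ActsInside.add (ActsInside.sum fun s' hs' => ?_) (ActsInside.sum fun s' hs' => ?_)
    · obtain ⟨h1, h2⟩ := hoth s' hs'
      exact actsInside_blockHam hsupp (block_subset_compl hq hs h1 h2)
    · obtain ⟨h1, h2, h3⟩ := hfar s' hs'
      exact actsInside_linkHam hq hsupp (block_subset_compl hq hs (by omega) h2)
        (block_subset_compl hq hs h1 h3)
  -- The sum of the norms of the individual terms, rather than the norm of `V`: the nested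
  -- commutators are bounded term by term.
  set v := ∑ s' ∈ near, ∑ Z ∈ linkTerms Λ q l s', ‖h Z‖ with hvdef
  have hv0 : 0 ≤ v := Finset.sum_nonneg fun _ _ => Finset.sum_nonneg fun _ _ => norm_nonneg _
  have hnear : ∀ s' ∈ near, s' ≤ q := fun s' hs' => by
    simp only [near, Finset.mem_filter, Finset.mem_range] at hs'
    omega
  have hv : v ≤ p.c₀ * gb / 2 := by
    have h1 : near.card ≤ 2 := by
      refine (Finset.card_le_card (t := {s, s - 1}) fun s' hs' => ?_).trans Finset.card_le_two
      simp only [near, Finset.mem_filter, Finset.mem_range] at hs'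
      simp only [Finset.mem_insert, Finset.mem_singleton]
      omega
    have h2 : v ≤ near.card • (p.c₀ * gb / 4) :=
      Finset.sum_le_card_nsmul _ _ _ fun s' hs' =>
        sum_norm_linkTerms_le hp hb hq hq2 (hnear s' hs')
    rw [nsmul_eq_mul] at h2
    have h3 : (near.card : ℝ) ≤ 2 := by exact_mod_cast h1
    have h4 : 0 ≤ p.c₀ * gb / 4 := by positivity
    linarith [mul_le_mul_of_nonneg_right h3 h4]
  have hVv : ‖V‖ ≤ v := (norm_sum_le _ _).trans (Finset.sum_le_sum fun s' _ => norm_sum_le _ _)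
  have hql : 2 ≤ q * l := by nlinarith
  -- The trivial bound settles the case in which the error function is at least 1.
  have hQ1 : ‖Ω - blockProj h q l τ s Ω‖ ≤ 1 := by
    have h1 : Ω - blockProj h q l τ s Ω = (spectralSubspace A ⊤
        (energyLevel A ⊤ 0 + τ))ᗮ.starProjection Ω := by
      rw [Submodule.starProjection_orthogonal']
      rfl
    rw [h1]
    exact (Submodule.norm_starProjection_apply_le _ _).trans hΩ1.le
  rcases hp.exists_order hql hv0 hv hτ with hE | ⟨m, hm, hE⟩
  · exact hQ1.trans hE
  refine le_trans ?_ hE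
  have hτ0 : 0 ≤ τ := by
    have h1 := hp.T_zero_pos q l
    have h2 : p.shiftedCutoff q l τ = τ - 4 * p.c₀ * gb - 8 * p.T q l 0 := rfl
    have h3 : 0 ≤ p.c₀ * gb := by positivity
    nlinarith
  have hm0 : (0 : ℝ) < m := by exact_mod_cast hm
  refine norm_sub_starProjection_le hAsa hAB hΩ1 (b := energyLevel B ⊤ 0)
    (E₀ := energyLevel (truncHam h q l) ⊤ 0)
    (fun x => energyLevel_zero_mul_le hBsa (fun _ _ => Submodule.mem_top) Submodule.mem_top)
    (by rw [← hdec]; exact hΩE) ?_ hv0 (hp.commutatorRate_pos q l m) hm hτ0 fun j hj => ?_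
  · rw [hdec]
    exact energyLevel_add_le hAsa hBsa hVsa hAX hBX hVv
  -- The growth estimate is used from the radius `ql`, which contains every link term, with exponent
  -- `1/(2m)`.
  · set Γ := (2 : ℝ) ^ p.χ * (p.gbar ((q : ℝ) * l) + p.g₁ * (2 * p.χ * m) ^ p.χ) with hΓ
    have hΓ0 : 0 ≤ Γ := by
      have := hp.g₁_pos
      have := hp.χ_pos
      rw [hΓ, ← hgb]
      positivity
    have hgrow : ∀ r : ℕ, q * l ≤ r →
        p.gbar r ≤ Γ * (((1 : ℝ) + r) / (1 + (q * l : ℕ))) ^ (1 / (2 * m : ℝ)) := fun r hr => by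
      have := hp.gbar_le_mul_rpow hm hr
      rw [Nat.cast_mul] at this ⊢
      exact this
    have hjε : (j : ℝ) * (1 / (2 * m : ℝ)) ≤ 1 / 2 := by
      have : (j : ℝ) ≤ m := by exact_mod_cast hj
      rw [mul_one_div, div_le_div_iff₀ (by positivity) (by norm_num)]
      linarith
    simp only [V, linkHam_eq, map_sum]
    rw [hvdef, Finset.sum_mul]
    refine (norm_sum_le _ _).trans (Finset.sum_le_sum fun s' hs' => ?_)
    rw [Finset.sum_mul]
    refine (norm_sum_le _ _).trans (Finset.sum_le_sum fun Z hZ => ?_)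
    exact norm_commutatorMap_pow_term_le hp hb hsupp hlocal hΓ0 (by positivity) hgrow
      (blockTerms Λ q l s) hjε (extent_le_of_mem_linkTerms hq hq2 (hnear s' hs') hZ)

end BlockEnergy

/-! ### Decay of the error parameters -/

namespace ChainParams

open Filter Asymptotics Topology

variable {p : ChainParams}

/-- The sub-exponential rate `exp (-(τ / (4 e c̃₂ g₁)) ^ (1 / (1 + χ)))`. -/
noncomputable def decay (p : ChainParams) (τ : ℝ) : ℝ :=
  Real.exp (-((τ / (4 * Real.exp 1 * p.c₂ * p.g₁)) ^ (1 / (1 + p.χ))))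

lemma decay_pos (p : ChainParams) (τ : ℝ) : 0 < p.decay τ := Real.exp_pos _

lemma Valid.energyUnit_pos (hp : p.Valid) : 0 < 4 * Real.exp 1 * p.c₂ * p.g₁ := by
  have := hp.c₂_pos
  have := hp.g₁_pos
  positivity

/-- The power `1/(1+χ)` is subadditive, so shifting the cutoff by a constant costs a constant
factor. -/
lemma Valid.decay_sub_le (hp : p.Valid) {A τ : ℝ} (hA : 0 ≤ A) (hτ : A ≤ τ) :
    p.decay (τ - A)
      ≤ Real.exp ((A / (4 * Real.exp 1 * p.c₂ * p.g₁)) ^ (1 / (1 + p.χ))) * p.decay τ := by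
  have hχ := hp.χ_pos
  have hC := hp.energyUnit_pos
  unfold decay
  set C := 4 * Real.exp 1 * p.c₂ * p.g₁
  have h1 : ((τ - A) / C + A / C) ^ (1 / (1 + p.χ))
      ≤ ((τ - A) / C) ^ (1 / (1 + p.χ)) + (A / C) ^ (1 / (1 + p.χ)) :=
    Real.rpow_add_le_add_rpow (div_nonneg (by linarith) hC.le) (by positivity) (by positivity)
      (by rw [div_le_one (by linarith)]; linarith)
  have h2 : (τ - A) / C + A / C = τ / C := by ring
  rw [h2] at h1
  rw [← Real.exp_add]
  exact Real.exp_le_exp.2 (by linarith)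

/-- `T̃` grows only like a power of a logarithm, which `u^(1-s)` beats for `s = 1/(1+χ) < 1`. Hence
the first summand of the error function eventually decays at least as fast as the second. -/
lemma Valid.eventually_scale_le (hp : p.Valid) (q l : ℕ) :
    ∀ᶠ y in atTop, (y / (4 * Real.exp 1 * p.c₂ * p.g₁)) ^ (1 / (1 + p.χ))
      ≤ y / (4 * Real.exp 1 * p.Ttilde q l (y / p.T q l 0)) := by
  have hχ := hp.χ_pos
  have hC := hp.energyUnit_pos
  set C := 4 * Real.exp 1 * p.c₂ * p.g₁
  set s : ℝ := 1 / (1 + p.χ) with hs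
  have hs0 : 0 < s := by positivity
  have hs1 : s < 1 := by rw [hs, div_lt_one (by linarith)]; linarith
  have hT := hp.T_zero_pos q l
  set T₀ := p.T q l 0 with hT₀
  have hK := hp.scale_pos
  set K := 2 * p.c₀ * p.c₃ + p.c₁ with hKdef
  have he := Real.exp_pos 1
  have hlog : (fun u : ℝ => p.g₀ + p.g₁ * Real.log u ^ p.χ) =o[atTop] fun u => u ^ (1 - s) := by
    refine IsLittleO.add ?_ ((isLittleO_log_rpow_rpow_atTop p.χ (by linarith)).const_mul_left _)
    exact isLittleO_const_left.2 (Or.inr (tendsto_norm_atTop_atTop.comp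
      (tendsto_rpow_atTop (by linarith))))
  -- Chosen so that all constants in the closing computation combine to `T₀/2`, matching the lower
  -- bound `T₀/2 · u ≤ y`.
  set c : ℝ := T₀ / 2 / (4 * Real.exp 1 * K * (T₀ / C) ^ s) with hc
  have hc0 : 0 < c := by positivity
  have hb := hlog.bound hc0
  have hu : Tendsto (fun y : ℝ => y / T₀ + (q : ℝ) * l + 1) atTop atTop :=
    tendsto_atTop_add_const_right _ _ (tendsto_atTop_add_const_right _ _
      (tendsto_id.atTop_div_const hT))
  filter_upwards [hu.eventually hb, hu.eventually_ge_atTop (2 * ((q : ℝ) * l + 1)),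
    eventually_gt_atTop 0] with y h1 h2 hy
  set u := y / T₀ + (q : ℝ) * l + 1 with hudef
  have hql : 0 ≤ (q : ℝ) * l := by positivity
  have hu0 : 0 < u := by positivity
  have hyu : y = T₀ * (u - ((q : ℝ) * l + 1)) := by rw [hudef]; field_simp; ring
  have hylow : T₀ / 2 * u ≤ y := by rw [hyu]; nlinarith
  have hyup : y ≤ T₀ * u := by rw [hyu]; nlinarith
  have hTt : p.Ttilde q l (y / T₀) = K * (p.g₀ + p.g₁ * Real.log u ^ p.χ) := rfl
  have hg : p.g₀ + p.g₁ * Real.log u ^ p.χ ≤ c * u ^ (1 - s) := by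
    rw [Real.norm_of_nonneg (Real.rpow_nonneg hu0.le _)] at h1
    exact (Real.le_norm_self _).trans h1
  have hTpos : 0 < p.Ttilde q l (y / T₀) :=
    hT.trans_le (hp.T_zero_le_Ttilde q l (by positivity))
  rw [le_div_iff₀ (by positivity)]
  have h3 : (y / C) ^ s ≤ (T₀ / C) ^ s * u ^ s := by
    rw [← Real.mul_rpow (by positivity) hu0.le]
    refine Real.rpow_le_rpow (by positivity) ?_ hs0.le
    rw [div_mul_eq_mul_div]
    gcongr
  have h4 : 4 * Real.exp 1 * p.Ttilde q l (y / T₀) ≤ 4 * Real.exp 1 * (K * (c * u ^ (1 - s))) := by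
    rw [hTt]
    gcongr
  calc (y / C) ^ s * (4 * Real.exp 1 * p.Ttilde q l (y / T₀))
      ≤ ((T₀ / C) ^ s * u ^ s) * (4 * Real.exp 1 * (K * (c * u ^ (1 - s)))) :=
        mul_le_mul h3 h4 (by positivity) (by positivity)
    _ = (4 * Real.exp 1 * K * (T₀ / C) ^ s) * c * (u ^ s * u ^ (1 - s)) := by ring
    _ = T₀ / 2 * u := by
        rw [← Real.rpow_add hu0, add_sub_cancel, Real.rpow_one, hc,
          mul_div_cancel₀ _ (by positivity)]
    _ ≤ y := hylow

lemma Valid.exists_eps₁_le (hp : p.Valid) (q l : ℕ) :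
    ∃ K : ℝ, 0 ≤ K ∧ ∀ᶠ τ in atTop, p.eps₁ q l τ ≤ K * p.decay τ := by
  have hμ₁ := one_le_μ₁ (p := p)
  have hμ₂ := one_le_μ₂ (p := p)
  set A := 4 * p.c₀ * p.gbar ((q : ℝ) * l) + 8 * p.T q l 0 with hA
  have hA0 : 0 ≤ A := by
    have := hp.c₀_nonneg
    have := hp.gbar_pos (x := (q : ℝ) * l) (by positivity)
    have := hp.T_zero_pos q l
    positivity
  set B := Real.exp ((A / (4 * Real.exp 1 * p.c₂ * p.g₁)) ^ (1 / (1 + p.χ))) with hB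
  refine ⟨2 * q * ((p.μ₁ + p.μ₂) * B), by positivity, ?_⟩
  have hy : Tendsto (fun τ : ℝ => τ - A) atTop atTop := tendsto_atTop_add_const_right _ _ tendsto_id
  filter_upwards [hy.eventually (hp.eventually_scale_le q l), eventually_ge_atTop A] with τ h1 h2
  have hcut : p.shiftedCutoff q l τ = τ - A := by rw [shiftedCutoff, hA]; ring
  have h3 : p.errorFn q l (τ - A) ≤ (p.μ₁ + p.μ₂) * p.decay (τ - A) := by
    have h4 : Real.exp (-((τ - A) / (4 * Real.exp 1 * p.Ttilde q l ((τ - A) / p.T q l 0))))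
        ≤ p.decay (τ - A) := Real.exp_le_exp.2 (by linarith)
    rw [add_mul]
    exact add_le_add (mul_le_mul_of_nonneg_left h4 (by linarith)) le_rfl
  have h5 := hp.decay_sub_le hA0 h2
  rw [eps₁, hcut]
  calc 2 * (q : ℝ) * p.errorFn q l (τ - A)
      ≤ 2 * q * ((p.μ₁ + p.μ₂) * (B * p.decay τ)) := by
        gcongr
        exact h3.trans (mul_le_mul_of_nonneg_left h5 (by linarith))
    _ = _ := by ring

lemma eps₁_nonneg (q l : ℕ) (τ : ℝ) : 0 ≤ p.eps₁ q l τ :=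
  mul_nonneg (by positivity) (errorFn_nonneg _ _ _)

lemma Valid.eps₁_isBigO (hp : p.Valid) (q l : ℕ) :
    (fun τ => p.eps₁ q l τ) =O[atTop] p.decay := by
  obtain ⟨K, hK, h⟩ := hp.exists_eps₁_le q l
  refine IsBigO.of_bound K ?_
  filter_upwards [h] with τ hτ
  rwa [Real.norm_of_nonneg (eps₁_nonneg q l τ), Real.norm_of_nonneg (p.decay_pos τ).le]

lemma Valid.tendsto_decay (hp : p.Valid) : Tendsto p.decay atTop (𝓝 0) := by
  have hχ := hp.χ_pos
  exact Real.tendsto_exp_neg_atTop_nhds_zero.comp ((tendsto_rpow_atTop (by positivity)).comp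
    (tendsto_id.atTop_div_const hp.energyUnit_pos))

/-- For large `τ` both `ε₁/(1 - ε₁) ≤ 2K · decay` and `τ + 2c₀ḡ ≤ 2τ` hold; the constant `8qK` is
their combined effect under the root. -/
lemma Valid.eps₂_isBigO (hp : p.Valid) (q l : ℕ) :
    (fun τ => p.eps₂ q l τ) =O[atTop] fun τ => Real.sqrt τ * Real.exp
      (-((τ / (4 * Real.exp 1 * p.c₂ * p.g₁)) ^ (1 / (1 + p.χ))) / 2) := by
  obtain ⟨K, hK, h⟩ := hp.exists_eps₁_le q l
  have hsmall : ∀ᶠ τ in atTop, K * p.decay τ < 1 / 2 := by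
    have h1 := hp.tendsto_decay.const_mul K
    rw [mul_zero] at h1
    exact h1.eventually_lt_const (by norm_num)
  refine IsBigO.of_bound (Real.sqrt (8 * q * K)) ?_
  filter_upwards [h, hsmall, eventually_ge_atTop (2 * p.c₀ * p.gbar ((q : ℝ) * l)),
    eventually_ge_atTop 0] with τ h1 h2 h3 h4
  have hε0 := eps₁_nonneg (p := p) q l τ
  have hd := p.decay_pos τ
  rw [Real.norm_of_nonneg (show 0 ≤ p.eps₂ q l τ from Real.sqrt_nonneg _),
    Real.norm_of_nonneg (mul_nonneg (Real.sqrt_nonneg _) (Real.exp_pos _).le), Real.exp_half, eps₂,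
    ← Real.sqrt_mul h4, ← Real.sqrt_mul (by positivity)]
  refine Real.sqrt_le_sqrt ?_
  change _ ≤ 8 * q * K * (τ * p.decay τ)
  have h5 : p.eps₁ q l τ / (1 - p.eps₁ q l τ) ≤ 2 * (K * p.decay τ) := by
    rw [div_le_iff₀ (by linarith)]
    nlinarith
  have h6 : 2 * q * (τ + 2 * p.c₀ * p.gbar ((q : ℝ) * l)) ≤ 4 * q * τ := by
    have : (0 : ℝ) ≤ q := Nat.cast_nonneg q
    nlinarith
  have h7 : 0 ≤ 2 * q * (τ + 2 * p.c₀ * p.gbar ((q : ℝ) * l)) := by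
    have := hp.c₀_nonneg
    have := hp.gbar_pos (x := (q : ℝ) * l) (by positivity)
    positivity
  calc _ ≤ 2 * (K * p.decay τ) * (4 * q * τ) := mul_le_mul h5 h6 h7 (by positivity)
    _ = _ := by ring

end ChainParams

/-! ### The effective Hamiltonian -/

section Effective

open scoped InnerProductSpace

variable {Λ : Finset ℤ} {N : ℤ → ℕ} {h : Finset Λ → ChainOp Λ N} {q l : ℕ} {τ : ℝ}

/-- A self-adjoint operator commuting with `A` commutes with the spectral projections of `A`. -/
lemma commute_starProjection_spectralSubspace {A C : ChainOp Λ N} (hC : IsSelfAdjoint C)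
    (hAC : Commute A C) (E : ℝ) : Commute (spectralSubspace A ⊤ E).starProjection C := by
  set S := spectralSubspace A ⊤ E with hS
  -- `C` preserves each eigenspace of `A`, hence `S`; being self-adjoint, it preserves the
  -- orthogonal complement as well.
  have hinv : ∀ x ∈ S, C x ∈ S := by
    have hle : S ≤ S.comap (C : ChainSpace Λ N →ₗ[ℂ] ChainSpace Λ N) :=
      spectralSubspace_le_of_forall fun μ hμ x _ hx => by
        refine mem_spectralSubspace hμ Submodule.mem_top ?_
        have h1 : A (C x) = C (A x) := congrArg (fun f : ChainOp Λ N => f x) hAC.eq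
        change A (C x) = (μ : ℂ) • C x
        rw [h1, hx, map_smul]
    exact fun x hx => hle hx
  ext1 x
  change S.starProjection (C x) = C (S.starProjection x)
  refine Submodule.eq_starProjection_of_mem_orthogonal
    (hinv _ (Submodule.starProjection_apply_mem _ _)) ?_
  rw [← map_sub, Submodule.mem_orthogonal]
  intro y hy
  rw [← hC.inner_apply_left]
  exact (Submodule.mem_orthogonal _ _).1 (Submodule.sub_starProjection_mem_orthogonal x) _
    (hinv y hy)

lemma isSelfAdjoint_blockProj (s : ℕ) : IsSelfAdjoint (blockProj h q l τ s) :=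
  isSelfAdjoint_starProjection _

lemma commute_blockProj_blockHam (hq : Even q) (hsa : ∀ Z, IsSelfAdjoint (h Z))
    (hsupp : ∀ Z, SupportedOn (h Z) Z) {s s' : ℕ} (hs : s ≤ q + 1) (hs' : s' ≤ q + 1) :
    Commute (blockProj h q l τ s) (blockHam h q l s') :=
  commute_starProjection_spectralSubspace (isSelfAdjoint_blockHam hsa s')
    (commute_blockHam hq hsupp hs hs') _

lemma commute_blockProj (hq : Even q) (hsa : ∀ Z, IsSelfAdjoint (h Z))
    (hsupp : ∀ Z, SupportedOn (h Z) Z) {s s' : ℕ} (hs : s ≤ q + 1) (hs' : s' ≤ q + 1) :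
    Commute (blockProj h q l τ s) (blockProj h q l τ s') :=
  commute_starProjection_spectralSubspace (isSelfAdjoint_blockProj s')
    (commute_blockProj_blockHam hq hsa hsupp hs' hs).symm _

lemma commute_listProd {C : ChainOp Λ N} {P : ℕ → ChainOp Λ N} {n : ℕ}
    (hC : ∀ s < n, Commute (P s) C) : Commute ((List.range n).map P).prod C := by
  refine Commute.list_prod_left _ _ fun B hB => ?_
  obtain ⟨s, hs, rfl⟩ := List.mem_map.1 hB
  exact hC s (List.mem_range.1 hs)

/-- A product of commuting orthogonal projections is an orthogonal projection. -/
lemma isStarProjection_listProd {P : ℕ → ChainOp Λ N} (n : ℕ)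
    (hP : ∀ s < n, IsStarProjection (P s))
    (hc : ∀ s < n, ∀ s' < n, Commute (P s) (P s')) :
    IsStarProjection ((List.range n).map P).prod := by
  induction n with
  | zero => simp
  | succ n ih =>
    rw [List.range_succ, List.map_append, List.prod_append, List.map_singleton,
      List.prod_singleton]
    exact IsStarProjection.mul
      (ih (fun s hs => hP s (by omega)) fun s hs s' hs' => hc s (by omega) s' (by omega))
      (hP n (by omega)) (commute_listProd fun s hs => hc s (by omega) n (by omega))

lemma norm_sub_listProd_le {P : ℕ → ChainOp Λ N} {x : ChainSpace Λ N} {E : ℝ} (n : ℕ)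
    (hP : ∀ s < n, ‖P s‖ ≤ 1) (hc : ∀ s < n, ∀ s' < n, Commute (P s) (P s'))
    (hx : ∀ s < n, ‖x - P s x‖ ≤ E) :
    ‖x - ((List.range n).map P).prod x‖ ≤ n * E := by
  induction n with
  | zero => simp
  | succ n ih =>
    have h1 := ih (fun s hs => hP s (by omega))
      (fun s hs s' hs' => hc s (by omega) s' (by omega)) fun s hs => hx s (by omega)
    rw [List.range_succ, List.map_append, List.prod_append, List.map_singleton,
      List.prod_singleton]
    set Q := ((List.range n).map P).prod with hQ
    have hcomm : Commute Q (P n) := commute_listProd fun s hs => hc s (by omega) n (by omega)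
    rw [hcomm.eq]
    -- Commutation lets the contraction `P n` act last, so it cannot enlarge the error accumulated
    -- so far.
    have e : x - (P n * Q) x = (x - P n x) + P n (x - Q x) := by
      rw [map_sub, mul_apply_eq_comp]
      abel
    rw [e]
    calc ‖(x - P n x) + P n (x - Q x)‖ ≤ ‖x - P n x‖ + ‖P n (x - Q x)‖ := norm_add_le _ _
      _ ≤ E + 1 * (n * E) := by
          refine add_le_add (hx n (by omega)) (((P n).le_opNorm _).trans ?_)
          exact mul_le_mul (hP n (by omega)) h1 (norm_nonneg _) zero_le_one
      _ = _ := by push_cast; ring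

lemma isStarProjection_cutoffProj (hq : Even q) (hsa : ∀ Z, IsSelfAdjoint (h Z))
    (hsupp : ∀ Z, SupportedOn (h Z) Z) : IsStarProjection (cutoffProj h q l τ) :=
  isStarProjection_listProd _ (fun _ _ => isStarProjection_starProjection)
    fun _ hs _ hs' => commute_blockProj hq hsa hsupp (by omega) (by omega)

lemma isSelfAdjoint_effHam {Q H : ChainOp Λ N} (hQ : IsSelfAdjoint Q) (hH : IsSelfAdjoint H) :
    IsSelfAdjoint (Q * H * Q) := by
  rw [IsSelfAdjoint, star_mul, star_mul, hQ.star_eq, hH.star_eq, mul_assoc]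

lemma inner_effHam_of_mem (hQ : IsStarProjection (cutoffProj h q l τ)) {x : ChainSpace Λ N}
    (hx : x ∈ cutoffSpace h q l τ) : ⟪x, effHam h q l τ x⟫_ℂ = ⟪x, truncHam h q l x⟫_ℂ := by
  have hQx : cutoffProj h q l τ x = x := by
    obtain ⟨z, rfl⟩ := hx
    exact congrArg (fun f : ChainOp Λ N => f z) hQ.isIdempotentElem.eq
  change ⟪x, cutoffProj h q l τ (truncHam h q l (cutoffProj h q l τ x))⟫_ℂ = _
  rw [← hQ.isSelfAdjoint.inner_apply_left, hQx]

/-- Cutting off a ground state costs little energy. -/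
lemma inner_apply_cutoff_le {Q H₀ L : ChainOp Λ N} (hQ : IsStarProjection Q)
    (hcomm : Commute Q H₀) {Ω : ChainSpace Λ N} {E₀ ℓ : ℝ} (hL : ‖L‖ ≤ ℓ)
    (hΩ : (H₀ + L) Ω = (E₀ : ℂ) • Ω) :
    RCLike.re ⟪Q Ω, (H₀ + L) (Q Ω)⟫_ℂ ≤ E₀ * ‖Q Ω‖ ^ 2 + ℓ * ‖Q Ω‖ * ‖Ω - Q Ω‖ := by
  set x := Q Ω with hx
  set y := Ω - x with hy
  have hQQ : ∀ z, Q (Q z) = Q z := fun z =>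
    congrArg (fun f : ChainOp Λ N => f z) hQ.isIdempotentElem.eq
  have hQsa := hQ.isSelfAdjoint
  have hxΩ : ⟪x, Ω⟫_ℂ = ⟪x, x⟫_ℂ := by
    rw [hx, ← hQsa.inner_apply_left, hQQ]
  -- `H₀` does not couple the range of `Q` to its kernel, so the cost of the cutoff comes from `L`
  -- alone, whatever the size of `H₀`.
  have hxy : ⟪x, H₀ y⟫_ℂ = 0 := by
    have h1 : Q (H₀ y) = H₀ (Q y) := congrArg (fun f : ChainOp Λ N => f y) hcomm.eq
    have h2 : Q y = 0 := by rw [hy, map_sub, hx, hQQ, sub_self]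
    rw [hx, hQsa.inner_apply_left, h1, h2, map_zero, inner_zero_right]
  have hxe : x = Ω - y := by rw [hy]; abel
  have h1 : ⟪x, (H₀ + L) x⟫_ℂ = (E₀ : ℂ) * ⟪x, x⟫_ℂ - ⟪x, L y⟫_ℂ := by
    conv_lhs => rw [show (H₀ + L) x = (E₀ : ℂ) • Ω - (H₀ y + L y) by
      conv_lhs => rw [hxe]
      rw [map_sub, hΩ, _root_.add_apply]]
    rw [inner_sub_right, inner_add_right, hxy, zero_add, inner_smul_right, hxΩ]
  have h2 : -(ℓ * ‖x‖ * ‖y‖) ≤ RCLike.re ⟪x, L y⟫_ℂ := by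
    have h4 := (abs_le.1 ((RCLike.abs_re_le_norm _).trans
      (norm_inner_le_norm (𝕜 := ℂ) x (L y)))).1
    have h5 : ‖x‖ * ‖L y‖ ≤ ‖x‖ * (ℓ * ‖y‖) := by
      gcongr
      exact (L.le_opNorm y).trans (by gcongr)
    linarith
  have h3 : RCLike.re ((E₀ : ℂ) * ⟪x, x⟫_ℂ) = E₀ * ‖x‖ ^ 2 := by
    rw [inner_self_eq_norm_sq_to_K]
    change ((E₀ : ℂ) * ((‖x‖ : ℝ) : ℂ) ^ 2).re = _
    rw [← Complex.ofReal_pow]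
    exact Complex.re_ofReal_mul _ _
  rw [h1, map_sub, h3]
  linarith

/-- A normalized state whose energy is at most `δ` above the ground energy is close to the
ground state, up to a phase. -/
lemma exists_phase_norm_sub_le {H : ChainOp Λ N} (hH : IsSelfAdjoint H) {Ω ψ : ChainSpace Λ N}
    (hΩ : IsGroundState H ⊤ Ω) (hψ : ‖ψ‖ = 1) {δ : ℝ} (hgap : 0 < spectralGap H ⊤)
    (hE : RCLike.re ⟪ψ, H ψ⟫_ℂ ≤ energyLevel H ⊤ 0 + δ) :
    ∃ z : ℂ, ‖z‖ = 1 ∧ ‖Ω - z • ψ‖ ^ 2 ≤ 2 * δ / spectralGap H ⊤ := by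
  obtain ⟨-, hΩ1, hHΩ⟩ := id hΩ
  set E₀ := energyLevel H ⊤ 0 with hE₀
  set α : ℂ := ⟪Ω, ψ⟫_ℂ with hα
  set β := ψ - α • Ω with hβ
  have hΩΩ : ⟪Ω, Ω⟫_ℂ = 1 := by rw [inner_self_eq_norm_sq_to_K, hΩ1]; simp
  have hort : ⟪Ω, β⟫_ℂ = 0 := by
    rw [hβ, inner_sub_right, inner_smul_right, hΩΩ, mul_one, ← hα, sub_self]
  have hψe : ψ = α • Ω + β := by rw [hβ]; abel
  have hort' : ⟪α • Ω, β⟫_ℂ = 0 := by rw [inner_smul_left, hort, mul_zero]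
  have hn : ‖α‖ ^ 2 + ‖β‖ ^ 2 = 1 := by
    have h1 := norm_add_sq_eq_norm_sq_add_norm_sq_of_inner_eq_zero _ _ hort'
    rw [← hψe, hψ, norm_smul, hΩ1] at h1
    nlinarith
  have hHβ : ⟪Ω, H β⟫_ℂ = 0 := by
    rw [← hH.inner_apply_left, hHΩ, inner_smul_left, hort, mul_zero]
  have hβΩ : ⟪β, Ω⟫_ℂ = 0 := inner_eq_zero_symm.1 hort
  have hen : RCLike.re ⟪ψ, H ψ⟫_ℂ = ‖α‖ ^ 2 * E₀ + RCLike.re ⟪β, H β⟫_ℂ := by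
    have h1 : ⟪α • Ω, H (α • Ω)⟫_ℂ = ((‖α‖ ^ 2 * E₀ : ℝ) : ℂ) := by
      rw [map_smul, hHΩ, inner_smul_left, inner_smul_right, inner_smul_right, hΩΩ, mul_one,
        ← mul_assoc, RCLike.conj_mul]
      push_cast
      rfl
    have h2 : ⟪α • Ω, H β⟫_ℂ = 0 := by rw [inner_smul_left, hHβ, mul_zero]
    have h3 : ⟪β, H (α • Ω)⟫_ℂ = 0 := by
      rw [map_smul, hHΩ, inner_smul_right, inner_smul_right, hβΩ, mul_zero, mul_zero]
    rw [hψe, map_add, inner_add_left, inner_add_right, inner_add_right, h1, h2, h3, add_zero,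
      zero_add, map_add]
    congr 1
  have hβ1 := energyLevel_one_mul_le hH hΩ hort
  have hgapdef : spectralGap H ⊤ = energyLevel H ⊤ 1 - E₀ := rfl
  set Δ := spectralGap H ⊤ with hΔ
  -- The component `β` orthogonal to `Ω` costs at least the gap per unit of squared norm.
  have hβδ : ‖β‖ ^ 2 * Δ ≤ δ := by
    have h4 : ‖α‖ ^ 2 = 1 - ‖β‖ ^ 2 := by linarith
    rw [hen, h4] at hE
    rw [hgapdef]
    linarith
  obtain ⟨z, hz1, hz⟩ : ∃ z : ℂ, ‖z‖ = 1 ∧ z * α = ((‖α‖ : ℝ) : ℂ) := by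
    rcases eq_or_ne α 0 with h0 | h0
    · exact ⟨1, by simp, by simp [h0]⟩
    · have h1 : ((‖α‖ : ℝ) : ℂ) ≠ 0 := by exact_mod_cast norm_ne_zero_iff.2 h0
      refine ⟨(starRingEnd ℂ) α / ((‖α‖ : ℝ) : ℂ), ?_, ?_⟩
      · rw [norm_div, RCLike.norm_conj, Complex.norm_real, norm_norm,
          div_self (norm_ne_zero_iff.2 h0)]
      · rw [div_mul_eq_mul_div, Complex.conj_mul', sq, mul_div_assoc, div_self h1, mul_one]
  refine ⟨z, hz1, ?_⟩
  have hα1 : ‖α‖ ≤ 1 := by nlinarith [norm_nonneg α, sq_nonneg ‖β‖]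
  have hre : RCLike.re ⟪Ω, z • ψ⟫_ℂ = ‖α‖ := by
    rw [inner_smul_right, ← hα, hz]
    exact Complex.ofReal_re _
  rw [norm_sub_sq (𝕜 := ℂ), hre, norm_smul, hz1, hΩ1, hψ, le_div_iff₀ hgap]
  -- With the phase making the overlap nonnegative, the squared distance is `2 - 2‖α‖`, at most `2(1
  -- - ‖α‖²) = 2‖β‖²`.
  nlinarith [norm_nonneg α, mul_nonneg (norm_nonneg α) (sub_nonneg.2 hα1)]

variable {p : ChainParams}

lemma eps₁_lt_one (hε : p.eps₁ q l τ ^ 2 ≤ 1 / 2) : p.eps₁ q l τ < 1 := by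
  nlinarith [p.eps₁_nonneg q l τ]

/-- The cutoff raises the ground energy by at most `ε₂²`. -/
lemma energyLevel_effHam_le (hp : p.Valid) (hb : InteractionBound p h)
    (hsa : ∀ Z, IsSelfAdjoint (h Z)) (hsupp : ∀ Z, SupportedOn (h Z) Z)
    (hlocal : ∀ Z, p.k < Z.card → h Z = 0) (hq : Even q) (hq2 : 2 ≤ q) (hl : 1 ≤ l)
    {Ω : ChainSpace Λ N} (hΩ : IsGroundState (truncHam h q l) ⊤ Ω)
    (hτ : 0 ≤ p.shiftedCutoff q l τ) (hε : p.eps₁ q l τ ^ 2 ≤ 1 / 2) :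
    energyLevel (effHam h q l τ) (cutoffSpace h q l τ) 0
      ≤ energyLevel (truncHam h q l) ⊤ 0 + p.eps₂ q l τ ^ 2 := by
  set gb := p.gbar ((q : ℝ) * l) with hgb
  have hgb0 : 0 < gb := hp.gbar_pos (by positivity)
  have hc0 := hp.c₀_nonneg
  have hcg : 0 ≤ p.c₀ * gb := by positivity
  set ε₁ := p.eps₁ q l τ with hε₁
  have hε0 : 0 ≤ ε₁ := p.eps₁_nonneg q l τ
  have hε1 : ε₁ < 1 := eps₁_lt_one hε
  have hq2' : (2 : ℝ) ≤ q := by exact_mod_cast hq2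
  have hτ0 : 0 ≤ τ := by
    have h1 := hp.T_zero_pos q l
    have h2 : p.shiftedCutoff q l τ = τ - 4 * p.c₀ * gb - 8 * p.T q l 0 := rfl
    linarith
  set Q := cutoffProj h q l τ with hQdef
  have hQ : IsStarProjection Q := isStarProjection_cutoffProj hq hsa hsupp
  have hQsa : IsSelfAdjoint Q := hQ.isSelfAdjoint
  -- There are `q + 2` blocks, and `q + 2 ≤ 2q` as `q ≥ 2`.
  have hclose : ‖Ω - Q Ω‖ ≤ ε₁ := by
    have h1 := norm_sub_listProd_le (P := blockProj h q l τ) (x := Ω)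
      (E := p.errorFn q l (p.shiftedCutoff q l τ)) (q + 2)
      (fun s _ => Submodule.starProjection_norm_le _)
      (fun s hs s' hs' => commute_blockProj hq hsa hsupp (by omega) (by omega))
      (fun s hs => norm_sub_blockProj_le hp hb hsa hsupp hlocal hq hq2 hl hΩ hτ (by omega))
    refine h1.trans ?_
    have h2 := ChainParams.errorFn_nonneg (p := p) q l (p.shiftedCutoff q l τ)
    rw [hε₁, ChainParams.eps₁]
    push_cast
    exact mul_le_mul_of_nonneg_right (by linarith) h2
  obtain ⟨-, hΩ1, hHΩ⟩ := hΩ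
  set L := ∑ s ∈ Finset.range (q + 1), linkHam h q l s with hLdef
  set H₀ := ∑ s ∈ Finset.range (q + 2), blockHam h q l s with hH₀
  have hL : ‖L‖ ≤ (q + 1) * (p.c₀ * gb / 4) := by
    refine (norm_sum_le _ _).trans ((Finset.sum_le_card_nsmul _ _ _ fun s hs =>
      norm_linkHam_le hp hb hq hq2 (by rw [Finset.mem_range] at hs; omega)).trans ?_)
    rw [Finset.card_range, nsmul_eq_mul]
    push_cast
    exact le_rfl
  have hcomm : Commute Q H₀ := by
    refine Commute.sum_right _ _ _ fun s hs => commute_listProd fun s' hs' => ?_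
    rw [Finset.mem_range] at hs
    exact commute_blockProj_blockHam hq hsa hsupp (by omega) (by omega)
  have hen := inner_apply_cutoff_le hQ hcomm hL hHΩ
  have hxlow : 1 - ε₁ ≤ ‖Q Ω‖ := by
    have := norm_sub_norm_le Ω (Q Ω)
    rw [hΩ1] at this
    linarith
  have hxpos : 0 < ‖Q Ω‖ := by linarith
  have hEsa : IsSelfAdjoint (effHam h q l τ) :=
    isSelfAdjoint_effHam hQsa (isSelfAdjoint_truncHam hsa)
  have hmem : ∀ z, Q z ∈ cutoffSpace h q l τ := fun z => ⟨z, rfl⟩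
  have h1 := energyLevel_zero_mul_le hEsa (W := cutoffSpace h q l τ)
    (fun x _ => hmem (truncHam h q l (Q x))) (hmem Ω)
  have h2 : ⟪Q Ω, effHam h q l τ (Q Ω)⟫_ℂ = ⟪Q Ω, (H₀ + L) (Q Ω)⟫_ℂ :=
    inner_effHam_of_mem hQ (hmem Ω)
  rw [h2] at h1
  set ℓ : ℝ := (q + 1) * (p.c₀ * gb / 4) with hℓ
  have hℓ0 : 0 ≤ ℓ := by positivity
  -- The Rayleigh quotient of the trial vector `Q Ω`, which is not normalized but has norm at least
  -- `1 - ε₁`.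
  have h3 : energyLevel (effHam h q l τ) (cutoffSpace h q l τ) 0
      ≤ energyLevel (truncHam h q l) ⊤ 0 + ℓ * ‖Ω - Q Ω‖ / ‖Q Ω‖ := by
    refine le_of_mul_le_mul_right ((h1.trans hen).trans (le_of_eq ?_))
      (by positivity : 0 < ‖Q Ω‖ ^ 2)
    field_simp
  refine h3.trans (add_le_add_right ?_ _)
  have h4 : ℓ * ‖Ω - Q Ω‖ / ‖Q Ω‖ ≤ ℓ * ε₁ / (1 - ε₁) := by
    have : 0 < 1 - ε₁ := by linarith
    gcongr
  refine h4.trans ?_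
  have hpos : 0 < 1 - ε₁ := by linarith
  have hbig : 0 ≤ ε₁ / (1 - ε₁) := by positivity
  rw [ChainParams.eps₂, Real.sq_sqrt (mul_nonneg hbig (by positivity)), mul_comm ℓ, mul_div_right_comm]
  refine mul_le_mul_of_nonneg_left ?_ hbig
  rw [hℓ]
  nlinarith [mul_nonneg (by positivity : (0 : ℝ) ≤ q) hτ0,
    mul_le_mul_of_nonneg_right hq2' hcg]

lemma exists_groundState {H : ChainOp Λ N} (hH : IsSelfAdjoint H) :
    ∃ Ω, IsGroundState H ⊤ Ω := by
  obtain ⟨x, hx0, hx⟩ := exists_ground_vector hH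
  refine ⟨((‖x‖⁻¹ : ℝ) : ℂ) • x, Submodule.mem_top, ?_, ?_⟩
  · rw [norm_smul, Complex.norm_real, norm_inv, norm_norm,
      inv_mul_cancel₀ (norm_ne_zero_iff.2 hx0)]
  · rw [map_smul, hx, smul_comm]

end Effective
-- The main theorem
open Classical in
theorem mainTheorem5
    (p : ChainParams) (hk : 1 ≤ p.k) (hχ : 0 < p.χ) (hα : 0 < p.α)
    (hg₀ : 0 < p.g₀) (hg₁ : 0 < p.g₁)
    (hJ0 : p.J 0 = 1) (hJ_nonneg : ∀ r, 0 ≤ p.J r)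
    (hJ_decay : ∀ r : ℕ, ((r : ℝ) ^ 2 + 1) * p.J r ≤ 1 / ((r : ℝ) ^ p.α + 1))
    (hη₁ : 1 ≤ p.η₁) (hη₂ : 1 ≤ p.η₂)
    (hη₁_bound : p.EtaBound 1 p.η₁) (hη₂_bound : p.EtaBound 2 p.η₂)
    (q l : ℕ) (hq : 2 ≤ q) (hq_even : Even q) (hl : 1 ≤ l)
    (Λ : Finset ℤ) (N : ℤ → ℕ)
    (h : Finset Λ → ChainOp Λ N)
    (h_selfAdjoint : ∀ Z, IsSelfAdjoint (h Z))
    (h_supported : ∀ Z, SupportedOn (h Z) Z)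
    (h_local : ∀ Z, p.k < Z.card → h Z = 0)
    (h_bound : ∀ (i i' : Λ) (x : ℕ),
      ∑ Z : Finset Λ with i ∈ Z ∧ i' ∈ Z ∧ ∀ j : Λ, j ∈ Z → |(j : ℤ)| ≤ x, ‖h Z‖
        ≤ p.gbar x * p.J ((i : ℤ) - (i' : ℤ)).natAbs) :
    -- sub-exponential decay of the two error parameters in the cutoff energy
    ((fun τ : ℝ => p.eps₁ q l τ) =O[Filter.atTop]
        (fun τ : ℝ => Real.exp
          (-((τ / (4 * Real.exp 1 * p.c₂ * p.g₁)) ^ (1 / (1 + p.χ)))))) ∧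
    ((fun τ : ℝ => p.eps₂ q l τ) =O[Filter.atTop]
        (fun τ : ℝ => Real.sqrt τ * Real.exp
          (-((τ / (4 * Real.exp 1 * p.c₂ * p.g₁)) ^ (1 / (1 + p.χ))) / 2))) ∧
    -- preservation of the ground state and of the spectral gap
    ∀ τ : ℝ, 0 ≤ p.shiftedCutoff q l τ → p.eps₁ q l τ ^ 2 ≤ 1 / 2 →
      (∀ Ω Ω' : ChainSpace Λ N,
        IsGroundState (truncHam h q l) ⊤ Ω →
        IsGroundState (effHam h q l τ) (cutoffSpace h q l τ) Ω' →
        2 * p.eps₂ q l τ ^ 2 < spectralGap (truncHam h q l) ⊤ →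
        ∃ z : ℂ, ‖z‖ = 1 ∧
          ‖Ω - z • Ω'‖ ≤ Real.sqrt 2 * p.eps₁ q l τ
            + Real.sqrt (2 * spectralGap (truncHam h q l) ⊤)
              / (spectralGap (truncHam h q l) ⊤ - 2 * p.eps₂ q l τ ^ 2) * p.eps₂ q l τ) ∧
      (2 ≤ Module.finrank ℂ (cutoffSpace h q l τ) →
        (1 - p.eps₁ q l τ ^ 2) * spectralGap (truncHam h q l) ⊤ - 2 * p.eps₂ q l τ ^ 2
          ≤ spectralGap (effHam h q l τ) (cutoffSpace h q l τ)) := by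
  have hp : p.Valid := ⟨hk, hχ, hα, hg₀, hg₁, hJ0, hJ_nonneg, hJ_decay, hη₁, hη₂, hη₁_bound,
    hη₂_bound⟩
  have hb : InteractionBound p h := fun i i' x => by
    refine le_trans (le_of_eq (Finset.sum_congr ?_ fun _ _ => rfl)) (h_bound i i' x)
    ext Z
    simp [termsThrough]
  refine ⟨hp.eps₁_isBigO q l, hp.eps₂_isBigO q l, fun τ hτ hε => ?_⟩
  have hHsa : IsSelfAdjoint (truncHam h q l) := isSelfAdjoint_truncHam h_selfAdjoint
  have hQ := isStarProjection_cutoffProj (τ := τ) (l := l) hq_even h_selfAdjoint h_supported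
  have hEsa : IsSelfAdjoint (effHam h q l τ) := isSelfAdjoint_effHam hQ.isSelfAdjoint hHsa
  have hcomp : ∀ x ∈ cutoffSpace h q l τ,
      inner ℂ x (truncHam h q l x) = inner ℂ x (effHam h q l τ x) := fun x hx =>
    (inner_effHam_of_mem hQ hx).symm
  have hmem : ∀ x ∈ cutoffSpace h q l τ, effHam h q l τ x ∈ cutoffSpace h q l τ :=
    fun x _ => ⟨_, rfl⟩
  have hlow : energyLevel (effHam h q l τ) (cutoffSpace h q l τ) 0
      ≤ energyLevel (truncHam h q l) ⊤ 0 + p.eps₂ q l τ ^ 2 := by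
    obtain ⟨Ω, hΩ⟩ := exists_groundState hHsa
    exact energyLevel_effHam_le hp hb h_selfAdjoint h_supported h_local hq_even hq hl hΩ hτ hε
  have hε0 := p.eps₁_nonneg q l τ
  refine ⟨fun Ω Ω' hΩ hΩ' hgap => ?_, fun hdim => ?_⟩
  · have hE2 := sq_nonneg (p.eps₂ q l τ)
    have hΔ : 0 < spectralGap (truncHam h q l) ⊤ := by linarith
    obtain ⟨hΩ'W, hΩ'1, hΩ'E⟩ := hΩ'
    have hen : RCLike.re (inner ℂ Ω' (truncHam h q l Ω'))
        ≤ energyLevel (truncHam h q l) ⊤ 0 + p.eps₂ q l τ ^ 2 := by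
      rw [hcomp Ω' hΩ'W, hΩ'E, inner_smul_right, inner_self_eq_norm_sq_to_K, hΩ'1]
      simpa using hlow
    obtain ⟨z, hz, hzΩ⟩ := exists_phase_norm_sub_le hHsa hΩ hΩ'1 hΔ hen
    refine ⟨z, hz, ?_⟩
    have hε2 : 0 ≤ p.eps₂ q l τ := Real.sqrt_nonneg _
    set Δ := spectralGap (truncHam h q l) ⊤
    -- This is sharper than the claim; shrinking the denominator and adding the `ε₁` term only
    -- weaken it.
    have h1 : ‖Ω - z • Ω'‖ ≤ Real.sqrt (2 * Δ) / Δ * p.eps₂ q l τ := by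
      refine (sq_le_sq₀ (norm_nonneg _) (by positivity)).1 (hzΩ.trans (le_of_eq ?_))
      rw [mul_pow, div_pow, Real.sq_sqrt (by positivity)]
      field_simp
    have h2 : Real.sqrt (2 * Δ) / Δ ≤ Real.sqrt (2 * Δ) / (Δ - 2 * p.eps₂ q l τ ^ 2) :=
      div_le_div_of_nonneg_left (Real.sqrt_nonneg _) (by linarith) (by linarith)
    have h3 := mul_le_mul_of_nonneg_right h2 hε2
    have h4 : 0 ≤ Real.sqrt 2 * p.eps₁ q l τ := by positivity
    linarith
  · have hdim' : 2 ≤ Module.finrank ℂ (⊤ : Submodule ℂ (ChainSpace Λ N)) :=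
      hdim.trans (Submodule.finrank_mono le_top)
    -- The first excited level does not drop and the ground level rises by at most `ε₂²`, so the gap
    -- loses at most `ε₂²`.
    have h1 := energyLevel_le_of_compression hHsa hEsa hmem hcomp (j := 1) (by omega)
    have h0 := energyLevel_zero_le_one hHsa (fun _ _ => Submodule.mem_top) hdim'
    unfold spectralGap
    nlinarith [sq_nonneg (p.eps₂ q l τ), mul_nonneg (sq_nonneg (p.eps₁ q l τ)) (sub_nonneg.2 h0)]
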